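/- Let $n\ge 1$. Cubes in $\mathbb{R}^n$ have sides parallel to the axes, $|Q|$ is the Lebesgue measure of $Q$. Let $w\ge 0$ be a locally integrable function on $\mathbb{R}^n$ with $w>0$ almost everywhere; put $w(E)=\int_E w\,dx$. For $1<r<\infty$, $1/r+1/r'=1$, write $w\in A_r^{loc}$ if $$\sup_{|Q|\le 1}\frac1{|Q|^r}\int_Q w\,dx\Big(\int_Q w^{-r'/r}dx\Big)^{r/r'}<\infty ,$$ and $w\in A_1^{loc}$ if $\sup_{|Q|\le1}\frac1{|Q|}\int_Q w\,dx\;\operatorname{ess\,sup}_{y\in Q}w(y)^{-1}<\infty$. Let $A_\infty^{loc}=\bigcup_{1\le r<\infty}A_r^{loc}$ and, for $w\in A^{loc}_\infty$, let $q_w=\inf\{r\in[1,\infty): w\in A_r^{loc}\}$. Let $L^q_w=L^q(w\,dx)$, where $L^\infty_w=L^\infty$. Let $\mathcal D$ be the space of (real-valued) $C_c^\infty$ functions on $\mathbb{R}^n$, and $\mathcal D'$ the space of complex-valued distributions. For $N\in\{0,1,2,\dots\}$ let $\mathcal D_N^0$ be the set of $\varphi\in\mathcal D$ with $\operatorname{supp}\varphi\subset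 B(0,1)$, $\int\varphi\ne0$ and $\|\partial^\alpha\varphi\|_\infty\le1$ for all $|\alpha|\le N+1$. For $f\in\mathcal D'$ let $$\mathcal M_N^0f(x)=\sup\{|\varphi_t*f(x)|:\ 0<t<1,\ \varphi\in\mathcal D_N^0\},\qquad \varphi_t(x)=t^{-n}\varphi(x/t).$$ For $p\in(0,1]$ let $N_{p,w}=\max\{0,[n(q_w/p-1)]\}+2$, where $[\cdot]$ is the integer part, and for $N\ge N_{p,w}$ let $h^p_{w,N}=\{f\in\mathcal D':\mathcal M^0_Nf\in L^p_w\}$, $\|f\|_{h^p_{w,N}}=\|\mathcal M^0_Nf\|_{L^p_w}$. For $q\in(q_w,\infty]$ and an integer $s\ge0$, a measurable function $a:\mathbb{R}^n\to\mathbb{C}$ is a $(p,q,s)_w$-atom if there is a cube $Q$ with (i) $\operatorname{supp}a\subset Q$, (ii) $\|a\|_{L^q_w}\le w(Q)^{1/q-1/p}$, and (iii) if $|Q|<1$, then $\int a(x)x^\alpha dx=0$ for all multi-indices $|\alpha|\le s$. It is a $(p,q)_w$ single atom if $\|a\|_{L^q_w}\le w(\mathbb{R}^n)^{1/q-1/p}$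 (so $a=0$ a.e. if $w(\mathbb{R}^n)=\infty$). The space $h^{p,q,s}_w$ consists of all $f\in\mathcal D'$ of the form $f=\sum_{i=0}^\infty\lambda_ia_i$ in $\mathcal D'$, where $\lambda_i\in\mathbb{C}$, $\sum_i|\lambda_i|^p<\infty$, $a_0$ is a $(p,q)_w$ single atom and $a_1,a_2,\dots$ are $(p,q,s)_w$-atoms; $\|f\|_{h^{p,q,s}_w}$ is the infimum of $(\sum_{i=0}^\infty|\lambda_i|^p)^{1/p}$ over all such decompositions of $f$. **Theorem.** Let $w\in A_\infty^{loc}$, $q\in(q_w,\infty]$, $p\in(0,1]$, and let $N\ge N_{p,w}$ and $s\ge[n(q_w/p-1)]$ be integers. Then $$h^{p,q,s}_w=h^p_{w,N}=h^p_{w,N_{p,w}}$$ as subsets of $\mathcal D'$, and the three quasi-norms are equivalent: there is a constant $C$, independent of $f$, such that each of $\|f\|_{h^{p,q,s}_w}$, $\|f\|_{h^p_{w,N}}$, $\|f\|_{h^p_{w,N_{p,w}}}$ is at most $C$ times each of the others, for every $f$ in this space. -/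

import Mathlib

open MeasureTheory Filter Topology TopologicalSpace Set
open scoped ENNReal NNReal Distributions

noncomputable section

namespace LocalHardy

/-- Euclidean space `ℝⁿ`. -/
abbrev Rn (n : ℕ) : Type := EuclideanSpace ℝ (Fin n)

/-- The test functions on `ℝⁿ`: smooth, compactly supported, real-valued. -/
abbrev Test (n : ℕ) : Type := 𝓓((⊤ : Opens (Rn n)), ℝ)

/-- The complex-valued distributions on `ℝⁿ`. -/
abbrev Dist (n : ℕ) : Type := 𝓓'((⊤ : Opens (Rn n)), ℂ)

/-- The (closed) cube with sides parallel to the axes, centre `x` and side length `l`. -/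
def cube {n : ℕ} (x : Rn n) (l : ℝ) : Set (Rn n) :=
  {y | ∀ i, |y i - x i| ≤ l / 2}

/-- `Q` is a (nondegenerate) cube with sides parallel to the axes. -/
def IsCube {n : ℕ} (Q : Set (Rn n)) : Prop :=
  ∃ (x : Rn n) (l : ℝ), 0 < l ∧ Q = cube x l

/-- A weight: a nonnegative locally integrable function that is positive almost everywhere. -/
structure IsWeight {n : ℕ} (w : Rn n → ℝ) : Prop where
  nonneg : ∀ x, 0 ≤ w x
  locallyIntegrable : LocallyIntegrable w volume
  ae_pos : ∀ᵐ x ∂(volume : Measure (Rn n)), 0 < w x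

/-- The measure `w(x) dx`; thus `w(E) = wMeasure w E`. -/
def wMeasure {n : ℕ} (w : Rn n → ℝ) : Measure (Rn n) :=
  volume.withDensity fun x => ENNReal.ofReal (w x)

/-- The local `A_p` constant of `w`, the supremum being over all cubes with `|Q| ≤ 1`;
`Real.conjExponent p = p / (p - 1)` is the conjugate exponent of `p`. -/
def localApConst {n : ℕ} (p : ℝ) (w : Rn n → ℝ) : ℝ≥0∞ :=
  ⨆ (Q : Set (Rn n)) (_ : IsCube Q) (_ : volume Q ≤ 1),
    (volume Q ^ p)⁻¹ * (∫⁻ x in Q, ENNReal.ofReal (w x)) *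
      (∫⁻ x in Q, ENNReal.ofReal (w x) ^ (-(Real.conjExponent p / p))) ^ (p / Real.conjExponent p)

/-- The local `A_1` constant of `w`, the supremum being over all cubes with `|Q| ≤ 1`. -/
def localA1Const {n : ℕ} (w : Rn n → ℝ) : ℝ≥0∞ :=
  ⨆ (Q : Set (Rn n)) (_ : IsCube Q) (_ : volume Q ≤ 1),
    (volume Q)⁻¹ * (∫⁻ x in Q, ENNReal.ofReal (w x)) *
      essSup (fun y => (ENNReal.ofReal (w y))⁻¹) (volume.restrict Q)

/-- `w ∈ A_p^loc`, for `1 ≤ p < ∞`. -/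
def IsLocalAp {n : ℕ} (p : ℝ) (w : Rn n → ℝ) : Prop :=
  IsWeight w ∧ ((p = 1 ∧ localA1Const w < ∞) ∨ (1 < p ∧ localApConst p w < ∞))

/-- `w ∈ A_∞^loc`, the union of the classes `A_p^loc` over `1 ≤ p < ∞`. -/
def IsLocalAInfty {n : ℕ} (w : Rn n → ℝ) : Prop :=
  ∃ p : ℝ, 1 ≤ p ∧ IsLocalAp p w

/-- The critical index `q_w`. -/
def criticalIndex {n : ℕ} (w : Rn n → ℝ) : ℝ :=
  sInf {p : ℝ | 1 ≤ p ∧ IsLocalAp p w}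

/-- The integer `[n (q_w / p - 1)]`. -/
def momentOrder {n : ℕ} (p : ℝ) (w : Rn n → ℝ) : ℤ :=
  ⌊(n : ℝ) * (criticalIndex w / p - 1)⌋

/-- `N_{p,w} = max {0, [n (q_w / p - 1)]} + 2`. -/
def hardyOrder {n : ℕ} (p : ℝ) (w : Rn n → ℝ) : ℕ :=
  (max 0 (momentOrder p w)).toNat + 2

/-- The test function `y ↦ φ_t (x - y)`, where `φ_t (z) = t^{-n} φ (z / t)`. -/
def reflectDilate {n : ℕ} (φ : Test n) (t : ℝ) (ht : 0 < t) (x : Rn n) : Test n where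
  toFun := fun y => (t ^ n)⁻¹ * φ (t⁻¹ • (x - y))
  contDiff' := by
    have h := φ.contDiff
    fun_prop
  hasCompactSupport' := by
    have h : HasCompactSupport fun y : Rn n => φ (t⁻¹ • (x - y)) :=
      φ.hasCompactSupport.comp_homeomorph
        ((Homeomorph.subLeft x).trans (Homeomorph.smulOfNeZero t⁻¹ (inv_ne_zero ht.ne')))
    exact h.mul_left
  tsupport_subset' := by simp

/-- The convolution `(φ_t * f)(x)` of a distribution `f` with `φ_t`. -/
def convDilate {n : ℕ} (f : Dist n) (φ : Test n) (t : ℝ) (ht : 0 < t) (x : Rn n) : ℂ :=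
  f (reflectDilate φ t ht x)

/-- The class `𝒟_N^0`: test functions with support in the unit ball, nonzero integral, and
`‖∂^α φ‖_∞ ≤ 1` for `|α| ≤ N + 1`. The partial derivatives of order `k` are the values of the
`k`-th Fréchet derivative on `k`-tuples of vectors of the standard basis. -/
def testClass (n N : ℕ) : Set (Test n) :=
  {φ | tsupport φ ⊆ Metric.ball 0 1 ∧ (∫ x, φ x) ≠ 0 ∧
    ∀ k ≤ N + 1, ∀ (v : Fin k → Fin n) (x : Rn n),
      |iteratedFDeriv ℝ k φ x fun j => EuclideanSpace.single (v j) (1 : ℝ)| ≤ 1}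

/-- The local vertical grand maximal function `ℳ_N^0 f`. -/
def grandMaximal {n : ℕ} (N : ℕ) (f : Dist n) (x : Rn n) : ℝ≥0∞ :=
  ⨆ (t : ℝ) (ht : 0 < t) (_ : t < 1) (φ : Test n) (_ : φ ∈ testClass n N),
    ‖convDilate f φ t ht x‖ₑ

/-- `‖f‖_{h^p_{w,N}} = ‖ℳ_N^0 f‖_{L^p_w}`. -/
def hardyNorm {n : ℕ} (p : ℝ) (w : Rn n → ℝ) (N : ℕ) (f : Dist n) : ℝ≥0∞ :=
  (∫⁻ x, grandMaximal N f x ^ p ∂(wMeasure w)) ^ (1 / p)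

/-- The weighted local Hardy space `h^p_{w,N}`. -/
def hardySpace {n : ℕ} (p : ℝ) (w : Rn n → ℝ) (N : ℕ) : Set (Dist n) :=
  {f | hardyNorm p w N f < ∞}

/-- `(p,q,s)_w`-atoms. -/
def IsAtom {n : ℕ} (p : ℝ) (q : ℝ≥0∞) (s : ℕ) (w : Rn n → ℝ) (a : Rn n → ℂ) : Prop :=
  AEStronglyMeasurable a volume ∧ ∃ Q : Set (Rn n), IsCube Q ∧
    Function.support a ⊆ Q ∧
    eLpNorm a q (wMeasure w) ≤ wMeasure w Q ^ ((q⁻¹).toReal - 1 / p) ∧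
    (volume Q < 1 → ∀ α : Fin n → ℕ, ∑ i, α i ≤ s →
      (∫ x, a x * (∏ i, ((x i : ℝ) : ℂ) ^ α i)) = 0)

/-- `(p,q)_w` single atoms (`[w(ℝⁿ)]^{1/q-1/p}` is `0` when `w(ℝⁿ) = ∞`). -/
def IsSingleAtom {n : ℕ} (p : ℝ) (q : ℝ≥0∞) (w : Rn n → ℝ) (a : Rn n → ℂ) : Prop :=
  AEStronglyMeasurable a volume ∧
    eLpNorm a q (wMeasure w) ≤ wMeasure w univ ^ ((q⁻¹).toReal - 1 / p)

/-- `f = ∑_{i ≥ 0} c_i a_i` in `𝒟'`, where `∑ |c_i|^p < ∞`, `a_0` is a single atom and the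
`a_i`, `i ≥ 1`, are atoms. -/
structure IsAtomicDecomposition {n : ℕ} (p : ℝ) (q : ℝ≥0∞) (s : ℕ) (w : Rn n → ℝ)
    (f : Dist n) (c : ℕ → ℂ) (a : ℕ → Rn n → ℂ) : Prop where
  single : IsSingleAtom p q w (a 0)
  atom : ∀ i, 1 ≤ i → IsAtom p q s w (a i)
  summable : Summable fun i => ‖c i‖ ^ p
  tendsto : ∀ φ : Test n,
    Tendsto (fun m => ∑ i ∈ Finset.range m, c i * ∫ x, a i x * (φ x : ℂ)) atTop (𝓝 (f φ))

/-- The weighted atomic local Hardy space `h^{p,q,s}_w`. -/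
def atomicSpace {n : ℕ} (p : ℝ) (q : ℝ≥0∞) (s : ℕ) (w : Rn n → ℝ) : Set (Dist n) :=
  {f | ∃ c a, IsAtomicDecomposition p q s w f c a}

/-- The quasi-norm of `h^{p,q,s}_w`. -/
def atomicNorm {n : ℕ} (p : ℝ) (q : ℝ≥0∞) (s : ℕ) (w : Rn n → ℝ) (f : Dist n) : ℝ≥0∞ :=
  ⨅ (c : ℕ → ℂ) (a : ℕ → Rn n → ℂ) (_ : IsAtomicDecomposition p q s w f c a),
    ENNReal.ofReal ((∑' i, ‖c i‖ ^ p) ^ (1 / p))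

end LocalHardy

end

/-! The three quasi-norms are compared around a cycle. The test classes shrink as `N` grows, so
`hardyNorm` decreases in `N` (`hardyNorm_anti`). What remains is to bound `hardyNorm` at order
`hardyOrder p w` by the atomic quasi-norm, and the atomic quasi-norm by `hardyNorm` at an arbitrary
order `N`.

From atoms to maximal functions. Put S = max(0, [n(q_w/p - 1)]). The integer part hides the strict
inequality n q_w < p(n + S + 1), which leaves room for an exponent r with q_w < r ≤ q and n r < p(n
+ S + 1) (`exists_exponent`). For this r the measure w dx satisfies the A_r inequality on all balls
of bounded radius (`BallWeight`). Hence it is doubling on such balls with exponent n r, and the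
local maximal function is of weak type (r, r). Kolmogorov's inequality turns this into L^p bounds on
sets of finite measure. Since the test functions act at scales t < 1, they only see a unit
neighbourhood of the cube, so this settles large cubes and single atoms. For a cube of side less
than one, the vanishing moments and Taylor's formula give decay of order n + S + 1 away from the
cube, and the p-th power of that decay beats the doubling growth. As p ≤ 1, the p-th powers of the
majorants of the atoms can simply be added (`exists_hardyNorm_le_of_isAtomicDecomposition`).

From maximal functions to atoms. The Calderón–Zygmund decomposition is not applied to the
distribution f itself. Mollification gives continuous functions g_m → f whose values and bump
averages are bounded by F = M_N^0 f with one constant for all m (`exists_controlled_approximation`).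
The sets Ω_k = {F > 2^k} are open and do not depend on m, and each gets a Whitney family and a
partition of unity. The good part of g_m at height 2^k is g_m off Ω_k; on Ω_k each g_m η_i is
replaced by a bounded function with the same moments, or by zero when the ball lies deep inside Ω_k.
The difference of two consecutive good parts splits into pieces of size at most K 2^k, each
supported near one Whitney ball, with vanishing moments when that ball is small. The differences
telescope to g_m (`exists_pieces`).

Since the balls and the bounds are independent of m, the pieces converge weakly along an
ultrafilter, and dominated convergence of the series gives f = ∑ h_j (`exists_limit_pieces`). This
limit takes the place of a density argument. With Q_j the enlarged cubes and λ_j = K 2^k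
w(Q_j)^{1/p}, the functions h_j/λ_j are bounded atoms, hence atoms for every q, and ∑ λ_j^p is at
most a constant times ∑ 2^{kp} w(Ω_k), which is at most a constant times ∫ F^p w
(`exists_isAtomicDecomposition`). -/

noncomputable section

namespace LocalHardy

/-! ### Distributions as finite sums of functionals of derivatives; convolution with test functions.
-/

section Distributions

variable {n : ℕ}

/-- The translate `y ↦ φ (y - x)` of a test function. -/
def translate (x : Rn n) (φ : Test n) : Test n where
  toFun := fun y => φ (y - x)
  contDiff' := by
    have h := φ.contDiff
    fun_prop
  hasCompactSupport' := φ.hasCompactSupport.comp_homeomorph (Homeomorph.subRight x)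
  tsupport_subset' := by simp

@[simp]
theorem translate_apply (x : Rn n) (φ : Test n) (y : Rn n) : translate x φ y = φ (y - x) := rfl

@[simp]
theorem reflectDilate_apply (φ : Test n) (t : ℝ) (ht : 0 < t) (x y : Rn n) :
    reflectDilate φ t ht x y = (t ^ n)⁻¹ * φ (t⁻¹ • (x - y)) := rfl

theorem reflectDilate_eq_translate (φ : Test n) (t : ℝ) (ht : 0 < t) (x : Rn n) :
    reflectDilate φ t ht x = translate x (reflectDilate φ t ht 0) := by
  ext y
  simp

theorem Test.continuous_iteratedFDeriv (φ : Test n) (i : ℕ) :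
    Continuous (iteratedFDeriv ℝ i φ) :=
  φ.contDiff.continuous_iteratedFDeriv (mod_cast le_top)

/-- The `i`-th derivative of a test function, as a bounded continuous function. -/
def bddDeriv (i : ℕ) (φ : Test n) :
    BoundedContinuousFunction (Rn n) ((Rn n) [×i]→L[ℝ] ℝ) :=
  BoundedContinuousFunction.ofNormedAddCommGroup (iteratedFDeriv ℝ i φ)
    (Test.continuous_iteratedFDeriv φ i)
    ((φ.hasCompactSupport.iteratedFDeriv (𝕜 := ℝ) i).exists_bound_of_continuous
      (Test.continuous_iteratedFDeriv φ i)).choose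
    ((φ.hasCompactSupport.iteratedFDeriv (𝕜 := ℝ) i).exists_bound_of_continuous
      (Test.continuous_iteratedFDeriv φ i)).choose_spec

@[simp]
theorem bddDeriv_apply (i : ℕ) (φ : Test n) (y : Rn n) :
    bddDeriv i φ y = iteratedFDeriv ℝ i φ y := rfl

/-- A linear functional that is bounded by finitely many norms of linear maps into normed spaces
factors as a sum of continuous functionals of these maps. -/
theorem exists_sum_functional {V : Type*} [AddCommGroup V] [Module ℝ V] {m : ℕ}
    {B : Fin (m + 1) → Type*} [∀ i, NormedAddCommGroup (B i)] [∀ i, NormedSpace ℝ (B i)]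
    (J : ∀ i, V →ₗ[ℝ] B i) (hJ : Function.Injective (J 0)) (g : V →ₗ[ℝ] ℂ) (C : ℝ)
    (hg : ∀ v, ‖g v‖ ≤ C * ‖fun i => J i v‖) :
    ∃ Λ : ∀ i, B i →L[ℝ] ℂ, ∀ v, g v = ∑ i, Λ i (J i v) := by
  classical
  let J' : V →ₗ[ℝ] (∀ i, B i) := LinearMap.pi J
  have hJ' : Function.Injective J' := fun a b hab => hJ (congrFun hab 0)
  let e := LinearEquiv.ofInjective J' hJ'
  let lam : LinearMap.range J' →L[ℝ] ℂ :=
    LinearMap.mkContinuous (g ∘ₗ e.symm.toLinearMap) C (by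
      intro x
      have := hg (e.symm x)
      have h2 : J' (e.symm x) = x := congrArg Subtype.val (e.apply_symm_apply x)
      change _ ≤ C * ‖J' (e.symm x)‖ at this
      rw [h2] at this
      exact this)
  -- Hahn–Banach for a functional with values in the finite-dimensional space `ℂ`. The extension to
  -- the whole product is then split into its components by means of the coordinate inclusions.
  obtain ⟨Λ, hΛ⟩ := lam.exist_extension_of_finiteDimensional_range
  refine ⟨fun i => Λ.comp (ContinuousLinearMap.single ℝ B i), fun v => ?_⟩
  have h2 : lam (e v) = Λ (J' v) := by rw [hΛ]; rfl
  have h3 : lam (e v) = g v := by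
    change g (e.symm (e v)) = _
    rw [e.symm_apply_apply]
  rw [← h3, h2]
  simp only [ContinuousLinearMap.comp_apply]
  rw [← map_sum]
  congr 1
  exact (Finset.univ_sum_single (J' v)).symm

/-- On test functions supported in a fixed compact set, a distribution is a finite sum of
continuous functionals of derivatives. -/
theorem exists_deriv_functional (f : Dist n) (K : Compacts (Rn n)) :
    ∃ (m : ℕ) (Λ : ∀ i : Fin (m + 1),
      BoundedContinuousFunction (Rn n) ((Rn n) [×(i : ℕ)]→L[ℝ] ℝ) →L[ℝ] ℂ),
      ∀ φ : Test n, tsupport φ ⊆ K → f φ = ∑ i, Λ i (bddDeriv i φ) := by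
  classical
  have hK : (K : Set (Rn n)) ⊆ ((⊤ : Opens (Rn n)) : Set (Rn n)) := by simp
  let ι : 𝓓_{K}(Rn n, ℝ) →L[ℝ] Test n := TestFunction.ofSupportedInCLM ℝ hK
  let fK : 𝓓_{K}(Rn n, ℝ) →ₗ[ℝ] ℂ :=
    { toFun := fun φ => f (ι φ)
      map_add' := by intro a b; simp
      map_smul' := by intro a b; simp }
  have hfK : Continuous fK := by
    change Continuous fun φ => f (ι φ)
    exact (ContinuousLinearMap.continuous (show Test n →L[ℝ] ℂ from f)).comp ι.continuous
  let q : Seminorm ℝ 𝓓_{K}(Rn n, ℝ) := (normSeminorm ℝ ℂ).comp fK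
  have hq : Continuous q := by
    change Continuous fun φ => ‖fK φ‖
    exact hfK.norm
  -- On test functions supported in a fixed compact set the topology is given by the sup norms of
  -- the derivatives, so the distribution has finite order there.
  obtain ⟨s, C, -, hC⟩ := Seminorm.bound_of_continuous
    (ContDiffMapSupportedIn.withSeminorms ℝ (Rn n) ℝ ⊤ K) q hq
  obtain ⟨m, hm⟩ : ∃ m, ∀ i ∈ s, i ≤ m := ⟨s.sup id, fun i hi => Finset.le_sup (f := id) hi⟩
  obtain ⟨Λ, hΛ⟩ := exists_sum_functional (V := 𝓓_{K}(Rn n, ℝ)) (m := m)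
    (B := fun i => BoundedContinuousFunction (Rn n) ((Rn n) [×(i : ℕ)]→L[ℝ] ℝ))
    (fun i => ContDiffMapSupportedIn.structureMapLM ℝ ⊤ (i : ℕ))
    (ContDiffMapSupportedIn.structureMapLM_zero_injective ℝ) fK C (by
      intro φ
      refine (hC φ).trans ?_
      change (C : ℝ) * (s.sup (ContDiffMapSupportedIn.seminorm ℝ (Rn n) ℝ ⊤ K)) φ ≤ _
      refine mul_le_mul_of_nonneg_left ?_ C.2
      refine Seminorm.finset_sup_apply_le (norm_nonneg _) fun i hi => ?_
      exact norm_le_pi_norm (fun i : Fin (m + 1) =>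
        ContDiffMapSupportedIn.structureMapLM ℝ ⊤ (i : ℕ) φ) ⟨i, Nat.lt_succ_of_le (hm i hi)⟩)
  refine ⟨m, Λ, fun φ hφ => ?_⟩
  let φK : 𝓓_{K}(Rn n, ℝ) :=
    ContDiffMapSupportedIn.of_support_subset φ.contDiff ((subset_tsupport _).trans hφ)
  have h1 : ι φK = φ := by ext y; rfl
  have h2 := hΛ φK
  change f (ι φK) = _ at h2
  rw [h1] at h2
  rw [h2]
  refine Finset.sum_congr rfl fun i _ => ?_
  refine congrArg (Λ i) ?_
  ext1 y
  rw [ContDiffMapSupportedIn.structureMapLM_top_apply]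
  rfl

theorem continuous_bddDeriv_translate (i : ℕ) (φ : Test n) :
    Continuous fun x : Rn n => bddDeriv i (translate x φ) := by
  have hu : UniformContinuous (iteratedFDeriv ℝ i φ) :=
    (φ.hasCompactSupport.iteratedFDeriv (𝕜 := ℝ) i).uniformContinuous_of_continuous
      (Test.continuous_iteratedFDeriv φ i)
  rw [Metric.continuous_iff]
  intro x ε hε
  obtain ⟨δ, hδ, h⟩ := Metric.uniformContinuous_iff.1 hu (ε / 2) (half_pos hε)
  refine ⟨δ, hδ, fun y hy => ?_⟩
  refine lt_of_le_of_lt ((BoundedContinuousFunction.dist_le (half_pos hε).le).2 fun z => ?_)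
    (half_lt_self hε)
  rw [bddDeriv_apply, bddDeriv_apply]
  have e : ∀ x : Rn n, iteratedFDeriv ℝ i (translate x φ) z = iteratedFDeriv ℝ i φ (z - x) :=
    fun x => iteratedFDeriv_comp_sub _ x z
  rw [e, e]
  refine (h ?_).le
  rw [dist_eq_norm] at hy ⊢
  rwa [show z - y - (z - x) = -(y - x) by abel, norm_neg]

theorem tsupport_translate_subset {φ : Test n} {R : ℝ} (hφ : tsupport φ ⊆ Metric.closedBall 0 R)
    {x : Rn n} {r : ℝ} (hx : ‖x‖ ≤ r) :
    tsupport (translate x φ) ⊆ Metric.closedBall 0 (R + r) := by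
  refine closure_minimal (fun y hy => ?_) Metric.isClosed_closedBall
  have : y - x ∈ Metric.closedBall (0 : Rn n) R := hφ (subset_tsupport _ hy)
  rw [mem_closedBall_zero_iff] at this ⊢
  calc ‖y‖ = ‖(y - x) + x‖ := by simp
    _ ≤ ‖y - x‖ + ‖x‖ := norm_add_le _ _
    _ ≤ R + r := add_le_add this hx

theorem exists_tsupport_subset_closedBall (φ : Test n) :
    ∃ R : ℝ, 0 < R ∧ tsupport φ ⊆ Metric.closedBall 0 R := by
  obtain ⟨R, hR⟩ := φ.hasCompactSupport.isCompact.isBounded.subset_closedBall 0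
  exact ⟨max R 1, by positivity, hR.trans (Metric.closedBall_subset_closedBall (le_max_left _ _))⟩

/-- A distribution is continuous along the translates of a test function. -/
theorem continuous_apply_translate (f : Dist n) (φ : Test n) :
    Continuous fun x : Rn n => f (translate x φ) := by
  rw [continuous_iff_continuousAt]
  intro x₀
  obtain ⟨R, -, hR⟩ := exists_tsupport_subset_closedBall φ
  obtain ⟨m, Λ, h⟩ := exists_deriv_functional f
    ⟨Metric.closedBall 0 (R + (‖x₀‖ + 1)), isCompact_closedBall _ _⟩
  have h1 : (fun x : Rn n => f (translate x φ)) =ᶠ[𝓝 x₀] fun x =>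
      ∑ i, Λ i (bddDeriv i (translate x φ)) := by
    filter_upwards [Metric.ball_mem_nhds x₀ one_pos] with x hx
    refine h _ (tsupport_translate_subset hR ?_)
    have : ‖x - x₀‖ < 1 := by simpa [dist_eq_norm] using hx
    calc ‖x‖ = ‖x₀ + (x - x₀)‖ := by simp
      _ ≤ ‖x₀‖ + ‖x - x₀‖ := norm_add_le _ _
      _ ≤ _ := by linarith
  refine ContinuousAt.congr (Continuous.continuousAt ?_) h1.symm
  exact continuous_finsetSum _ fun i _ =>
    (Λ i).continuous.comp (continuous_bddDeriv_translate i φ)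

theorem continuous_convDilate (f : Dist n) (φ : Test n) (t : ℝ) (ht : 0 < t) :
    Continuous (convDilate f φ t ht) := by
  have := continuous_apply_translate f (reflectDilate φ t ht 0)
  refine this.congr fun x => ?_
  rw [convDilate, reflectDilate_eq_translate φ t ht x]

-- A supremum of continuous functions. This makes the maximal function measurable and, more
-- importantly, its superlevel sets open, so that they have Whitney covers.
theorem lowerSemicontinuous_grandMaximal (N : ℕ) (f : Dist n) :
    LowerSemicontinuous (grandMaximal N f) := by
  refine lowerSemicontinuous_iSup fun t => lowerSemicontinuous_iSup fun ht =>
    lowerSemicontinuous_iSup fun _ => lowerSemicontinuous_iSup fun φ =>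
    lowerSemicontinuous_iSup fun _ => ?_
  exact (continuous_enorm.comp (continuous_convDilate f φ t ht)).lowerSemicontinuous

theorem ContinuousLinearMap.map_integral_smul_of_hasCompactSupport {E V W : Type*}
    [TopologicalSpace E] [T2Space E]
    [MeasurableSpace E] [OpensMeasurableSpace E] {μ : Measure E} [IsFiniteMeasureOnCompacts μ]
    [NormedAddCommGroup V] [NormedSpace ℝ V] [CompleteSpace V]
    [NormedAddCommGroup W] [NormedSpace ℝ W] [CompleteSpace W] (L : V →L[ℝ] W) {ψ : E → ℝ}
    (hψ : Continuous ψ) (hψc : HasCompactSupport ψ) {G : E → V} (hG : Continuous G) :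
    L (∫ x, ψ x • G x ∂μ) = ∫ x, ψ x • L (G x) ∂μ := by
  have hc : HasCompactSupport fun x => ψ x • G x := hψc.smul_right
  have h := L.integral_comp_comm ((hψ.smul hG).integrable_of_hasCompactSupport hc (μ := μ))
  simp only [Pi.smul_apply', map_smul] at h
  exact h.symm

theorem hasFDerivAt_integral_smul_comp_sub {E V : Type*} [NormedAddCommGroup E] [NormedSpace ℝ E]
    [MeasurableSpace E] [BorelSpace E] [SecondCountableTopology E] {μ : Measure E}
    [μ.IsAddLeftInvariant] [SFinite μ]
    [NormedAddCommGroup V] [NormedSpace ℝ V] [CompleteSpace V] {ψ : E → ℝ}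
    (hψ : LocallyIntegrable ψ μ) {g : E → V} (hg : ContDiff ℝ 1 g) (hgc : HasCompactSupport g)
    (y : E) :
    HasFDerivAt (fun y => ∫ x, ψ x • g (y - x) ∂μ) (∫ x, ψ x • fderiv ℝ g (y - x) ∂μ) y :=
  hgc.hasFDerivAt_convolution_right (ContinuousLinearMap.lsmul ℝ ℝ) hψ hg y

theorem iteratedFDeriv_integral_smul_comp_sub {E V : Type*} [NormedAddCommGroup E]
    [NormedSpace ℝ E] [MeasurableSpace E] [BorelSpace E] [SecondCountableTopology E]
    {μ : Measure E} [μ.IsAddLeftInvariant] [SFinite μ] [IsFiniteMeasureOnCompacts μ]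
    [IsLocallyFiniteMeasure μ]
    [NormedAddCommGroup V] [NormedSpace ℝ V] [CompleteSpace V] {ψ : E → ℝ}
    (hψ : Continuous ψ) (hψc : HasCompactSupport ψ)
    {g : E → V} (hg : ContDiff ℝ ((⊤ : ℕ∞) : WithTop ℕ∞) g) (hgc : HasCompactSupport g)
    (i : ℕ) (y : E) :
    iteratedFDeriv ℝ i (fun y => ∫ x, ψ x • g (y - x) ∂μ) y
      = ∫ x, ψ x • iteratedFDeriv ℝ i g (y - x) ∂μ := by
  induction i generalizing y with
  | zero =>
    ext v
    rw [iteratedFDeriv_zero_apply, ContinuousMultilinearMap.integral_apply]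
    · simp
    · have hc : HasCompactSupport fun x => ψ x • iteratedFDeriv ℝ 0 g (y - x) :=
        hψc.smul_right
      refine Continuous.integrable_of_hasCompactSupport (hψ.smul ?_) hc
      exact (hg.continuous_iteratedFDeriv (m := 0) (mod_cast le_top)).comp
        (continuous_const.sub continuous_id)
  | succ i ih =>
    rw [iteratedFDeriv_succ_eq_comp_left, Function.comp_apply]
    rw [show iteratedFDeriv ℝ i (fun y => ∫ x, ψ x • g (y - x) ∂μ)
      = fun y => ∫ x, ψ x • iteratedFDeriv ℝ i g (y - x) ∂μ from funext ih]
    rw [(hasFDerivAt_integral_smul_comp_sub hψ.locallyIntegrable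
      (hg.iteratedFDeriv_right (m := 1) (i := i) (mod_cast le_top))
      (hgc.iteratedFDeriv (𝕜 := ℝ) i) y).fderiv]
    -- The next derivative is the uncurrying of the derivative of the previous one; uncurrying is
    -- continuous linear and hence passes through the integral.
    let e := (continuousMultilinearCurryLeftEquiv ℝ (fun _ : Fin (i + 1) => E) V).symm
    have hG : Continuous fun x => fderiv ℝ (iteratedFDeriv ℝ i g) (y - x) :=
      ((hg.iteratedFDeriv_right (m := 1) (i := i) (mod_cast le_top)).continuous_fderiv
        one_ne_zero).comp (continuous_const.sub continuous_id)
    exact ContinuousLinearMap.map_integral_smul_of_hasCompactSupport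
      (μ := μ) (V := E →L[ℝ] (E [×i]→L[ℝ] V)) (W := E [×(i + 1)]→L[ℝ] V)
      (e.toContinuousLinearEquiv : (E →L[ℝ] (E [×i]→L[ℝ] V)) →L[ℝ] (E [×(i + 1)]→L[ℝ] V))
      hψ hψc hG

/-- The convolution of two test functions. -/
def convTest (ψ γ : Test n) : Test n where
  toFun := fun y => ∫ x, ψ x • γ (y - x)
  contDiff' := γ.hasCompactSupport.contDiff_convolution_right (ContinuousLinearMap.lsmul ℝ ℝ)
    (ψ.continuous.locallyIntegrable (μ := volume)) γ.contDiff
  hasCompactSupport' := HasCompactSupport.convolution (ContinuousLinearMap.lsmul ℝ ℝ)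
    (μ := volume) ψ.hasCompactSupport γ.hasCompactSupport
  tsupport_subset' := by simp

theorem convTest_apply (ψ γ : Test n) (y : Rn n) : convTest ψ γ y = ∫ x, ψ x • γ (y - x) := rfl

theorem convTest_comm (ψ γ : Test n) : convTest ψ γ = convTest γ ψ := by
  ext y
  rw [convTest_apply, convTest_apply, ← integral_sub_left_eq_self _ _ y]
  refine integral_congr_ae (Eventually.of_forall fun x => ?_)
  simp [mul_comm]

/-- The derivatives of ψ * γ are Bochner integrals of translated derivatives of γ in the Banach
space of bounded continuous functions. On the relevant compact set `f` is a sum of continuous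
functionals of derivatives, and these commute with such integrals. -/
theorem apply_convTest (f : Dist n) (ψ γ : Test n) :
    f (convTest ψ γ) = ∫ x, ψ x • f (translate x γ) := by
  obtain ⟨R, hR0, hR⟩ := exists_tsupport_subset_closedBall γ
  obtain ⟨r, hr0, hr⟩ := exists_tsupport_subset_closedBall ψ
  obtain ⟨m, Λ, h⟩ := exists_deriv_functional f
    ⟨Metric.closedBall 0 (R + r), isCompact_closedBall _ _⟩
  have hsupp : tsupport (convTest ψ γ) ⊆ Metric.closedBall 0 (R + r) := by
    refine closure_minimal (fun y hy => ?_) Metric.isClosed_closedBall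
    by_contra hy'
    refine hy ?_
    change (∫ x, ψ x • γ (y - x)) = 0
    refine integral_eq_zero_of_ae (Eventually.of_forall fun x => ?_)
    by_cases hx : x ∈ tsupport ψ
    · have h1 : ‖x‖ ≤ r := by simpa using hr hx
      have h2 : y - x ∉ tsupport γ := by
        intro h3
        have h4 : ‖y - x‖ ≤ R := by simpa using hR h3
        refine hy' ?_
        rw [mem_closedBall_zero_iff]
        calc ‖y‖ = ‖(y - x) + x‖ := by simp
          _ ≤ ‖y - x‖ + ‖x‖ := norm_add_le _ _
          _ ≤ _ := by linarith
      simp [image_eq_zero_of_notMem_tsupport h2]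
    · simp [image_eq_zero_of_notMem_tsupport hx]
  rw [h _ hsupp]
  have hderiv : ∀ i, bddDeriv i (convTest ψ γ) = ∫ x, ψ x • bddDeriv i (translate x γ) := by
    intro i
    ext1 y
    have := ContinuousLinearMap.map_integral_smul_of_hasCompactSupport (μ := volume)
      (V := BoundedContinuousFunction (Rn n) ((Rn n) [×(i : ℕ)]→L[ℝ] ℝ))
      (W := (Rn n) [×i]→L[ℝ] ℝ)
      (BoundedContinuousFunction.evalCLM ℝ y) ψ.continuous ψ.hasCompactSupport
      (continuous_bddDeriv_translate i γ)
    refine Eq.trans ?_ this.symm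
    rw [bddDeriv_apply]
    refine (iteratedFDeriv_integral_smul_comp_sub ψ.continuous ψ.hasCompactSupport γ.contDiff
      γ.hasCompactSupport i y).trans ?_
    refine integral_congr_ae (Eventually.of_forall fun x => ?_)
    exact congrArg (fun v => ψ x • v) (iteratedFDeriv_comp_sub _ x y).symm
  have hsum : ∀ i : Fin (m + 1), Λ i (bddDeriv i (convTest ψ γ))
      = ∫ x, ψ x • Λ i (bddDeriv i (translate x γ)) := by
    intro i
    rw [hderiv]
    exact ContinuousLinearMap.map_integral_smul_of_hasCompactSupport
      (μ := volume) (V := BoundedContinuousFunction (Rn n) ((Rn n) [×(i : ℕ)]→L[ℝ] ℝ))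
      (Λ i) ψ.continuous
      ψ.hasCompactSupport (continuous_bddDeriv_translate i γ)
  rw [Finset.sum_congr rfl fun i _ => hsum i, ← integral_finsetSum]
  · refine integral_congr_ae (Eventually.of_forall fun x => ?_)
    simp only
    rw [← Finset.smul_sum]
    by_cases hx : x ∈ tsupport ψ
    · rw [h _ (tsupport_translate_subset hR (by simpa using hr hx))]
    · simp [image_eq_zero_of_notMem_tsupport hx]
  · intro i _
    have hc : HasCompactSupport fun x => ψ x • Λ i (bddDeriv i (translate x γ)) :=
      ψ.hasCompactSupport.smul_right
    exact (ψ.continuous.smul ((Λ i).continuous.comp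
      (continuous_bddDeriv_translate i γ))).integrable_of_hasCompactSupport hc

end Distributions

/-! ### Control of a distribution by its grand maximal function; uniformly controlled
mollifications. -/

section Smoothing

variable {n : ℕ}

theorem norm_iteratedFDeriv_comp_affine_le {E V : Type*} [NormedAddCommGroup E] [NormedSpace ℝ E]
    [NormedAddCommGroup V] [NormedSpace ℝ V] {g : E → V}
    (hg : ContDiff ℝ ((⊤ : ℕ∞) : WithTop ℕ∞) g) (z : E) (c : ℝ) (k : ℕ) (u : E) :
    ‖iteratedFDeriv ℝ k (fun u => g (z + c • u)) u‖
      ≤ |c| ^ k * ‖iteratedFDeriv ℝ k g (z + c • u)‖ := by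
  let L : E →L[ℝ] E := c • ContinuousLinearMap.id ℝ E
  have hg' : ContDiff ℝ ((⊤ : ℕ∞) : WithTop ℕ∞) fun u => g (z + u) := by fun_prop
  have h := L.iteratedFDeriv_comp_right hg' u (i := k) (mod_cast le_top)
  have h2 : iteratedFDeriv ℝ k (fun u => g (z + c • u)) u
      = (iteratedFDeriv ℝ k g (z + c • u)).compContinuousLinearMap fun _ => L := by
    rw [← iteratedFDeriv_comp_add_left]
    exact h
  rw [h2]
  refine (ContinuousMultilinearMap.norm_compContinuousLinearMap_le _ _).trans ?_
  rw [mul_comm, Finset.prod_const, Finset.card_univ, Fintype.card_fin]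
  gcongr
  refine (norm_smul_le _ _).trans ?_
  rw [Real.norm_eq_abs]
  exact mul_le_of_le_one_right (abs_nonneg _) ContinuousLinearMap.norm_id_le

/-- A nonnegative test function with integral `1`, supported in the open unit ball. -/
theorem exists_mollifier (n : ℕ) : ∃ η : Test n, (∀ x, 0 ≤ η x) ∧ (∫ x, η x) = 1 ∧
    tsupport η ⊆ Metric.closedBall 0 (1 / 2) := by
  let b : ContDiffBump (0 : Rn n) := ⟨1 / 4, 1 / 2, by norm_num, by norm_num⟩
  refine ⟨⟨b.normed volume, b.contDiff_normed, b.hasCompactSupport_normed, by simp⟩,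
    fun x => b.nonneg_normed x, b.integral_normed, ?_⟩
  exact (b.tsupport_normed_eq (μ := volume)).subset

theorem exists_deriv_bound (φ : Test n) (m : ℕ) :
    ∃ D : ℝ, 0 < D ∧ ∀ k ≤ m, ∀ x, ‖iteratedFDeriv ℝ k φ x‖ ≤ D := by
  have h : ∀ k, ∃ D : ℝ, ∀ x, ‖iteratedFDeriv ℝ k φ x‖ ≤ D := fun k =>
    (φ.hasCompactSupport.iteratedFDeriv (𝕜 := ℝ) k).exists_bound_of_continuous
      (Test.continuous_iteratedFDeriv φ k)
  choose D hD using h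
  refine ⟨1 + ∑ k ∈ Finset.range (m + 1), |D k|,
    by positivity, fun k hk x => ?_⟩
  have := Finset.single_le_sum (f := fun k => |D k|) (fun i _ => abs_nonneg _)
    (Finset.mem_range.2 (Nat.lt_succ_of_le hk))
  have h2 := (hD k x).trans (le_abs_self _)
  linarith

theorem norm_iteratedFDeriv_apply_single_le {g : Rn n → ℝ} (k : ℕ) (v : Fin k → Fin n)
    (x : Rn n) :
    |iteratedFDeriv ℝ k g x fun j => EuclideanSpace.single (v j) (1 : ℝ)|
      ≤ ‖iteratedFDeriv ℝ k g x‖ := by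
  refine ((iteratedFDeriv ℝ k g x).le_opNorm _).trans ?_
  simp

theorem testClass_nonempty (n N : ℕ) : (testClass n N).Nonempty := by
  obtain ⟨η, -, h1, h2⟩ := exists_mollifier n
  obtain ⟨D, hD, h⟩ := exists_deriv_bound η (N + 1)
  refine ⟨D⁻¹ • η, ?_, ?_, ?_⟩
  · refine (tsupport_smul_subset_right (fun _ => D⁻¹) η).trans (h2.trans ?_)
    exact Metric.closedBall_subset_ball (by norm_num)
  · change (∫ x, D⁻¹ * η x) ≠ 0
    rw [integral_const_mul, h1]
    positivity
  · intro k hk v x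
    have e : iteratedFDeriv ℝ k (⇑(D⁻¹ • η)) x = D⁻¹ • iteratedFDeriv ℝ k η x :=
      iteratedFDeriv_const_smul_apply (f := η) (η.contDiff.contDiffAt.of_le (mod_cast le_top))
    refine (norm_iteratedFDeriv_apply_single_le k v x).trans ?_
    rw [e, norm_smul, norm_inv, Real.norm_of_nonneg hD.le]
    exact inv_mul_le_one_of_le₀ (h k hk x) hD.le

theorem convDilate_combination (f : Dist n) (φ ψ : Test n) (a b t : ℝ) (ht : 0 < t) (z : Rn n) :
    convDilate f (a • φ + b • ψ) t ht z
      = a • convDilate f φ t ht z + b • convDilate f ψ t ht z := by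
  have : reflectDilate (a • φ + b • ψ) t ht z
      = a • reflectDilate φ t ht z + b • reflectDilate ψ t ht z := by
    ext y
    change (t ^ n)⁻¹ * (a * φ _ + b * ψ _) = a * ((t ^ n)⁻¹ * φ _) + b * ((t ^ n)⁻¹ * ψ _)
    ring
  simp only [convDilate, this, map_add, map_smul]

/-- The condition `∫ φ ≠ 0` plays no role in estimates by the grand maximal function. -/
theorem norm_convDilate_le {f : Dist n} {N : ℕ} {z : Rn n} {t Λ : ℝ} (ht : 0 < t) (ht1 : t < 1)
    (hΛ : 0 ≤ Λ) (hF : grandMaximal N f z ≤ ENNReal.ofReal Λ) {φ : Test n}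
    (hφ : tsupport φ ⊆ Metric.ball 0 1)
    (hd : ∀ k ≤ N + 1, ∀ (v : Fin k → Fin n) (x : Rn n),
      |iteratedFDeriv ℝ k φ x fun j => EuclideanSpace.single (v j) (1 : ℝ)| ≤ 1) :
    ‖convDilate f φ t ht z‖ ≤ Λ := by
  have key : ∀ φ ∈ testClass n N, ‖convDilate f φ t ht z‖ ≤ Λ := by
    intro φ hφ
    have h1 : ‖convDilate f φ t ht z‖ₑ ≤ grandMaximal N f z :=
      le_iSup_of_le t <| le_iSup_of_le ht <| le_iSup_of_le ht1 <| le_iSup_of_le φ <|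
        le_iSup_of_le hφ le_rfl
    have h2 := h1.trans hF
    rwa [← ofReal_norm, ENNReal.ofReal_le_ofReal_iff hΛ] at h2
  by_cases hint : (∫ x, φ x) = 0
  -- If φ has integral zero, then (1 - δ)φ + δφ₀ is admissible for 0 < δ < 1: the derivative bounds
  -- are convex and the integral equals δ∫φ₀. The estimate passes to the limit δ → 0.
  · obtain ⟨φ₀, h1, h2, h3⟩ := testClass_nonempty n N
    have hmem : ∀ δ ∈ Ioo (0 : ℝ) 1, (1 - δ) • φ + δ • φ₀ ∈ testClass n N := by
      intro δ hδ
      refine ⟨?_, ?_, ?_⟩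
      · refine (tsupport_add ((1 - δ) • φ) (δ • φ₀)).trans (union_subset ?_ ?_)
        · exact (tsupport_smul_subset_right (fun _ => 1 - δ) φ).trans hφ
        · exact (tsupport_smul_subset_right (fun _ => δ) φ₀).trans h1
      · change (∫ x, ((1 - δ) * φ x + δ * φ₀ x)) ≠ 0
        rw [integral_add, integral_const_mul, integral_const_mul, hint]
        · simpa using ⟨hδ.1.ne', h2⟩
        · exact (φ.continuous.integrable_of_hasCompactSupport φ.hasCompactSupport).const_mul _
        · exact (φ₀.continuous.integrable_of_hasCompactSupport φ₀.hasCompactSupport).const_mul _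
      · intro k hk v x
        have c1 : ContDiffAt ℝ k φ x := φ.contDiff.contDiffAt.of_le (mod_cast le_top)
        have c2 : ContDiffAt ℝ k φ₀ x := φ₀.contDiff.contDiffAt.of_le (mod_cast le_top)
        have e : iteratedFDeriv ℝ k (⇑((1 - δ) • φ + δ • φ₀)) x
            = (1 - δ) • iteratedFDeriv ℝ k φ x + δ • iteratedFDeriv ℝ k φ₀ x := by
          rw [← iteratedFDeriv_const_smul_apply c1, ← iteratedFDeriv_const_smul_apply c2]
          exact iteratedFDeriv_add_apply (f := (1 - δ) • ⇑φ) (g := δ • ⇑φ₀)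
            (c1.const_smul (1 - δ)) (c2.const_smul δ)
        rw [e]
        rw [add_apply, smul_apply,
          smul_apply, smul_eq_mul, smul_eq_mul]
        refine (abs_add_le _ _).trans ?_
        rw [abs_mul, abs_mul, abs_of_pos hδ.1, abs_of_pos (by linarith [hδ.2] : 0 < 1 - δ)]
        have a1 := mul_le_mul_of_nonneg_left (hd k hk v x) (by linarith [hδ.2] : 0 ≤ 1 - δ)
        have a2 := mul_le_mul_of_nonneg_left (h3 k hk v x) hδ.1.le
        linarith
    have hlim : Tendsto (fun δ : ℝ => ‖(1 - δ) • convDilate f φ t ht z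
        + δ • convDilate f φ₀ t ht z‖) (𝓝[>] 0) (𝓝 ‖convDilate f φ t ht z‖) := by
      have : Continuous fun δ : ℝ => ‖(1 - δ) • convDilate f φ t ht z
        + δ • convDilate f φ₀ t ht z‖ := by fun_prop
      have h := this.tendsto 0
      simp only [sub_zero, one_smul, zero_smul, add_zero] at h
      exact h.mono_left nhdsWithin_le_nhds
    refine le_of_tendsto hlim ?_
    filter_upwards [Ioo_mem_nhdsGT one_pos] with δ hδ
    rw [← convDilate_combination]
    exact key _ (hmem δ hδ)
  · exact key φ ⟨hφ, hint, hd⟩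

/-- A distribution is controlled by its grand maximal function at a nearby point. -/
theorem norm_apply_le_of_deriv_bound {f : Dist n} {N : ℕ} {z : Rn n} {τ Λ B : ℝ} (hτ : 0 < τ)
    (hτ1 : τ < 1) (hΛ : 0 ≤ Λ) (hF : grandMaximal N f z ≤ ENNReal.ofReal Λ) {Θ : Test n}
    (hs : tsupport Θ ⊆ Metric.ball z τ)
    (hB : ∀ k ≤ N + 1, ∀ y, τ ^ k * ‖iteratedFDeriv ℝ k Θ y‖ ≤ B) :
    ‖f Θ‖ ≤ B * Λ * τ ^ n := by
  have hB0 : 0 ≤ B := le_trans (by positivity) (hB 0 (by omega) 0)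
  rcases hB0.eq_or_lt with rfl | hBpos
  · have : Θ = 0 := by
      ext y
      have := hB 0 (by omega) y
      simpa using this
    simp [this]
  -- Transporting Θ to the unit ball by u ↦ z - τu and dividing by B gives an admissible profile
  -- with Θ = B τ^n φ_τ(z - ·). The reflection is needed because the convolution at z tests against
  -- y ↦ φ_τ(z - y).
  let φ : Test n :=
    { toFun := fun u => B⁻¹ * Θ (z + (-τ) • u)
      contDiff' := by
        have h := Θ.contDiff
        fun_prop
      hasCompactSupport' := by
        have h : HasCompactSupport fun u : Rn n => Θ (z + (-τ) • u) :=
          Θ.hasCompactSupport.comp_homeomorph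
            ((Homeomorph.smulOfNeZero (-τ) (neg_ne_zero.2 hτ.ne')).trans (Homeomorph.addLeft z))
        exact h.mul_left
      tsupport_subset' := by simp }
  have hφ : tsupport φ ⊆ Metric.ball 0 1 := by
    have hc : Continuous fun u : Rn n => z + (-τ) • u := by fun_prop
    have h1 : tsupport φ ⊆ (fun u : Rn n => z + (-τ) • u) ⁻¹' tsupport Θ := by
      refine closure_minimal (fun u hu => ?_) ((isClosed_tsupport _).preimage hc)
      refine subset_tsupport _ ?_
      intro h0
      exact hu (by change B⁻¹ * Θ (z + (-τ) • u) = 0; rw [h0, mul_zero])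
    intro u hu
    have h2 := hs (h1 hu)
    rw [Metric.mem_ball, dist_eq_norm, add_sub_cancel_left, norm_smul, norm_neg,
      Real.norm_of_nonneg hτ.le] at h2
    rw [mem_ball_zero_iff]
    by_contra h3
    push Not at h3
    nlinarith
  have hd : ∀ k ≤ N + 1, ∀ (v : Fin k → Fin n) (x : Rn n),
      |iteratedFDeriv ℝ k φ x fun j => EuclideanSpace.single (v j) (1 : ℝ)| ≤ 1 := by
    intro k hk v x
    refine (norm_iteratedFDeriv_apply_single_le k v x).trans ?_
    have c1 : ContDiffAt ℝ k (fun u : Rn n => Θ (z + (-τ) • u)) x := by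
      have h : ContDiff ℝ ((⊤ : ℕ∞) : WithTop ℕ∞) (fun u : Rn n => Θ (z + (-τ) • u)) := by
        have h := Θ.contDiff
        fun_prop
      exact h.contDiffAt.of_le (mod_cast le_top)
    have e : iteratedFDeriv ℝ k φ x = B⁻¹ • iteratedFDeriv ℝ k
        (fun u : Rn n => Θ (z + (-τ) • u)) x := iteratedFDeriv_const_smul_apply (a := B⁻¹) c1
    rw [e, norm_smul, norm_inv, Real.norm_of_nonneg hB0]
    refine inv_mul_le_one_of_le₀ ((norm_iteratedFDeriv_comp_affine_le Θ.contDiff z (-τ) k x).trans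
      ?_) hB0
    rw [abs_neg, abs_of_pos hτ]
    exact hB k hk _
  have hconv : Θ = (B * τ ^ n) • reflectDilate φ τ hτ z := by
    ext y
    change Θ y = (B * τ ^ n) * ((τ ^ n)⁻¹ * (B⁻¹ * Θ (z + (-τ) • (τ⁻¹ • (z - y)))))
    have : z + (-τ) • (τ⁻¹ • (z - y)) = y := by
      rw [smul_smul, neg_mul, mul_inv_cancel₀ hτ.ne']
      simp
    rw [this]
    field_simp
  rw [hconv, map_smul, norm_smul, Real.norm_of_nonneg (by positivity)]
  have h := norm_convDilate_le hτ hτ1 hΛ hF hφ hd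
  calc B * τ ^ n * ‖f (reflectDilate φ τ hτ z)‖ ≤ B * τ ^ n * Λ := by
        gcongr
        exact h
    _ = _ := by ring

/-- A continuous function `g` is controlled by `F` if its values, and its averages against bump
functions near a point, are at most a constant times the values of `F`. -/
structure Controlled (N : ℕ) (F : Rn n → ℝ≥0∞) (C : ℝ) (g : Rn n → ℂ) : Prop where
  continuous : Continuous g
  norm_le : ∀ x Λ, 0 ≤ Λ → F x ≤ ENNReal.ofReal Λ → ‖g x‖ ≤ C * Λ
  norm_integral_le : ∀ (z : Rn n) (t A Λ : ℝ) (ψ : Test n), 0 < t → t ≤ 1 / 4 →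
    tsupport ψ ⊆ Metric.closedBall z t → 0 ≤ Λ → F z ≤ ENNReal.ofReal Λ →
    (∀ k ≤ N + 1, ∀ y, t ^ k * ‖iteratedFDeriv ℝ k ψ y‖ ≤ A) →
    ‖∫ x, g x * (ψ x : ℂ)‖ ≤ C * A * Λ * t ^ n

/-- Both sides are the value of `f` at the convolution of ψ with the reflected mollifier. By
commutativity the averaging may be placed on either factor, so the mollification of `f` can be moved
onto the test function. -/
theorem integral_convDilate_mul (f : Dist n) (η ψ : Test n) (ε : ℝ) (hε : 0 < ε) :
    ∫ x, convDilate f η ε hε x * (ψ x : ℂ)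
      = ∫ u, reflectDilate η ε hε 0 u • f (translate u ψ) := by
  rw [← apply_convTest, convTest_comm, apply_convTest]
  refine integral_congr_ae (Eventually.of_forall fun x => ?_)
  simp only
  rw [convDilate, reflectDilate_eq_translate η ε hε x, Complex.real_smul, mul_comm]

theorem integral_reflectDilate (η : Test n) (ε : ℝ) (hε : 0 < ε) (x : Rn n) :
    ∫ u, reflectDilate η ε hε x u = ∫ u, η u := by
  simp only [reflectDilate_apply]
  rw [integral_const_mul, integral_sub_left_eq_self (fun u => η (ε⁻¹ • u)) volume x,
    Measure.integral_comp_inv_smul]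
  rw [finrank_euclideanSpace, Fintype.card_fin, abs_of_pos (by positivity), smul_eq_mul,
    ← mul_assoc, inv_mul_cancel₀ (by positivity), one_mul]

theorem tsupport_reflectDilate_subset {η : Test n} {r : ℝ}
    (hη : tsupport η ⊆ Metric.closedBall 0 r) {ε : ℝ} (hε : 0 < ε) (x : Rn n) :
    tsupport (reflectDilate η ε hε x) ⊆ Metric.closedBall x (ε * r) := by
  refine closure_minimal (fun y hy => ?_) Metric.isClosed_closedBall
  have h1 : ε⁻¹ • (x - y) ∈ tsupport η := by
    refine subset_tsupport _ fun h0 => hy ?_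
    rw [reflectDilate_apply, h0, mul_zero]
  have h2 := hη h1
  rw [mem_closedBall_zero_iff, norm_smul, norm_inv, Real.norm_of_nonneg hε.le,
    inv_mul_le_iff₀ hε] at h2
  rwa [Metric.mem_closedBall, dist_comm, dist_eq_norm]

theorem norm_iteratedFDeriv_reflectDilate_le (η : Test n) {ε D : ℝ} (hε : 0 < ε) (x : Rn n)
    {k : ℕ} (hD : ∀ y, ‖iteratedFDeriv ℝ k η y‖ ≤ D) (y : Rn n) :
    ‖iteratedFDeriv ℝ k (reflectDilate η ε hε x) y‖ ≤ (ε ^ n)⁻¹ * ((ε ^ k)⁻¹ * D) := by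
  have e0 : ∀ y, η (ε⁻¹ • (x - y)) = η (ε⁻¹ • x + (-ε⁻¹) • y) := by
    intro y
    rw [smul_sub, neg_smul, sub_eq_add_neg]
  have c1 : ContDiffAt ℝ k (fun y : Rn n => η (ε⁻¹ • x + (-ε⁻¹) • y)) y := by
    have h : ContDiff ℝ ((⊤ : ℕ∞) : WithTop ℕ∞) fun y : Rn n => η (ε⁻¹ • x + (-ε⁻¹) • y) := by
      have h := η.contDiff
      fun_prop
    exact h.contDiffAt.of_le (mod_cast le_top)
  have e : iteratedFDeriv ℝ k (reflectDilate η ε hε x) y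
      = (ε ^ n)⁻¹ • iteratedFDeriv ℝ k (fun y : Rn n => η (ε⁻¹ • x + (-ε⁻¹) • y)) y := by
    rw [← iteratedFDeriv_const_smul_apply c1]
    congr 1
    funext y
    rw [reflectDilate_apply, e0]
    rfl
  rw [e, norm_smul, norm_inv, Real.norm_of_nonneg (by positivity : 0 ≤ ε ^ n)]
  gcongr
  refine (norm_iteratedFDeriv_comp_affine_le η.contDiff _ _ k y).trans ?_
  rw [abs_neg, abs_of_pos (inv_pos.2 hε), inv_pow]
  gcongr
  exact hD _

/-- The kernel at x lives in the ball of radius ε/2 about x. If x is within ε of z, this ball lies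
in B(z, 2ε), so the kernel is an admissible bump for z at the scale τ = 2ε < 1. -/
theorem norm_convDilate_mollifier_le {N : ℕ} {η : Test n}
    (hη : tsupport η ⊆ Metric.closedBall 0 (1 / 2)) {D : ℝ}
    (hD : ∀ k ≤ N + 1, ∀ y, ‖iteratedFDeriv ℝ k η y‖ ≤ D) {f : Dist n} {ε : ℝ} (hε : 0 < ε)
    (hε1 : ε ≤ 1 / 4) {x z : Rn n} (hxz : dist x z ≤ ε) {Λ : ℝ} (hΛ : 0 ≤ Λ)
    (hF : grandMaximal N f z ≤ ENNReal.ofReal Λ) :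
    ‖convDilate f η ε hε x‖ ≤ 2 ^ (N + 1) * 2 ^ n * D * Λ := by
  have hD0 : 0 ≤ D := (norm_nonneg _).trans (hD 0 (by omega) 0)
  have h := norm_apply_le_of_deriv_bound (f := f) (N := N) (z := z) (τ := 2 * ε) (Λ := Λ)
    (B := 2 ^ (N + 1) * D * (ε ^ n)⁻¹) (by positivity) (by linarith) hΛ hF
    (Θ := reflectDilate η ε hε x) ?_ ?_
  · refine h.trans (le_of_eq ?_)
    rw [mul_pow]
    field_simp
  · refine (tsupport_reflectDilate_subset hη hε x).trans ?_
    refine Metric.closedBall_subset_ball' ?_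
    linarith
  · intro k hk y
    have h1 := norm_iteratedFDeriv_reflectDilate_le η hε x (hD k hk) y
    calc (2 * ε) ^ k * ‖iteratedFDeriv ℝ k (reflectDilate η ε hε x) y‖
        ≤ (2 * ε) ^ k * ((ε ^ n)⁻¹ * ((ε ^ k)⁻¹ * D)) := by gcongr
      _ = 2 ^ k * D * (ε ^ n)⁻¹ := by rw [mul_pow]; field_simp
      _ ≤ _ := by gcongr; norm_num

theorem norm_iteratedFDeriv_translate (φ : Test n) (u : Rn n) (k : ℕ) (y : Rn n) :
    iteratedFDeriv ℝ k (translate u φ) y = iteratedFDeriv ℝ k φ (y - u) :=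
  iteratedFDeriv_comp_sub _ u y

theorem volume_closedBall_eq (z : Rn n) {t : ℝ} (ht : 0 ≤ t) :
    volume.real (Metric.closedBall z t) = t ^ n * volume.real (Metric.ball (0 : Rn n) 1) := by
  rw [measureReal_def, Measure.addHaar_closedBall _ _ ht, ENNReal.toReal_mul,
    ENNReal.toReal_ofReal (by positivity), finrank_euclideanSpace, Fintype.card_fin]
  rfl

/-- There are two regimes. If t < ε, the mollified function is bounded on the whole ball of radius t
by the maximal function at z, and integration is trivial. If t ≥ ε, the averaging is moved onto ψ,
whose translates by |u| ≤ ε/2 are bumps at z of scale 2t. The restrictions to 1/4 keep the doubled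
scales below 1. -/
theorem controlled_convDilate (n N : ℕ) (η : Test n) (h0 : ∀ x, 0 ≤ η x) (h1 : (∫ x, η x) = 1)
    (hη : tsupport η ⊆ Metric.closedBall 0 (1 / 2)) :
    ∃ C : ℝ, 0 < C ∧ ∀ (f : Dist n) (ε : ℝ) (hε : 0 < ε), ε ≤ 1 / 4 →
      Controlled N (grandMaximal N f) C (convDilate f η ε hε) := by
  obtain ⟨D, hD0, hD⟩ := exists_deriv_bound η (N + 1)
  set C₁ : ℝ := 2 ^ (N + 1) * 2 ^ n * D with hC₁
  set v : ℝ := volume.real (Metric.ball (0 : Rn n) 1) with hv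
  have hv0 : 0 ≤ v := measureReal_nonneg
  refine ⟨C₁ + C₁ * v + 2 ^ (N + 1) * 2 ^ n, by positivity, fun f ε hε hε1 => ⟨?_, ?_, ?_⟩⟩
  · exact continuous_convDilate f η ε hε
  · intro x Λ hΛ hF
    refine (norm_convDilate_mollifier_le hη hD hε hε1 (by simpa using hε.le) hΛ hF).trans ?_
    rw [← hC₁]
    gcongr
    have : 0 ≤ C₁ * v + 2 ^ (N + 1) * 2 ^ n := by positivity
    linarith
  · intro z t A Λ ψ ht ht1 hψ hΛ hF hA
    have hA0 : 0 ≤ A := le_trans (by positivity) (hA 0 (by omega) 0)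
    rcases lt_or_ge t ε with hlt | hle
    · have hb : ∀ x ∈ Metric.closedBall z t, ‖convDilate f η ε hε x * (ψ x : ℂ)‖
          ≤ C₁ * Λ * A := by
        intro x hx
        rw [norm_mul]
        have a1 := norm_convDilate_mollifier_le hη hD hε hε1
          ((Metric.mem_closedBall.1 hx).trans hlt.le) hΛ hF
        have a2 : ‖(ψ x : ℂ)‖ ≤ A := by simpa using hA 0 (by omega) x
        exact mul_le_mul a1 a2 (norm_nonneg _) (by positivity)
      have e : ∫ x, convDilate f η ε hε x * (ψ x : ℂ)
          = ∫ x in Metric.closedBall z t, convDilate f η ε hε x * (ψ x : ℂ) := by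
        refine (setIntegral_eq_integral_of_forall_compl_eq_zero fun x hx => ?_).symm
        rw [image_eq_zero_of_notMem_tsupport fun h => hx (hψ h)]
        simp
      rw [e]
      refine (norm_setIntegral_le_of_norm_le_const measure_closedBall_lt_top hb).trans ?_
      rw [volume_closedBall_eq z ht.le, ← hv]
      have : C₁ * Λ * A * (t ^ n * v) = (C₁ * v) * A * Λ * t ^ n := by ring
      rw [this]
      gcongr
      have : 0 ≤ C₁ + 2 ^ (N + 1) * 2 ^ n := by positivity
      linarith
    · rw [integral_convDilate_mul]
      set M : ℝ := 2 ^ (N + 1) * 2 ^ n * A * Λ * t ^ n with hM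
      have hM0 : 0 ≤ M := by positivity
      have hg0 : ∀ u, 0 ≤ reflectDilate η ε hε 0 u := fun u =>
        mul_nonneg (by positivity) (h0 _)
      have hb : ∀ u, ‖reflectDilate η ε hε 0 u • f (translate u ψ)‖
          ≤ reflectDilate η ε hε 0 u * M := by
        intro u
        rw [norm_smul, Real.norm_of_nonneg (hg0 u)]
        by_cases hu : u ∈ tsupport (reflectDilate η ε hε 0)
        · have hu' := tsupport_reflectDilate_subset hη hε 0 hu
          rw [mem_closedBall_zero_iff] at hu'
          refine mul_le_mul_of_nonneg_left ?_ (hg0 u)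
          have h := norm_apply_le_of_deriv_bound (f := f) (N := N) (z := z) (τ := 2 * t) (Λ := Λ)
            (B := 2 ^ (N + 1) * A) (by positivity) (by linarith) hΛ hF
            (Θ := translate u ψ) ?_ ?_
          · refine h.trans (le_of_eq ?_)
            rw [mul_pow]
            ring
          · have : tsupport (translate u ψ) ⊆ Metric.closedBall z (t + ε * (1 / 2)) := by
              refine closure_minimal (fun y hy => ?_) Metric.isClosed_closedBall
              have h3 : y - u ∈ Metric.closedBall z t := hψ (subset_tsupport _ hy)
              rw [Metric.mem_closedBall, dist_eq_norm] at h3 ⊢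
              calc ‖y - z‖ = ‖(y - u - z) + u‖ := by congr 1; abel
                _ ≤ ‖y - u - z‖ + ‖u‖ := norm_add_le _ _
                _ ≤ _ := by linarith
            exact this.trans (Metric.closedBall_subset_ball (by linarith))
          · intro k hk y
            rw [norm_iteratedFDeriv_translate, mul_pow, mul_assoc]
            have := hA k hk (y - u)
            gcongr
            norm_num
        · rw [image_eq_zero_of_notMem_tsupport hu]
          simp
      refine (norm_integral_le_of_norm_le ?_ (Eventually.of_forall hb)).trans ?_
      · exact ((reflectDilate η ε hε 0).continuous.integrable_of_hasCompactSupport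
          (reflectDilate η ε hε 0).hasCompactSupport).mul_const M
      · rw [integral_mul_const, integral_reflectDilate, h1, one_mul, hM]
        gcongr
        have : 0 ≤ C₁ + C₁ * v := by positivity
        linarith

theorem tendsto_integral_convDilate (η : Test n) (h0 : ∀ x, 0 ≤ η x) (h1 : (∫ x, η x) = 1)
    (hη : tsupport η ⊆ Metric.closedBall 0 (1 / 2)) (f : Dist n) (φ : Test n)
    {ε : ℕ → ℝ} (hε : ∀ j, 0 < ε j) (hlim : Tendsto ε atTop (𝓝 0)) :
    Tendsto (fun j => ∫ x, convDilate f η (ε j) (hε j) x * (φ x : ℂ)) atTop (𝓝 (f φ)) := by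
  have hcont := continuous_apply_translate f φ
  have hz : translate 0 φ = φ := by ext y; simp
  rw [Metric.tendsto_atTop]
  intro δ hδ
  obtain ⟨r, hr, hr'⟩ := Metric.continuous_iff.1 hcont 0 (δ / 2) (half_pos hδ)
  obtain ⟨J, hJ⟩ := Metric.tendsto_atTop.1 hlim r hr
  refine ⟨J, fun j hj => lt_of_le_of_lt ?_ (half_lt_self hδ)⟩
  have hεr : ε j < r := by
    have := hJ j hj
    rwa [Real.dist_0_eq_abs, abs_of_pos (hε j)] at this
  rw [integral_convDilate_mul]
  set g := reflectDilate η (ε j) (hε j) 0 with hg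
  have hgi : Integrable g := g.continuous.integrable_of_hasCompactSupport g.hasCompactSupport
  have hg1 : ∫ u, g u = 1 := by rw [hg, integral_reflectDilate, h1]
  have e : f φ = ∫ u, g u • f φ := by
    rw [integral_smul_const, hg1, one_smul]
  have hc : HasCompactSupport fun u => g u • f (translate u φ) :=
    g.hasCompactSupport.smul_right
  have hi : Integrable fun u => g u • f (translate u φ) :=
    (g.continuous.smul hcont).integrable_of_hasCompactSupport hc
  rw [e, dist_eq_norm, ← integral_sub hi (hgi.smul_const _)]
  have hb : ∀ u, ‖g u • f (translate u φ) - g u • f φ‖ ≤ g u * (δ / 2) := by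
    intro u
    have hg0 : 0 ≤ g u := mul_nonneg (by have := hε j; positivity) (h0 _)
    rw [← smul_sub, norm_smul, Real.norm_of_nonneg hg0]
    by_cases hu : u ∈ tsupport g
    · have hu' := tsupport_reflectDilate_subset hη (hε j) 0 hu
      refine mul_le_mul_of_nonneg_left ?_ hg0
      have := hr' u (lt_of_le_of_lt (Metric.mem_closedBall.1 hu') (by linarith [hε j]))
      rw [hz, dist_eq_norm] at this
      exact this.le
    · rw [image_eq_zero_of_notMem_tsupport hu]
      simp
  refine (norm_integral_le_of_norm_le (hgi.mul_const _) (Eventually.of_forall hb)).trans ?_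
  rw [integral_mul_const, hg1, one_mul]

/-- Every distribution is the limit of continuous functions that are uniformly controlled by its
grand maximal function. -/
theorem exists_controlled_approximation (n N : ℕ) : ∃ C : ℝ, 0 < C ∧ ∀ f : Dist n,
    ∃ g : ℕ → Rn n → ℂ, (∀ j, Controlled N (grandMaximal N f) C (g j)) ∧
      ∀ φ : Test n, Tendsto (fun j => ∫ x, g j x * (φ x : ℂ)) atTop (𝓝 (f φ)) := by
  obtain ⟨η, h0, h1, hη⟩ := exists_mollifier n
  obtain ⟨C, hC, h⟩ := controlled_convDilate n N η h0 h1 hη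
  have hpos : ∀ j : ℕ, 0 < 1 / 4 * (1 / ((j : ℝ) + 1)) := fun j => by positivity
  refine ⟨C, hC, fun f => ⟨fun j => convDilate f η (1 / 4 * (1 / ((j : ℝ) + 1))) (hpos j),
    fun j => h f _ (hpos j) ?_, fun φ => ?_⟩⟩
  · have : 1 / ((j : ℝ) + 1) ≤ 1 := by
      rw [div_le_one (by positivity)]
      linarith [(Nat.cast_nonneg j : (0 : ℝ) ≤ j)]
    linarith
  · refine tendsto_integral_convDilate η h0 h1 hη f φ hpos ?_
    have := (tendsto_one_div_add_atTop_nhds_zero_nat (𝕜 := ℝ)).const_mul (1 / 4)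
    rwa [mul_zero] at this

end Smoothing

/-! ### Cubes, and the A_p condition as an inequality between averages. -/

section Weights

variable {n : ℕ}

theorem isClosed_cube (x : Rn n) (l : ℝ) : IsClosed (cube x l) := by
  have : cube x l = ⋂ i, {y : Rn n | |y i - x i| ≤ l / 2} := by
    ext y
    simp [cube]
  rw [this]
  refine isClosed_iInter fun i => isClosed_le ?_ continuous_const
  fun_prop

theorem measurableSet_cube (x : Rn n) (l : ℝ) : MeasurableSet (cube x l) :=
  (isClosed_cube x l).measurableSet

theorem volume_cube (x : Rn n) (l : ℝ) : volume (cube x l) = ENNReal.ofReal l ^ n := by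
  have h : cube x l = (@WithLp.ofLp 2 (Fin n → ℝ)) ⁻¹'
      (Set.pi univ fun i => Icc (x i - l / 2) (x i + l / 2)) := by
    ext y
    simp only [cube, Set.mem_ofPred_eq, mem_preimage, Set.mem_pi, mem_univ, true_implies, mem_Icc]
    refine forall_congr' fun i => ?_
    rw [abs_le]
    constructor <;> rintro ⟨h1, h2⟩ <;> constructor <;> linarith
  rw [h, (PiLp.volume_preserving_ofLp (Fin n)).measure_preimage
    (MeasurableSet.univ_pi fun i => measurableSet_Icc).nullMeasurableSet, volume_pi_pi]
  simp [Real.volume_Icc]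

theorem closedBall_subset_cube (x : Rn n) (t : ℝ) : Metric.closedBall x t ⊆ cube x (2 * t) := by
  intro y hy i
  have h1 : ‖y - x‖ ≤ t := by simpa [dist_eq_norm] using hy
  have h2 : ‖(y - x) i‖ ≤ ‖y - x‖ := PiLp.norm_apply_le _ i
  have h3 : |y i - x i| ≤ ‖y - x‖ := h2
  linarith

theorem cube_subset_closedBall (x : Rn n) {l : ℝ} (hl : 0 ≤ l) :
    cube x l ⊆ Metric.closedBall x (√n * l / 2) := by
  intro y hy
  rw [Metric.mem_closedBall, EuclideanSpace.dist_eq]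
  calc √(∑ i, dist (y i) (x i) ^ 2) ≤ √(∑ _i : Fin n, (l / 2) ^ 2) := by
        gcongr with i
        exact hy i
    _ = √n * l / 2 := by
        rw [Finset.sum_const, Finset.card_univ, Fintype.card_fin, nsmul_eq_mul,
          Real.sqrt_mul (by positivity), Real.sqrt_sq (by positivity)]
        ring

theorem isBounded_cube (x : Rn n) (l : ℝ) : Bornology.IsBounded (cube x l) :=
  Metric.isBounded_closedBall.subset
    (fun y hy => cube_subset_closedBall x (abs_nonneg l)
      (fun i => (hy i).trans (by linarith [le_abs_self l])))

theorem IsWeight.aemeasurable {w : Rn n → ℝ} (hw : IsWeight w) :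
    AEMeasurable (fun x => ENNReal.ofReal (w x)) volume :=
  hw.locallyIntegrable.aestronglyMeasurable.aemeasurable.ennreal_ofReal

theorem wMeasure_absolutelyContinuous (w : Rn n → ℝ) : wMeasure w ≪ volume :=
  withDensity_absolutelyContinuous _ _

theorem IsWeight.absolutelyContinuous {w : Rn n → ℝ} (hw : IsWeight w) :
    volume ≪ wMeasure w := by
  refine withDensity_absolutelyContinuous' hw.aemeasurable ?_
  filter_upwards [hw.ae_pos] with x hx
  simpa using hx

theorem IsWeight.measure_lt_top {w : Rn n → ℝ} (hw : IsWeight w) {s : Set (Rn n)}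
    (hs : Bornology.IsBounded s) : wMeasure w s < ∞ := by
  obtain ⟨R, hR⟩ := hs.subset_closedBall 0
  refine (measure_mono hR).trans_lt ?_
  rw [wMeasure, withDensity_apply _ Metric.isClosed_closedBall.measurableSet]
  have h := (hw.locallyIntegrable.integrableOn_isCompact
    (isCompact_closedBall (0 : Rn n) R)).hasFiniteIntegral
  refine lt_of_le_of_lt (lintegral_mono fun x => ?_) h
  rw [← Real.enorm_eq_ofReal (hw.nonneg x)]

theorem IsWeight.measure_pos {w : Rn n → ℝ} (hw : IsWeight w) {s : Set (Rn n)}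
    (hs : volume s ≠ 0) : 0 < wMeasure w s := by
  rw [pos_iff_ne_zero]
  exact fun h => hs (hw.absolutelyContinuous h)

/-- The averages over cubes with `|Q| ≤ 1` are bounded by weighted averages:
`(|Q|⁻¹ ∫_Q g)^r ≤ K w(Q)⁻¹ ∫_Q g^r w`. -/
def CubeAverageBound (r : ℝ) (K : ℝ≥0∞) (μ : Measure (Rn n)) : Prop :=
  ∀ Q : Set (Rn n), IsCube Q → volume Q ≤ 1 → ∀ g : Rn n → ℝ≥0∞, AEMeasurable g volume →
    (∫⁻ x in Q, g x) ^ r * μ Q ≤ K * volume Q ^ r * ∫⁻ x in Q, g x ^ r ∂μ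

theorem setLIntegral_wMeasure {w : Rn n → ℝ} (hw : IsWeight w) {Q : Set (Rn n)}
    (hQ : MeasurableSet Q) {g : Rn n → ℝ≥0∞} (hg : AEMeasurable g volume) :
    ∫⁻ x in Q, g x ∂(wMeasure w) = ∫⁻ x in Q, ENNReal.ofReal (w x) * g x := by
  rw [wMeasure, restrict_withDensity hQ, lintegral_withDensity_eq_lintegral_mul₀
    hw.aemeasurable.restrict hg.restrict]
  rfl

theorem IsCube.measurableSet {Q : Set (Rn n)} (hQ : IsCube Q) : MeasurableSet Q := by
  obtain ⟨x, l, -, rfl⟩ := hQ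
  exact measurableSet_cube x l

theorem IsCube.volume_ne_zero {Q : Set (Rn n)} (hQ : IsCube Q) : volume Q ≠ 0 := by
  obtain ⟨x, l, hl, rfl⟩ := hQ
  rw [volume_cube]
  exact pow_ne_zero _ (by simpa using hl)

theorem IsCube.isBounded {Q : Set (Rn n)} (hQ : IsCube Q) : Bornology.IsBounded Q := by
  obtain ⟨x, l, -, rfl⟩ := hQ
  exact isBounded_cube x l

theorem IsCube.volume_ne_top {Q : Set (Rn n)} (hQ : IsCube Q) : volume Q ≠ ∞ :=
  hQ.isBounded.measure_lt_top.ne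

theorem cubeAverageBound_one {w : Rn n → ℝ} (hw : IsWeight w) :
    CubeAverageBound 1 (localA1Const w) (wMeasure w) := by
  intro Q hQ hQ1 g hg
  have hA : (volume Q)⁻¹ * (∫⁻ x in Q, ENNReal.ofReal (w x)) *
      essSup (fun y => (ENNReal.ofReal (w y))⁻¹) (volume.restrict Q) ≤ localA1Const w :=
    le_iSup_of_le Q <| le_iSup_of_le hQ <| le_iSup_of_le hQ1 le_rfl
  set S := essSup (fun y => (ENNReal.ofReal (w y))⁻¹) (volume.restrict Q)
  have h1 : ∫⁻ x in Q, g x ≤ S * ∫⁻ x in Q, ENNReal.ofReal (w x) * g x := by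
    rw [← lintegral_const_mul'' (f := fun x => ENNReal.ofReal (w x) * g x) _
      (hw.aemeasurable.restrict.mul hg.restrict)]
    refine lintegral_mono_ae ?_
    filter_upwards [ENNReal.ae_le_essSup (μ := volume.restrict Q)
      fun y => (ENNReal.ofReal (w y))⁻¹, ae_restrict_of_ae hw.ae_pos] with x hx hx0
    calc g x = (ENNReal.ofReal (w x))⁻¹ * (ENNReal.ofReal (w x) * g x) := by
          rw [← mul_assoc, ENNReal.inv_mul_cancel (by simpa using hx0) ENNReal.ofReal_ne_top,
            one_mul]
      _ ≤ _ := by gcongr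
  have hμ : wMeasure w Q = ∫⁻ x in Q, ENNReal.ofReal (w x) := withDensity_apply _ hQ.measurableSet
  simp only [ENNReal.rpow_one]
  rw [setLIntegral_wMeasure hw hQ.measurableSet hg]
  calc (∫⁻ x in Q, g x) * wMeasure w Q
      ≤ (S * ∫⁻ x in Q, ENNReal.ofReal (w x) * g x) * wMeasure w Q := by gcongr
    _ = ((volume Q)⁻¹ * volume Q) * (S * ∫⁻ x in Q, ENNReal.ofReal (w x) * g x)
          * wMeasure w Q := by
        rw [ENNReal.inv_mul_cancel hQ.volume_ne_zero hQ.volume_ne_top, one_mul]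
    _ = ((volume Q)⁻¹ * (∫⁻ x in Q, ENNReal.ofReal (w x)) * S) * volume Q
          * ∫⁻ x in Q, ENNReal.ofReal (w x) * g x := by rw [hμ]; ring
    _ ≤ _ := by gcongr

/-- Hölder's inequality for the factorisation g = (w^{1/p} g) w^{-1/p}. The integral of the dual
power of w is the second factor in the A_p constant. -/
theorem cubeAverageBound_of_one_lt {w : Rn n → ℝ} (hw : IsWeight w) {p : ℝ} (hp : 1 < p) :
    CubeAverageBound p (localApConst p w) (wMeasure w) := by
  intro Q hQ hQ1 g hg
  set q := Real.conjExponent p with hq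
  have hpq : p.HolderConjugate q := Real.HolderConjugate.conjExponent hp
  have hp0 : 0 < p := by linarith
  have hA : (volume Q ^ p)⁻¹ * (∫⁻ x in Q, ENNReal.ofReal (w x)) *
      (∫⁻ x in Q, ENNReal.ofReal (w x) ^ (-(q / p))) ^ (p / q) ≤ localApConst p w :=
    le_iSup_of_le Q <| le_iSup_of_le hQ <| le_iSup_of_le hQ1 le_rfl
  set S := ∫⁻ x in Q, ENNReal.ofReal (w x) ^ (-(q / p))
  set I := ∫⁻ x in Q, ENNReal.ofReal (w x) * g x ^ p
  have h1 : (∫⁻ x in Q, g x) ^ p ≤ I * S ^ (p / q) := by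
    have e : ∫⁻ x in Q, g x = ∫⁻ x in Q, ((fun x => ENNReal.ofReal (w x) ^ (1 / p) * g x)
        * fun x => ENNReal.ofReal (w x) ^ (-(1 / p))) x := by
      refine lintegral_congr_ae ?_
      filter_upwards [ae_restrict_of_ae hw.ae_pos] with x hx
      have h0 : ENNReal.ofReal (w x) ≠ 0 := by simpa using hx
      rw [Pi.mul_apply, mul_right_comm, ← ENNReal.rpow_add _ _ h0 ENNReal.ofReal_ne_top]
      simp
    have h2 := ENNReal.lintegral_mul_le_Lp_mul_Lq (volume.restrict Q) hpq
      (f := fun x => ENNReal.ofReal (w x) ^ (1 / p) * g x)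
      (g := fun x => ENNReal.ofReal (w x) ^ (-(1 / p)))
      ((hw.aemeasurable.restrict.pow_const _).mul hg.restrict)
      (hw.aemeasurable.restrict.pow_const _)
    rw [← e] at h2
    have e1 : ∫⁻ x in Q, (ENNReal.ofReal (w x) ^ (1 / p) * g x) ^ p = I := by
      refine lintegral_congr fun x => ?_
      rw [ENNReal.mul_rpow_of_nonneg _ _ hp0.le, ← ENNReal.rpow_mul, one_div,
        inv_mul_cancel₀ hp0.ne', ENNReal.rpow_one]
    have e2 : ∫⁻ x in Q, (ENNReal.ofReal (w x) ^ (-(1 / p))) ^ q = S := by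
      refine lintegral_congr fun x => ?_
      rw [← ENNReal.rpow_mul]
      congr 1
      ring
    rw [e1, e2] at h2
    calc (∫⁻ x in Q, g x) ^ p ≤ (I ^ (1 / p) * S ^ (1 / q)) ^ p := by gcongr
      _ = I * S ^ (p / q) := by
        rw [ENNReal.mul_rpow_of_nonneg _ _ hp0.le, ← ENNReal.rpow_mul, ← ENNReal.rpow_mul,
          one_div, inv_mul_cancel₀ hp0.ne', ENNReal.rpow_one]
        congr 2
        ring
  have hμ : wMeasure w Q = ∫⁻ x in Q, ENNReal.ofReal (w x) := withDensity_apply _ hQ.measurableSet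
  rw [setLIntegral_wMeasure hw hQ.measurableSet (hg.pow_const p)]
  have hV0 : volume Q ^ p ≠ 0 := by
    simp [ENNReal.rpow_eq_zero_iff, hQ.volume_ne_zero, hQ.volume_ne_top]
  have hV1 : volume Q ^ p ≠ ∞ := ENNReal.rpow_ne_top_of_nonneg hp0.le hQ.volume_ne_top
  calc (∫⁻ x in Q, g x) ^ p * wMeasure w Q
      ≤ (I * S ^ (p / q)) * wMeasure w Q := by gcongr
    _ = ((volume Q ^ p)⁻¹ * volume Q ^ p) * (I * S ^ (p / q)) * wMeasure w Q := by
        rw [ENNReal.inv_mul_cancel hV0 hV1, one_mul]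
    _ = ((volume Q ^ p)⁻¹ * (∫⁻ x in Q, ENNReal.ofReal (w x)) * S ^ (p / q)) * volume Q ^ p
          * I := by rw [hμ]; ring
    _ ≤ _ := by gcongr

theorem lintegral_rpow_le_of_le {α : Type*} [MeasurableSpace α] {μ : Measure α}
    {g : α → ℝ≥0∞} (hg : AEMeasurable g μ) {p r : ℝ} (hp : 0 < p) (hpr : p < r) :
    ∫⁻ x, g x ^ p ∂μ ≤ (∫⁻ x, g x ^ r ∂μ) ^ (p / r) * μ univ ^ (1 - p / r) := by
  have h1 : 1 < r / p := by rwa [one_lt_div hp]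
  have hpq : (r / p).HolderConjugate (Real.conjExponent (r / p)) :=
    Real.HolderConjugate.conjExponent h1
  have h := ENNReal.lintegral_mul_le_Lp_mul_Lq μ hpq (f := fun x => g x ^ p) (g := fun _ => 1)
    (hg.pow_const p) aemeasurable_const
  simp only [Pi.mul_apply, mul_one, ENNReal.one_rpow, lintegral_const, one_mul] at h
  have e : ∀ x, (g x ^ p) ^ (r / p) = g x ^ r := by
    intro x
    rw [← ENNReal.rpow_mul, mul_div_cancel₀ _ hp.ne']
  simp only [e] at h
  have e2 : 1 / Real.conjExponent (r / p) = 1 - p / r := by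
    have := hpq.inv_add_inv_eq_one
    rw [inv_div] at this
    rw [one_div]
    linarith
  rwa [e2, one_div_div] at h

/-- The classes increase with the exponent: apply Hölder with respect to μ on the right-hand side
and raise to the power r/p. The surplus powers of μ(Q) cancel because μ(Q) is positive and finite.
-/
theorem CubeAverageBound.mono {μ : Measure (Rn n)} (hμ : μ ≪ volume)
    (hfin : ∀ Q : Set (Rn n), IsCube Q → μ Q ≠ ∞) (hpos : ∀ Q : Set (Rn n), IsCube Q → μ Q ≠ 0)
    {p r : ℝ} (hp : 0 < p) (hpr : p < r) {K : ℝ≥0∞} (h : CubeAverageBound p K μ) :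
    CubeAverageBound r (K ^ (r / p)) μ := by
  intro Q hQ hQ1 g hg
  have h1 := h Q hQ hQ1 g hg
  have h2 := lintegral_rpow_le_of_le ((hg.mono_ac hμ).restrict (s := Q)) hp hpr
  rw [Measure.restrict_apply_univ] at h2
  set V := volume Q
  set m := μ Q
  set I := ∫⁻ x in Q, g x ^ r ∂μ
  have hm0 : m ≠ 0 := hpos Q hQ
  have hm1 : m ≠ ∞ := hfin Q hQ
  have hr : 0 < r := hp.trans hpr
  have h3 : (∫⁻ x in Q, g x) ^ p * m ≤ K * V ^ p * (I ^ (p / r) * m ^ (1 - p / r)) :=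
    h1.trans (by gcongr)
  have h4 : ((∫⁻ x in Q, g x) ^ p * m) ^ (r / p)
      ≤ (K * V ^ p * (I ^ (p / r) * m ^ (1 - p / r))) ^ (r / p) := by gcongr
  have hrp : 0 ≤ r / p := by positivity
  have e1 : (r / p) * (p / r) = 1 := by field_simp
  rw [ENNReal.mul_rpow_of_nonneg _ _ hrp, ENNReal.mul_rpow_of_nonneg _ _ hrp,
    ENNReal.mul_rpow_of_nonneg _ _ hrp, ENNReal.mul_rpow_of_nonneg _ _ hrp,
    ← ENNReal.rpow_mul, ← ENNReal.rpow_mul, ← ENNReal.rpow_mul, ← ENNReal.rpow_mul,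
    mul_div_cancel₀ _ hp.ne', mul_comm (p / r), e1, ENNReal.rpow_one, sub_mul, one_mul,
    mul_comm (p / r), e1, ENNReal.rpow_sub _ _ hm0 hm1, ENNReal.rpow_one] at h4
  have hmr0 : m ^ (r / p) ≠ 0 := by simp [ENNReal.rpow_eq_zero_iff, hm0, hm1]
  have hmr1 : m ^ (r / p) ≠ ∞ := ENNReal.rpow_ne_top_of_nonneg hrp hm1
  calc (∫⁻ x in Q, g x) ^ r * m
      = ((∫⁻ x in Q, g x) ^ r * m ^ (r / p)) * ((m ^ (r / p))⁻¹ * m) := by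
        rw [mul_assoc, ← mul_assoc (m ^ (r / p)), ENNReal.mul_inv_cancel hmr0 hmr1, one_mul]
    _ ≤ (K ^ (r / p) * V ^ r * (I * (m ^ (r / p) / m))) * ((m ^ (r / p))⁻¹ * m) := by gcongr
    _ = K ^ (r / p) * V ^ r * I * ((m ^ (r / p) * (m ^ (r / p))⁻¹) * (m⁻¹ * m)) := by
        rw [show m ^ (r / p) / m = m ^ (r / p) * m⁻¹ from div_eq_mul_inv _ _]; ring
    _ = K ^ (r / p) * V ^ r * I := by
        rw [ENNReal.mul_inv_cancel hmr0 hmr1, ENNReal.inv_mul_cancel hm0 hm1]; simp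

/-- For every `r > q_w`, averages over small cubes are bounded by weighted averages. -/
theorem exists_cubeAverageBound {w : Rn n → ℝ} (hw : IsLocalAInfty w) {r : ℝ}
    (hr : criticalIndex w < r) : IsWeight w ∧ ∃ K : ℝ≥0∞, K ≠ ∞ ∧
      CubeAverageBound r K (wMeasure w) := by
  have hne : {p : ℝ | 1 ≤ p ∧ IsLocalAp p w}.Nonempty := hw
  obtain ⟨p, ⟨hp1, hpw⟩, hpr⟩ := exists_lt_of_csInf_lt hne hr
  have hW := hpw.1
  have hp0 : 0 < p := by linarith
  obtain ⟨K, hK, hb⟩ : ∃ K : ℝ≥0∞, K ≠ ∞ ∧ CubeAverageBound p K (wMeasure w) := by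
    rcases hpw.2 with ⟨rfl, h⟩ | ⟨h1, h⟩
    · exact ⟨_, h.ne, cubeAverageBound_one hW⟩
    · exact ⟨_, h.ne, cubeAverageBound_of_one_lt hW h1⟩
  refine ⟨hW, K ^ (r / p), ENNReal.rpow_ne_top_of_nonneg (div_nonneg (by linarith) hp0.le) hK, ?_⟩
  exact hb.mono (wMeasure_absolutelyContinuous w) (fun Q hQ => (hW.measure_lt_top hQ.isBounded).ne)
    (fun Q hQ => (hW.measure_pos hQ.volume_ne_zero).ne') hp0 hpr

end Weights

/-! ### From cubes with |Q| ≤ 1 to balls of any bounded radius; doubling. -/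

section BallWeights

variable {n : ℕ}

theorem ofReal_pow_rpow_ne_zero {t : ℝ} (ht : 0 < t) (n : ℕ) (r : ℝ) :
    (ENNReal.ofReal t ^ n) ^ r ≠ 0 := by
  have h : ENNReal.ofReal t ^ n ≠ 0 := pow_ne_zero _ (by simpa using ht)
  simp [ENNReal.rpow_eq_zero_iff, h, ENNReal.ofReal_ne_top]

theorem ofReal_pow_rpow_ne_top (t : ℝ) (n : ℕ) {r : ℝ} (hr : 0 ≤ r) :
    (ENNReal.ofReal t ^ n) ^ r ≠ ∞ :=
  ENNReal.rpow_ne_top_of_nonneg hr (ENNReal.pow_ne_top ENNReal.ofReal_ne_top)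

/-- Both cubes lie in the cube of side 2h about the midpoint of the centres. Test the average bound
there on the indicator of one of them; h ≤ 1/2 guarantees that the large cube has volume at most 1.
-/
theorem CubeAverageBound.measure_cube_le_of_dist_le {μ : Measure (Rn n)} {r : ℝ} (hr : 0 < r)
    {K : ℝ≥0∞} (hK : CubeAverageBound r K μ) {h : ℝ} (h0 : 0 < h) (h1 : h ≤ 1 / 2) {x y : Rn n}
    (hxy : ∀ i, |y i - x i| ≤ h) :
    μ (cube y h) ≤ K * (2 ^ n) ^ r * μ (cube x h) := by
  set m : Rn n := (2⁻¹ : ℝ) • (x + y) with hm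
  have hmi : ∀ i, m i = (x i + y i) / 2 := by
    intro i
    simp [hm]
    ring
  have hx : cube x h ⊆ cube m (2 * h) := by
    intro z hz i
    have a := abs_le.1 (hz i)
    have b := abs_le.1 (hxy i)
    rw [hmi, abs_le]
    constructor <;> linarith [a.1, a.2, b.1, b.2]
  have hy : cube y h ⊆ cube m (2 * h) := by
    intro z hz i
    have a := abs_le.1 (hz i)
    have b := abs_le.1 (hxy i)
    rw [hmi, abs_le]
    constructor <;> linarith [a.1, a.2, b.1, b.2]
  have hV : volume (cube m (2 * h)) = 2 ^ n * ENNReal.ofReal h ^ n := by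
    rw [volume_cube, ENNReal.ofReal_mul (by norm_num), mul_pow]
    simp
  have hV1 : volume (cube m (2 * h)) ≤ 1 := by
    rw [volume_cube]
    refine pow_le_one₀ (by positivity) ?_
    rw [← ENNReal.ofReal_one]
    exact ENNReal.ofReal_le_ofReal (by linarith)
  have key := hK _ ⟨m, 2 * h, by positivity, rfl⟩ hV1 ((cube x h).indicator 1)
    ((measurable_one.indicator (measurableSet_cube x h)).aemeasurable)
  have e1 : ∫⁻ z in cube m (2 * h), (cube x h).indicator (1 : Rn n → ℝ≥0∞) z
      = ENNReal.ofReal h ^ n := by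
    rw [lintegral_indicator_one (measurableSet_cube x h),
      Measure.restrict_apply (measurableSet_cube x h), inter_eq_left.2 hx, volume_cube]
  have e2 : ∫⁻ z in cube m (2 * h), (cube x h).indicator (1 : Rn n → ℝ≥0∞) z ^ r ∂μ
      = μ (cube x h) := by
    have : ∀ z, (cube x h).indicator (1 : Rn n → ℝ≥0∞) z ^ r
        = (cube x h).indicator (1 : Rn n → ℝ≥0∞) z := by
      intro z
      by_cases hz : z ∈ cube x h <;> simp [hz, hr]
    simp only [this]
    rw [lintegral_indicator_one (measurableSet_cube x h),
      Measure.restrict_apply (measurableSet_cube x h), inter_eq_left.2 hx]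
  rw [e1, e2, hV, ENNReal.mul_rpow_of_nonneg _ _ hr.le] at key
  have hh0 := ofReal_pow_rpow_ne_zero h0 n r
  have hh1 := ofReal_pow_rpow_ne_top h n hr.le
  have key2 : (ENNReal.ofReal h ^ n) ^ r * μ (cube m (2 * h))
      ≤ (ENNReal.ofReal h ^ n) ^ r * (K * (2 ^ n) ^ r * μ (cube x h)) :=
    key.trans (le_of_eq (by ring))
  exact (measure_mono hy).trans ((ENNReal.mul_le_mul_iff_right hh0 hh1).1 key2)

/-- Walk along the segment from x to y in m equal steps, each of length at most h in every
coordinate; the induction splits off the last step, at the fraction m/(m+1) of the way. -/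
theorem CubeAverageBound.measure_cube_le_chain {μ : Measure (Rn n)} {r : ℝ} (hr : 0 < r)
    {K : ℝ≥0∞} (hK : CubeAverageBound r K μ) {h : ℝ} (h0 : 0 < h) (h1 : h ≤ 1 / 2) (m : ℕ)
    {x y : Rn n} (hxy : ∀ i, |y i - x i| ≤ m * h) :
    μ (cube y h) ≤ (K * (2 ^ n) ^ r) ^ m * μ (cube x h) := by
  induction m generalizing y with
  | zero =>
    have : y = x := by
      ext i
      have := hxy i
      simp only [Nat.cast_zero, zero_mul, abs_nonpos_iff] at this
      linarith
    simp [this]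
  | succ m ih =>
    set z : Rn n := x + ((m : ℝ) / (m + 1)) • (y - x) with hz
    have hm : (0 : ℝ) < m + 1 := by positivity
    have hzi : ∀ i, z i - x i = (m : ℝ) / (m + 1) * (y i - x i) := by
      intro i
      simp [hz]
    have hyi : ∀ i, y i - z i = 1 / (m + 1) * (y i - x i) := by
      intro i
      have := hzi i
      have e : y i - z i = (y i - x i) - (z i - x i) := by ring
      rw [e, this]
      field_simp
      ring
    have a1 : ∀ i, |z i - x i| ≤ m * h := by
      intro i
      rw [hzi, abs_mul, abs_of_nonneg (by positivity)]
      calc (m : ℝ) / (m + 1) * |y i - x i| ≤ (m : ℝ) / (m + 1) * ((m + 1) * h) := by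
            gcongr
            have := hxy i
            push_cast at this
            exact this
        _ = m * h := by field_simp
    have a2 : ∀ i, |y i - z i| ≤ h := by
      intro i
      rw [hyi, abs_mul, abs_of_nonneg (by positivity)]
      calc 1 / ((m : ℝ) + 1) * |y i - x i| ≤ 1 / ((m : ℝ) + 1) * ((m + 1) * h) := by
            gcongr
            have := hxy i
            push_cast at this
            exact this
        _ = h := by field_simp
    calc μ (cube y h) ≤ K * (2 ^ n) ^ r * μ (cube z h) :=
          hK.measure_cube_le_of_dist_le hr h0 h1 a2
      _ ≤ K * (2 ^ n) ^ r * ((K * (2 ^ n) ^ r) ^ m * μ (cube x h)) := by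
          gcongr
          exact ih a1
      _ = _ := by rw [pow_succ]; ring

/-- The measures that behave like `A_r`-weights on balls of bounded radius. -/
structure BallWeight (r : ℝ) (μ : Measure (Rn n)) : Prop where
  ac : μ ≪ volume
  ac' : volume ≪ μ
  lt_top : ∀ s : Set (Rn n), Bornology.IsBounded s → μ s < ∞
  bound : ∀ L : ℝ, 0 < L → ∃ C : ℝ≥0∞, C ≠ ∞ ∧ ∀ (x : Rn n) (t : ℝ), 0 < t → t ≤ L →
    ∀ g : Rn n → ℝ≥0∞, AEMeasurable g volume →
      (∫⁻ y in Metric.closedBall x t, g y) ^ r * μ (Metric.closedBall x t)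
        ≤ C * (ENNReal.ofReal t ^ n) ^ r * ∫⁻ y in Metric.closedBall x t, g y ^ r ∂μ

theorem exists_le_of_le_sum {ι : Type*} [Fintype ι] [Nonempty ι] {a : ℝ≥0∞} {f : ι → ℝ≥0∞}
    (h : a ≤ ∑ i, f i) : ∃ i, a ≤ Fintype.card ι * f i := by
  obtain ⟨i, -, hi⟩ := Finset.exists_max_image Finset.univ f Finset.univ_nonempty
  refine ⟨i, h.trans ?_⟩
  have := Finset.sum_le_card_nsmul Finset.univ f (f i) fun j hj => hi j hj
  simpa using this

/-- A grid of mesh 2t/m with (m+1)^n nodes. The cubes are twice as wide as the mesh, so rounding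
each coordinate down to a node is enough for covering. The bound on the centres is in the form
needed for the chain estimate. -/
theorem cube_subset_iUnion (x : Rn n) {t : ℝ} (ht : 0 < t) {m : ℕ} (hm : 0 < m) :
    ∃ c : (Fin n → Fin (m + 1)) → Rn n,
      (∀ j k i, |c j i - c k i| ≤ m * (4 * t / m)) ∧
      cube x (2 * t) ⊆ ⋃ k, cube (c k) (4 * t / m) := by
  have hm' : (0 : ℝ) < m := by exact_mod_cast hm
  set d : ℝ := 2 * t / m with hd
  have hd0 : 0 < d := by positivity
  have hdm : (m : ℝ) * d = 2 * t := by rw [hd]; field_simp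
  have h4 : 4 * t / m = 2 * d := by rw [hd]; ring
  refine ⟨fun k => WithLp.toLp 2 fun i => x i - t + (k i : ℕ) * d, fun j k i => ?_, ?_⟩
  · have a : ((j i : ℕ) : ℝ) ≤ m := by exact_mod_cast Nat.lt_succ_iff.1 (j i).2
    have b : ((k i : ℕ) : ℝ) ≤ m := by exact_mod_cast Nat.lt_succ_iff.1 (k i).2
    have a' : (0 : ℝ) ≤ (j i : ℕ) := by positivity
    have b' : (0 : ℝ) ≤ (k i : ℕ) := by positivity
    simp only [h4]
    rw [show x i - t + ((j i : ℕ) : ℝ) * d - (x i - t + ((k i : ℕ) : ℝ) * d)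
      = (((j i : ℕ) : ℝ) - (k i : ℕ)) * d by ring, abs_mul, abs_of_pos hd0]
    have : |((j i : ℕ) : ℝ) - (k i : ℕ)| ≤ m := abs_le.2 ⟨by linarith, by linarith⟩
    nlinarith
  · intro y hy
    have hlt : ∀ i, ⌊(y i - x i + t) / d⌋₊ < m + 1 := by
      intro i
      rw [Nat.lt_succ_iff]
      refine Nat.floor_le_of_le ?_
      rw [div_le_iff₀ hd0, hdm]
      have := (abs_le.1 (hy i)).2
      linarith
    refine mem_iUnion.2 ⟨fun i => ⟨_, hlt i⟩, fun i => ?_⟩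
    simp only [h4]
    have h0 : 0 ≤ (y i - x i + t) / d := by
      have := (abs_le.1 (hy i)).1
      exact div_nonneg (by linarith) hd0.le
    have f1 := Nat.floor_le h0
    have f2 := Nat.lt_floor_add_one ((y i - x i + t) / d)
    rw [le_div_iff₀ hd0] at f1
    rw [div_lt_iff₀ hd0] at f2
    rw [abs_le]
    constructor <;> nlinarith

/-- The hypothesis only concerns cubes of volume at most 1. The ball is covered by finitely many
cubes of side at most 1/2, which is where m > 8L comes from. One of them carries at least the
fraction 1/c of ∫g, and chaining shows that its measure is comparable to that of the ball. The
constant depends on L, which is harmless because only bounded radii occur. -/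
theorem exists_ballWeight_const {μ : Measure (Rn n)} {r : ℝ} (hr : 0 < r)
    {K : ℝ≥0∞} (hKtop : K ≠ ∞) (hK : CubeAverageBound r K μ) {L : ℝ} (hL : 0 < L) :
    ∃ C : ℝ≥0∞, C ≠ ∞ ∧ ∀ (x : Rn n) (t : ℝ), 0 < t → t ≤ L →
    ∀ g : Rn n → ℝ≥0∞, AEMeasurable g volume →
      (∫⁻ y in Metric.closedBall x t, g y) ^ r * μ (Metric.closedBall x t)
        ≤ C * (ENNReal.ofReal t ^ n) ^ r * ∫⁻ y in Metric.closedBall x t, g y ^ r ∂μ := by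
  obtain ⟨m, hm⟩ := exists_nat_gt (8 * L)
  have hm0 : 0 < m := by
    have : (0 : ℝ) < m := lt_trans (by positivity) hm
    exact_mod_cast this
  have hm0' : (0 : ℝ) < m := by exact_mod_cast hm0
  set c : ℝ≥0∞ := (Fintype.card (Fin n → Fin (m + 1)) : ℝ≥0∞) with hc
  have hctop : c ≠ ∞ := ENNReal.natCast_ne_top _
  set D : ℝ≥0∞ := (K * (2 ^ n) ^ r) ^ m with hD
  have h2 : ((2 : ℝ≥0∞) ^ n) ^ r ≠ ∞ :=
    ENNReal.rpow_ne_top_of_nonneg hr.le (ENNReal.pow_ne_top (by norm_num))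
  have h4 : ((4 : ℝ≥0∞) ^ n) ^ r ≠ ∞ :=
    ENNReal.rpow_ne_top_of_nonneg hr.le (ENNReal.pow_ne_top (by norm_num))
  have hDtop : D ≠ ∞ := ENNReal.pow_ne_top (ENNReal.mul_ne_top hKtop h2)
  refine ⟨c ^ r * (c * D * K * (4 ^ n) ^ r), ?_, ?_⟩
  · exact ENNReal.mul_ne_top (ENNReal.rpow_ne_top_of_nonneg hr.le hctop)
      (ENNReal.mul_ne_top (ENNReal.mul_ne_top (ENNReal.mul_ne_top hctop hDtop) hKtop) h4)
  intro x t ht htL g hg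
  set B := Metric.closedBall x t with hB
  have hBm : MeasurableSet B := Metric.isClosed_closedBall.measurableSet
  obtain ⟨ctr, hc1, hc2⟩ := cube_subset_iUnion x ht hm0
  set h : ℝ := 4 * t / m with hh
  have hh0 : 0 < h := by positivity
  have hh1 : h ≤ 1 / 2 := by
    rw [hh, div_le_iff₀ hm0']
    linarith
  have hh4 : h ≤ 4 * t := by
    rw [hh]
    refine div_le_self (by positivity) ?_
    exact_mod_cast hm0
  have hBQ : B ⊆ ⋃ k, cube (ctr k) h := (closedBall_subset_cube x t).trans hc2
  set g' := B.indicator g with hg'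
  have hg'm : AEMeasurable g' volume := hg.indicator hBm
  have e1 : ∫⁻ y in B, g y = ∫⁻ y in B, g' y := by
    refine setLIntegral_congr_fun hBm fun y hy => ?_
    simp [hg', hy]
  have l1 : ∫⁻ y in B, g y ≤ ∑ k, ∫⁻ y in cube (ctr k) h, g' y := by
    rw [e1]
    exact ((lintegral_mono_set hBQ).trans (lintegral_iUnion_le _ _)).trans_eq (tsum_fintype _)
  obtain ⟨j, hj⟩ := exists_le_of_le_sum l1
  have l2 : μ B ≤ c * D * μ (cube (ctr j) h) := by
    calc μ B ≤ ∑' k, μ (cube (ctr k) h) := (measure_mono hBQ).trans (measure_iUnion_le _)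
      _ = ∑ k, μ (cube (ctr k) h) := tsum_fintype _
      _ ≤ ∑ _k : (Fin n → Fin (m + 1)), D * μ (cube (ctr j) h) := by
          refine Finset.sum_le_sum fun k _ => ?_
          exact hK.measure_cube_le_chain hr hh0 hh1 m (fun i => hc1 k j i)
      _ = _ := by simp [hc, mul_assoc]
  have hV1 : volume (cube (ctr j) h) ≤ 1 := by
    rw [volume_cube]
    refine pow_le_one₀ (by positivity) ?_
    rw [← ENNReal.ofReal_one]
    exact ENNReal.ofReal_le_ofReal (by linarith)
  have key := hK _ ⟨ctr j, h, hh0, rfl⟩ hV1 g' hg'm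
  have hV : volume (cube (ctr j) h) ≤ 4 ^ n * ENNReal.ofReal t ^ n := by
    rw [volume_cube, ← mul_pow]
    gcongr
    refine (ENNReal.ofReal_le_ofReal hh4).trans ?_
    rw [ENNReal.ofReal_mul (by norm_num)]
    simp
  have l3 : ∫⁻ y in cube (ctr j) h, g' y ^ r ∂μ ≤ ∫⁻ y in B, g y ^ r ∂μ := by
    have : ∀ y, g' y ^ r = B.indicator (fun y => g y ^ r) y := by
      intro y
      by_cases hy : y ∈ B <;> simp [hg', hy, hr]
    simp only [this]
    refine (setLIntegral_le_lintegral _ _).trans ?_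
    rw [lintegral_indicator hBm]
  calc (∫⁻ y in B, g y) ^ r * μ B
      ≤ (c * ∫⁻ y in cube (ctr j) h, g' y) ^ r * (c * D * μ (cube (ctr j) h)) := by gcongr
    _ = c ^ r * (c * D) * ((∫⁻ y in cube (ctr j) h, g' y) ^ r * μ (cube (ctr j) h)) := by
        rw [ENNReal.mul_rpow_of_nonneg _ _ hr.le]; ring
    _ ≤ c ^ r * (c * D) * (K * (4 ^ n * ENNReal.ofReal t ^ n) ^ r
          * ∫⁻ y in B, g y ^ r ∂μ) := by
        refine mul_le_mul_right (key.trans ?_) _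
        gcongr
    _ = _ := by rw [ENNReal.mul_rpow_of_nonneg _ _ hr.le]; ring

theorem exists_ballWeight {w : Rn n → ℝ} (hw : IsLocalAInfty w) {r : ℝ} (hr0 : 0 < r)
    (hr : criticalIndex w < r) : BallWeight r (wMeasure w) := by
  obtain ⟨hW, K, hKtop, hK⟩ := exists_cubeAverageBound hw hr
  exact ⟨wMeasure_absolutelyContinuous w, hW.absolutelyContinuous, fun s hs => hW.measure_lt_top hs,
    fun L hL => exists_ballWeight_const hr0 hKtop hK hL⟩

namespace BallWeight

variable {r : ℝ} {μ : Measure (Rn n)}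

theorem measure_closedBall_pos (hμ : BallWeight r μ) (x : Rn n) {t : ℝ} (ht : 0 < t) :
    0 < μ (Metric.closedBall x t) := by
  rw [pos_iff_ne_zero]
  exact fun h => (Metric.measure_closedBall_pos volume x ht).ne' (hμ.ac' h)

theorem measure_closedBall_lt_top (hμ : BallWeight r μ) (x : Rn n) (t : ℝ) :
    μ (Metric.closedBall x t) < ∞ := hμ.lt_top _ Metric.isBounded_closedBall

/-- Test the inequality on the indicator of the smaller ball. The growth exponent n r obtained here
is the one that the decay of an atom with vanishing moments has to beat. -/
theorem doubling (hμ : BallWeight r μ) (hr : 0 < r) {L : ℝ} (hL : 0 < L) :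
    ∃ C : ℝ≥0∞, C ≠ ∞ ∧ ∀ (x y : Rn n) (t u : ℝ), 0 < t → t ≤ L → 0 < u →
      Metric.closedBall y u ⊆ Metric.closedBall x t →
      μ (Metric.closedBall x t)
        ≤ C * ENNReal.ofReal ((t / u) ^ (n * r)) * μ (Metric.closedBall y u) := by
  obtain ⟨C, hC, h⟩ := hμ.bound L hL
  set v : ℝ≥0∞ := volume (Metric.ball (0 : Rn n) 1) with hv
  have hv0 : v ≠ 0 := (Metric.measure_ball_pos volume _ one_pos).ne'
  have hv1 : v ≠ ∞ := measure_ball_lt_top.ne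
  have hvr0 : v ^ r ≠ 0 := by simp [ENNReal.rpow_eq_zero_iff, hv0, hv1]
  have hvr1 : v ^ r ≠ ∞ := ENNReal.rpow_ne_top_of_nonneg hr.le hv1
  refine ⟨C * (v ^ r)⁻¹, ENNReal.mul_ne_top hC (ENNReal.inv_ne_top.2 hvr0), ?_⟩
  intro x y t u ht htL hu hsub
  have hm : MeasurableSet (Metric.closedBall y u) := Metric.isClosed_closedBall.measurableSet
  have key := h x t ht htL ((Metric.closedBall y u).indicator 1)
    ((measurable_one.indicator hm).aemeasurable)
  have e1 : ∫⁻ z in Metric.closedBall x t, (Metric.closedBall y u).indicator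
      (1 : Rn n → ℝ≥0∞) z = ENNReal.ofReal u ^ n * v := by
    rw [lintegral_indicator_one hm, Measure.restrict_apply hm, inter_eq_left.2 hsub,
      Measure.addHaar_closedBall _ _ hu.le, finrank_euclideanSpace, Fintype.card_fin,
      ENNReal.ofReal_pow hu.le]
  have e2 : ∫⁻ z in Metric.closedBall x t, (Metric.closedBall y u).indicator
      (1 : Rn n → ℝ≥0∞) z ^ r ∂μ = μ (Metric.closedBall y u) := by
    have : ∀ z, (Metric.closedBall y u).indicator (1 : Rn n → ℝ≥0∞) z ^ r
        = (Metric.closedBall y u).indicator (1 : Rn n → ℝ≥0∞) z := by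
      intro z
      by_cases hz : z ∈ Metric.closedBall y u
      · simp [indicator_of_mem hz]
      · simp [indicator_of_notMem hz, hr]
    simp only [this]
    rw [lintegral_indicator_one hm, Measure.restrict_apply hm, inter_eq_left.2 hsub]
  rw [e1, e2, ENNReal.mul_rpow_of_nonneg _ _ hr.le] at key
  have hu0 := ofReal_pow_rpow_ne_zero hu n r
  have hu1 := ofReal_pow_rpow_ne_top u n hr.le
  have e3 : (ENNReal.ofReal u ^ n) ^ r * ENNReal.ofReal ((t / u) ^ (n * r))
      = (ENNReal.ofReal t ^ n) ^ r := by
    rw [← ENNReal.ofReal_pow hu.le, ← ENNReal.ofReal_pow ht.le,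
      ENNReal.ofReal_rpow_of_pos (by positivity), ENNReal.ofReal_rpow_of_pos (by positivity),
      ← ENNReal.ofReal_mul (by positivity)]
    congr 1
    rw [Real.rpow_mul (by positivity), Real.rpow_natCast, ← Real.mul_rpow (by positivity)
      (by positivity), div_pow]
    congr 1
    field_simp
  have h0 : (ENNReal.ofReal u ^ n) ^ r * v ^ r ≠ 0 := mul_ne_zero hu0 hvr0
  have h1 : (ENNReal.ofReal u ^ n) ^ r * v ^ r ≠ ∞ := ENNReal.mul_ne_top hu1 hvr1
  refine (ENNReal.mul_le_mul_iff_right h0 h1).1 (key.trans (le_of_eq ?_))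
  rw [← e3]
  calc C * ((ENNReal.ofReal u ^ n) ^ r * ENNReal.ofReal ((t / u) ^ (n * r)))
        * μ (Metric.closedBall y u)
      = (v ^ r * (v ^ r)⁻¹) * (C * ((ENNReal.ofReal u ^ n) ^ r
        * ENNReal.ofReal ((t / u) ^ (n * r))) * μ (Metric.closedBall y u)) := by
        rw [ENNReal.mul_inv_cancel hvr0 hvr1, one_mul]
    _ = _ := by ring

/-- Balls of comparable bounded radii have comparable measure. -/
theorem doubling_const (hμ : BallWeight r μ) (hr : 0 < r) {L : ℝ} (hL : 0 < L) (c : ℝ) :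
    ∃ C : ℝ≥0∞, C ≠ ∞ ∧ ∀ (x y : Rn n) (t u : ℝ), 0 < t → t ≤ L → 0 < u → t ≤ c * u →
      Metric.closedBall y u ⊆ Metric.closedBall x t →
      μ (Metric.closedBall x t) ≤ C * μ (Metric.closedBall y u) := by
  obtain ⟨C, hC, h⟩ := hμ.doubling hr hL
  refine ⟨C * ENNReal.ofReal (c ^ (n * r)), ENNReal.mul_ne_top hC ENNReal.ofReal_ne_top, ?_⟩
  intro x y t u ht htL hu htu hsub
  refine (h x y t u ht htL hu hsub).trans ?_
  gcongr
  rwa [div_le_iff₀ hu]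

end BallWeight

end BallWeights

/-! ### The local maximal function: weak type (r, r) and Kolmogorov's inequality. -/

section LocalMaximal

variable {n : ℕ}

theorem rpow_sum_le_sum_rpow {ι : Type*} (s : Finset ι) (f : ι → ℝ≥0∞) {p : ℝ} (hp : 0 < p)
    (hp1 : p ≤ 1) : (∑ i ∈ s, f i) ^ p ≤ ∑ i ∈ s, f i ^ p := by
  classical
  induction s using Finset.induction_on with
  | empty => simp [hp]
  | insert i s hi ih =>
    rw [Finset.sum_insert hi, Finset.sum_insert hi]
    exact (ENNReal.rpow_add_le_add_rpow _ _ hp.le hp1).trans (by gcongr)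

theorem rpow_tsum_le_tsum_rpow {ι : Type*} (f : ι → ℝ≥0∞) {p : ℝ} (hp : 0 < p)
    (hp1 : p ≤ 1) : (∑' i, f i) ^ p ≤ ∑' i, f i ^ p := by
  have h : Tendsto (fun s : Finset ι => (∑ i ∈ s, f i) ^ p) atTop (𝓝 ((∑' i, f i) ^ p)) :=
    (ENNReal.continuous_rpow_const.tendsto _).comp ENNReal.summable.hasSum
  refine le_of_tendsto h (Eventually.of_forall fun s => ?_)
  exact (rpow_sum_le_sum_rpow s f hp hp1).trans (ENNReal.sum_le_tsum s)

/-- The local (centred) Hardy–Littlewood maximal function. -/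
def localMaximal (g : Rn n → ℝ≥0∞) (x : Rn n) : ℝ≥0∞ :=
  ⨆ (t : ℝ) (_ : 0 < t) (_ : t < 1), (ENNReal.ofReal t ^ n)⁻¹ * ∫⁻ y in Metric.ball x t, g y

/-- An open ball is the increasing union of the concentric balls of slightly smaller radius, and
these remain inside when the centre moves a little. This is why `localMaximal` uses open balls: it
is then measurable without any hypothesis on `g`. -/
theorem lowerSemicontinuous_measure_ball (ν : Measure (Rn n)) (t : ℝ) :
    LowerSemicontinuous fun x : Rn n => ν (Metric.ball x t) := by
  intro x c hc
  have hU : Metric.ball x t = ⋃ k : ℕ, Metric.ball x (t - 1 / ((k : ℝ) + 1)) := by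
    ext y
    simp only [mem_iUnion, Metric.mem_ball]
    constructor
    · intro hy
      obtain ⟨k, hk⟩ := exists_nat_one_div_lt (sub_pos.2 hy)
      exact ⟨k, by linarith⟩
    · rintro ⟨k, hk⟩
      have : 0 < 1 / ((k : ℝ) + 1) := by positivity
      linarith
  have hmono : Monotone fun k : ℕ => Metric.ball x (t - 1 / ((k : ℝ) + 1)) := by
    intro k l hkl
    refine Metric.ball_subset_ball ?_
    have : 1 / ((l : ℝ) + 1) ≤ 1 / ((k : ℝ) + 1) := by
      gcongr
    linarith
  change c < ν (Metric.ball x t) at hc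
  rw [hU, hmono.measure_iUnion] at hc
  obtain ⟨k, hk⟩ := lt_iSup_iff.1 hc
  have hpos : 0 < 1 / ((k : ℝ) + 1) := by positivity
  filter_upwards [Metric.ball_mem_nhds x hpos] with y hy
  refine hk.trans_le (measure_mono ?_)
  refine Metric.ball_subset_ball' ?_
  rw [dist_comm]
  have := Metric.mem_ball.1 hy
  linarith

theorem measurable_localMaximal (g : Rn n → ℝ≥0∞) : Measurable (localMaximal g) := by
  refine LowerSemicontinuous.measurable ?_
  refine lowerSemicontinuous_iSup fun t => lowerSemicontinuous_iSup fun ht =>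
    lowerSemicontinuous_iSup fun _ => ?_
  have h := lowerSemicontinuous_measure_ball
    ((ENNReal.ofReal t ^ n)⁻¹ • (volume : Measure (Rn n)).withDensity g) t
  convert h using 2 with x
  rw [Measure.smul_apply, withDensity_apply _ Metric.isOpen_ball.measurableSet, smul_eq_mul]

/-- Vitali's covering argument: at each point of the superlevel set the average bound gives a ball
on which λ^r μ(B) is at most C∫_B g^r. A disjoint subfamily, enlarged five times, covers the set.
All radii stay below 5, so doubling with a fixed constant applies. -/
theorem BallWeight.weak_type {r : ℝ} {μ : Measure (Rn n)} (hμ : BallWeight r μ) (hr : 0 < r) :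
    ∃ C : ℝ≥0∞, C ≠ ∞ ∧ ∀ g : Rn n → ℝ≥0∞, AEMeasurable g volume → ∀ lam : ℝ≥0∞,
      lam ^ r * μ {x | lam < localMaximal g x} ≤ C * ∫⁻ x, g x ^ r ∂μ := by
  obtain ⟨C₁, hC₁, h1⟩ := hμ.bound 1 one_pos
  obtain ⟨C₂, hC₂, h2⟩ := hμ.doubling_const hr (by norm_num : (0 : ℝ) < 5) 5
  refine ⟨C₂ * C₁, ENNReal.mul_ne_top hC₂ hC₁, fun g hg lam => ?_⟩
  set E := {x | lam < localMaximal g x} with hE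
  have hex : ∀ x ∈ E, ∃ t : ℝ, 0 < t ∧ t < 1 ∧
      lam ^ r * μ (Metric.closedBall x t)
        ≤ C₁ * ∫⁻ y in Metric.closedBall x t, g y ^ r ∂μ := by
    intro x hx
    simp only [hE, localMaximal, Set.mem_ofPred_eq, lt_iSup_iff] at hx
    obtain ⟨t, ht0, ht1, ht⟩ := hx
    refine ⟨t, ht0, ht1, ?_⟩
    have hb := h1 x t ht0 ht1.le g hg
    have hT0 : ENNReal.ofReal t ^ n ≠ 0 := pow_ne_zero _ (by simpa using ht0)
    have hT1 : ENNReal.ofReal t ^ n ≠ ∞ := ENNReal.pow_ne_top ENNReal.ofReal_ne_top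
    have hl : ENNReal.ofReal t ^ n * lam ≤ ∫⁻ y in Metric.closedBall x t, g y := by
      calc ENNReal.ofReal t ^ n * lam
          ≤ ENNReal.ofReal t ^ n * ((ENNReal.ofReal t ^ n)⁻¹ * ∫⁻ y in Metric.ball x t, g y) := by
            gcongr
        _ = ∫⁻ y in Metric.ball x t, g y := by
            rw [← mul_assoc, ENNReal.mul_inv_cancel hT0 hT1, one_mul]
        _ ≤ _ := lintegral_mono_set Metric.ball_subset_closedBall
    have h3 : (ENNReal.ofReal t ^ n) ^ r * (lam ^ r * μ (Metric.closedBall x t))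
        ≤ (ENNReal.ofReal t ^ n) ^ r
          * (C₁ * ∫⁻ y in Metric.closedBall x t, g y ^ r ∂μ) := by
      calc (ENNReal.ofReal t ^ n) ^ r * (lam ^ r * μ (Metric.closedBall x t))
          = (ENNReal.ofReal t ^ n * lam) ^ r * μ (Metric.closedBall x t) := by
            rw [ENNReal.mul_rpow_of_nonneg _ _ hr.le, mul_assoc]
        _ ≤ (∫⁻ y in Metric.closedBall x t, g y) ^ r * μ (Metric.closedBall x t) := by gcongr
        _ ≤ _ := hb.trans (le_of_eq (by ring))
    exact (ENNReal.mul_le_mul_iff_right (ofReal_pow_rpow_ne_zero ht0 n r)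
      (ofReal_pow_rpow_ne_top t n hr.le)).1 h3
  choose! ρ hρ0 hρ1 hρ using hex
  obtain ⟨u, huE, hdisj, hcov⟩ := Vitali.exists_disjoint_subfamily_covering_enlargement_closedBall
    E (fun x : Rn n => x) ρ 1 (fun x hx => (hρ1 x hx).le) 5 (by norm_num)
  have hucount : u.Countable := by
    refine hdisj.countable_of_nonempty_interior fun x hx => ?_
    refine ⟨x, ?_⟩
    rw [mem_interior_iff_mem_nhds]
    exact Metric.closedBall_mem_nhds x (hρ0 x (huE hx))
  have : Countable u := hucount.to_subtype
  have hsub : E ⊆ ⋃ b : u, Metric.closedBall (b : Rn n) (5 * ρ b) := by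
    intro x hx
    obtain ⟨b, hb, hxb⟩ := hcov x hx
    exact mem_iUnion.2 ⟨⟨b, hb⟩, hxb (Metric.mem_closedBall_self (hρ0 x hx).le)⟩
  calc lam ^ r * μ E ≤ lam ^ r * ∑' b : u, μ (Metric.closedBall (b : Rn n) (5 * ρ b)) := by
        gcongr
        exact (measure_mono hsub).trans (measure_iUnion_le _)
    _ = ∑' b : u, lam ^ r * μ (Metric.closedBall (b : Rn n) (5 * ρ b)) := by
        rw [ENNReal.tsum_mul_left]
    _ ≤ ∑' b : u, C₂ * C₁ * ∫⁻ y in Metric.closedBall (b : Rn n) (ρ b), g y ^ r ∂μ := by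
        refine ENNReal.tsum_le_tsum fun b => ?_
        have hb := huE b.2
        have p0 := hρ0 b hb
        have p1 := hρ1 b hb
        calc lam ^ r * μ (Metric.closedBall (b : Rn n) (5 * ρ b))
            ≤ lam ^ r * (C₂ * μ (Metric.closedBall (b : Rn n) (ρ b))) := by
              gcongr
              exact h2 b b _ _ (by positivity) (by linarith) p0 le_rfl
                (Metric.closedBall_subset_closedBall (by linarith))
          _ = C₂ * (lam ^ r * μ (Metric.closedBall (b : Rn n) (ρ b))) := by ring
          _ ≤ C₂ * (C₁ * ∫⁻ y in Metric.closedBall (b : Rn n) (ρ b), g y ^ r ∂μ) := by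
              exact mul_le_mul_right (hρ b hb) _
          _ = _ := by ring
    _ = C₂ * C₁ * ∫⁻ y in ⋃ b : u, Metric.closedBall (b : Rn n) (ρ b), g y ^ r ∂μ := by
        rw [ENNReal.tsum_mul_left, lintegral_iUnion]
        · exact fun b => Metric.isClosed_closedBall.measurableSet
        · intro b c hbc
          exact hdisj b.2 c.2 (fun h => hbc (Subtype.ext h))
    _ ≤ _ := by
        gcongr
        exact Measure.restrict_le_self

/-- A dyadic layer decomposition above the height λ. The weak-type bound makes the k-th layer at
most a multiple of 2^{k(p - r)}, which is summable since p < r; below 2λ the function is estimated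
by a constant. -/
theorem lintegral_rpow_le_of_weak_type {α : Type*} [MeasurableSpace α] {ν : Measure α}
    {G : α → ℝ≥0∞} (hG : Measurable G) {p r : ℝ} (hp : 0 < p) (hpr : p < r) {A : ℝ≥0∞}
    (hA : ∀ lam : ℝ≥0∞, lam ^ r * ν {x | lam < G x} ≤ A) {lam : ℝ≥0∞} (h0 : lam ≠ 0)
    (h1 : lam ≠ ∞) :
    ∫⁻ x, G x ^ p ∂ν ≤ (2 * lam) ^ p * ν univ
      + 4 ^ p * (1 - 2 ^ (p - r))⁻¹ * (lam ^ (p - r) * A) := by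
  have hr : 0 < r := hp.trans hpr
  have hpt : ∀ x, G x ^ p ≤ (2 * lam) ^ p + ∑' k : ℕ,
      {x | 2 ^ k * lam < G x}.indicator (fun _ => (4 * (2 ^ k * lam)) ^ p) x := by
    intro x
    by_cases hx : G x ≤ 2 * lam
    · exact (ENNReal.rpow_le_rpow hx hp.le).trans le_self_add
    push Not at hx
    by_cases htop : G x = ∞
    · refine le_trans ?_ le_add_self
      have : ∑' k : ℕ, {x | 2 ^ k * lam < G x}.indicator (fun _ => (4 * (2 ^ k * lam)) ^ p) x
          = ∞ := by
        refine top_le_iff.1 ?_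
        have hterm : ∀ k : ℕ, (4 * lam) ^ p ≤
            {x | 2 ^ k * lam < G x}.indicator (fun _ => (4 * (2 ^ k * lam)) ^ p) x := by
          intro k
          rw [indicator_of_mem]
          · gcongr
            exact le_mul_of_one_le_left (by positivity) (one_le_pow₀ (by norm_num))
          · change _ < G x
            rw [htop]
            exact (ENNReal.mul_ne_top (ENNReal.pow_ne_top (by norm_num)) h1).lt_top
        refine le_trans (le_of_eq ?_) (ENNReal.tsum_le_tsum hterm)
        rw [ENNReal.tsum_const_eq_top_of_ne_zero]
        simp [ENNReal.rpow_eq_zero_iff, h0, hp, hp.not_gt]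
      rw [this]
      exact le_top
    · have hGl : 1 ≤ (G x / lam).toReal := by
        rw [← ENNReal.toReal_one]
        refine ENNReal.toReal_mono (ENNReal.div_ne_top htop h0) ?_
        rw [ENNReal.le_div_iff_mul_le (Or.inl h0) (Or.inl h1), one_mul]
        refine le_trans ?_ hx.le
        exact le_mul_of_one_le_left (by positivity) (by norm_num)
      obtain ⟨k, hk1, hk2⟩ := exists_nat_pow_near hGl (by norm_num : (1 : ℝ) < 2)
      have hfin : G x / lam ≠ ∞ := ENNReal.div_ne_top htop h0
      have hk1' : (2 : ℝ≥0∞) ^ k ≤ G x / lam := by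
        rw [← ENNReal.ofReal_toReal hfin]
        have := ENNReal.ofReal_le_ofReal hk1
        rwa [ENNReal.ofReal_pow (by norm_num), ENNReal.ofReal_ofNat] at this
      have hk2' : G x / lam < (2 : ℝ≥0∞) ^ (k + 1) := by
        rw [← ENNReal.ofReal_toReal hfin]
        have := (ENNReal.ofReal_lt_ofReal_iff (by positivity)).2 hk2
        rwa [ENNReal.ofReal_pow (by norm_num), ENNReal.ofReal_ofNat] at this
      rw [ENNReal.le_div_iff_mul_le (Or.inl h0) (Or.inl h1)] at hk1'
      rw [ENNReal.div_lt_iff (Or.inl h0) (Or.inl h1)] at hk2'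
      -- As G > 2λ, the exponent can be lowered by one: with k = j + 1, the strict inequality 2^j λ
      -- < G holds, as required by the layer sets, and still G < 4 · 2^j λ.
      have hkpos : k ≠ 0 := by
        rintro rfl
        simp only [zero_add, pow_one] at hk2'
        exact absurd hx hk2'.not_gt
      obtain ⟨j, rfl⟩ := Nat.exists_eq_succ_of_ne_zero hkpos
      refine le_trans ?_ le_add_self
      refine le_trans ?_ (ENNReal.le_tsum j)
      rw [indicator_of_mem]
      · gcongr
        refine hk2'.le.trans (le_of_eq ?_)
        rw [pow_succ, pow_succ]
        ring
      · change _ < G x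
        refine lt_of_lt_of_le ?_ hk1'
        have hj : (2 : ℝ≥0∞) ^ j < 2 ^ (j + 1) := by
          exact_mod_cast (pow_lt_pow_right₀ (by norm_num) (Nat.lt_succ_self j) :
            (2 : ℕ) ^ j < 2 ^ (j + 1))
        exact ENNReal.mul_lt_mul_left h0 h1 hj
  calc ∫⁻ x, G x ^ p ∂ν
      ≤ ∫⁻ x, ((2 * lam) ^ p + ∑' k : ℕ,
          {x | 2 ^ k * lam < G x}.indicator (fun _ => (4 * (2 ^ k * lam)) ^ p) x) ∂ν :=
        lintegral_mono hpt
    _ = (2 * lam) ^ p * ν univ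
          + ∑' k : ℕ, (4 * (2 ^ k * lam)) ^ p * ν {x | 2 ^ k * lam < G x} := by
        rw [lintegral_add_left measurable_const, lintegral_const, lintegral_tsum]
        · congr 1
          refine tsum_congr fun k => ?_
          rw [lintegral_indicator_const (measurableSet_lt measurable_const hG)]
        · intro k
          exact (measurable_const.indicator
            (measurableSet_lt measurable_const hG)).aemeasurable
    _ ≤ (2 * lam) ^ p * ν univ + ∑' k : ℕ, 4 ^ p * (lam ^ (p - r) * A) * (2 ^ (p - r)) ^ k := by
        refine add_le_add le_rfl (ENNReal.tsum_le_tsum fun k => ?_)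
        have hL0 : (2 : ℝ≥0∞) ^ k * lam ≠ 0 := mul_ne_zero (by positivity) h0
        have hL1 : (2 : ℝ≥0∞) ^ k * lam ≠ ∞ := ENNReal.mul_ne_top (ENNReal.pow_ne_top (by norm_num)) h1
        have e : (2 ^ k * lam) ^ p = (2 ^ k * lam) ^ (p - r) * (2 ^ k * lam) ^ r := by
          rw [← ENNReal.rpow_add _ _ hL0 hL1]
          congr 1
          ring
        have e2 : ((2 : ℝ≥0∞) ^ k * lam) ^ (p - r) = (2 ^ (p - r)) ^ k * lam ^ (p - r) := by
          rw [ENNReal.mul_rpow_of_ne_zero (by positivity) h0, ← ENNReal.rpow_natCast,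
            ← ENNReal.rpow_natCast, ← ENNReal.rpow_mul, ← ENNReal.rpow_mul, mul_comm (k : ℝ)]
        calc (4 * (2 ^ k * lam)) ^ p * ν {x | 2 ^ k * lam < G x}
            = 4 ^ p * (2 ^ k * lam) ^ (p - r)
              * ((2 ^ k * lam) ^ r * ν {x | 2 ^ k * lam < G x}) := by
              rw [ENNReal.mul_rpow_of_nonneg _ _ hp.le, e]; ring
          _ ≤ 4 ^ p * (2 ^ k * lam) ^ (p - r) * A := mul_le_mul_right (hA _) _
          _ = _ := by rw [e2]; ring
    _ = _ := by
        rw [ENNReal.tsum_mul_left, ENNReal.tsum_geometric]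
        ring

/-- Kolmogorov's inequality for the local maximal function. -/
theorem BallWeight.lintegral_localMaximal_le {r : ℝ} {μ : Measure (Rn n)} (hμ : BallWeight r μ)
    {p : ℝ} (hp : 0 < p) (hpr : p < r) :
    ∃ C : ℝ≥0∞, C ≠ ∞ ∧ ∀ g : Rn n → ℝ≥0∞, AEMeasurable g volume → ∀ E : Set (Rn n), μ E ≠ ∞ →
      ∫⁻ x in E, localMaximal g x ^ p ∂μ
        ≤ C * (μ E ^ (1 - p / r) * (∫⁻ x, g x ^ r ∂μ) ^ (p / r)) := by
  have hr : 0 < r := hp.trans hpr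
  obtain ⟨C₀, hC₀, hweak⟩ := hμ.weak_type hr
  set C₁ : ℝ≥0∞ := C₀ + 1 with hC₁
  have hC₁0 : C₁ ≠ 0 := by simp [hC₁]
  have hC₁t : C₁ ≠ ∞ := by simp [hC₁, hC₀]
  have h2pr : (2 : ℝ≥0∞) ^ (p - r) < 1 :=
    ENNReal.rpow_lt_one_of_one_lt_of_neg (by norm_num) (by linarith)
  set C₂ : ℝ≥0∞ := 2 ^ p + 4 ^ p * (1 - 2 ^ (p - r))⁻¹ with hC₂
  have hC₂t : C₂ ≠ ∞ := by
    refine ENNReal.add_ne_top.2 ⟨ENNReal.rpow_ne_top_of_nonneg hp.le (by norm_num), ?_⟩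
    refine ENNReal.mul_ne_top (ENNReal.rpow_ne_top_of_nonneg hp.le (by norm_num)) ?_
    rw [Ne, ENNReal.inv_eq_top, tsub_eq_zero_iff_le, not_le]
    exact h2pr
  have hC₂0 : C₂ ≠ 0 := by
    have : (2 : ℝ≥0∞) ^ p ≠ 0 := by simp [ENNReal.rpow_eq_zero_iff, hp.not_gt]
    simp [hC₂, this]
  have hpr0 : 0 < p / r := by positivity
  refine ⟨C₂ * C₁ ^ (p / r), ENNReal.mul_ne_top hC₂t
    (ENNReal.rpow_ne_top_of_nonneg hpr0.le hC₁t), fun g hg E hE => ?_⟩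
  have hG := measurable_localMaximal g
  rcases eq_or_ne (μ E) 0 with hE0 | hE0
  · rw [setLIntegral_measure_zero _ _ hE0]
    exact bot_le
  set I := ∫⁻ x, g x ^ r ∂μ with hI
  rcases eq_or_ne I ∞ with hIt | hIt
  · rw [hIt, ENNReal.top_rpow_of_pos hpr0]
    rw [ENNReal.mul_top, ENNReal.mul_top]
    · exact le_top
    · refine mul_ne_zero hC₂0 ?_
      simp [ENNReal.rpow_eq_zero_iff, hC₁0, hC₁t]
    · simp [ENNReal.rpow_eq_zero_iff, hE0, hE]
  rcases eq_or_ne I 0 with hI0 | hI0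
  · have hzero : ∀ᵐ x ∂μ, localMaximal g x = 0 := by
      have h1 : g =ᵐ[μ] 0 := by
        have := (lintegral_eq_zero_iff' ((hg.mono_ac hμ.ac).pow_const r)).1 hI0
        filter_upwards [this] with x hx
        simpa [ENNReal.rpow_eq_zero_iff, hr, hr.not_gt] using hx
      have h2 : g =ᵐ[volume] 0 := hμ.ac' h1
      refine Eventually.of_forall fun x => ?_
      simp only [localMaximal, ENNReal.iSup_eq_zero]
      intro t _ _
      rw [lintegral_congr_ae (ae_restrict_of_ae h2)]
      simp
    have : ∫⁻ x in E, localMaximal g x ^ p ∂μ = 0 := by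
      refine (lintegral_congr_ae (ae_restrict_of_ae ?_)).trans lintegral_zero
      filter_upwards [hzero] with x hx
      rw [hx, ENNReal.zero_rpow_of_pos hp]
    rw [this]
    exact bot_le
  set A := C₁ * I with hA
  have hA0 : A ≠ 0 := mul_ne_zero hC₁0 hI0
  have hAt : A ≠ ∞ := ENNReal.mul_ne_top hC₁t hIt
  -- The optimal height: it makes the contributions λ^p μ(E) and λ^{p-r} A equal. Adding 1 to the
  -- weak-type constant has ensured that A does not vanish.
  set lam : ℝ≥0∞ := (A / μ E) ^ (1 / r) with hlam
  have hq0 : A / μ E ≠ 0 := (ENNReal.div_pos hA0 hE).ne'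
  have hqt : A / μ E ≠ ∞ := ENNReal.div_ne_top hAt hE0
  have hl0 : lam ≠ 0 := by simp [hlam, ENNReal.rpow_eq_zero_iff, hq0, hqt]
  have hlt : lam ≠ ∞ := ENNReal.rpow_ne_top_of_nonneg (by positivity) hqt
  have key := lintegral_rpow_le_of_weak_type (ν := μ.restrict E) hG hp hpr (A := A) (fun lam => by
    refine le_trans ?_ ((hweak g hg lam).trans ?_)
    · gcongr
      exact Measure.restrict_le_self
    · rw [hA, hC₁]
      gcongr
      exact le_self_add) hl0 hlt
  rw [Measure.restrict_apply_univ] at key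
  have e1 : lam ^ p * μ E = μ E ^ (1 - p / r) * A ^ (p / r) := by
    rw [hlam, ← ENNReal.rpow_mul, show 1 / r * p = p / r by ring,
      ENNReal.div_rpow_of_nonneg _ _ hpr0.le, ENNReal.rpow_sub _ _ hE0 hE, ENNReal.rpow_one]
    simp only [ENNReal.div_eq_inv_mul]
    ring
  have e2 : lam ^ (p - r) * A = μ E ^ (1 - p / r) * A ^ (p / r) := by
    rw [← e1, ENNReal.rpow_sub _ _ hl0 hlt, hlam, ← ENNReal.rpow_mul _ (1 / r) r,
      one_div_mul_cancel hr.ne', ENNReal.rpow_one]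
    rw [ENNReal.div_eq_inv_mul, ENNReal.inv_div (Or.inl hE) (Or.inl hE0), ENNReal.div_eq_inv_mul]
    calc A⁻¹ * μ E * ((A / μ E) ^ (1 / r)) ^ p * A
        = (A⁻¹ * A) * (((A / μ E) ^ (1 / r)) ^ p * μ E) := by ring
      _ = _ := by rw [ENNReal.inv_mul_cancel hA0 hAt, one_mul]
  rw [ENNReal.mul_rpow_of_nonneg _ _ hp.le, mul_assoc, e1, e2, ← add_mul] at key
  refine key.trans (le_of_eq ?_)
  rw [hA, ENNReal.mul_rpow_of_nonneg _ _ hpr0.le, hC₂]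
  ring

end LocalMaximal

/-! ### Moments against Taylor polynomials. -/

section Taylor

variable {n : ℕ}

theorem multilinear_apply_eq_sum {k : ℕ} (m : ContinuousMultilinearMap ℝ (fun _ : Fin k => Rn n) ℝ)
    (h : Fin k → Rn n) :
    m h = ∑ v : Fin k → Fin n, (∏ j, h j (v j)) *
      m fun j => EuclideanSpace.single (v j) (1 : ℝ) := by
  classical
  have e : h = fun j => ∑ i, (h j i) • EuclideanSpace.single i (1 : ℝ) := by
    funext j
    ext i
    simp [Finset.sum_apply, Pi.single_apply]
  conv_lhs => rw [e]
  rw [ContinuousMultilinearMap.map_sum]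
  refine Finset.sum_congr rfl fun v _ => ?_
  rw [ContinuousMultilinearMap.map_smul_univ, smul_eq_mul]

/-- The test classes bound partial derivatives only, while Taylor's formula uses operator norms;
expanding in the standard basis costs a factor n^k. A bound on the basis tuples says nothing about
the sign of `A` when there are no tuples, which forces the case distinction. -/
theorem norm_multilinear_le {k : ℕ} (m : ContinuousMultilinearMap ℝ (fun _ : Fin k => Rn n) ℝ)
    {A : ℝ} (hA : ∀ v : Fin k → Fin n, |m fun j => EuclideanSpace.single (v j) (1 : ℝ)| ≤ A) :
    ‖m‖ ≤ (n : ℝ) ^ k * A := by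
  have hA0 : 0 ≤ (n : ℝ) ^ k * A := by
    rcases isEmpty_or_nonempty (Fin k → Fin n) with hv | ⟨⟨v⟩⟩
    · have : (n : ℝ) ^ k = 0 := by
        have : Fintype.card (Fin k → Fin n) = 0 := Fintype.card_eq_zero
        rw [Fintype.card_fun, Fintype.card_fin, Fintype.card_fin] at this
        exact_mod_cast this
      rw [this, zero_mul]
    · exact mul_nonneg (by positivity) ((abs_nonneg _).trans (hA v))
  refine ContinuousMultilinearMap.opNorm_le_bound hA0 fun h => ?_
  rw [multilinear_apply_eq_sum m h]
  calc ‖∑ v : Fin k → Fin n, (∏ j, h j (v j)) * m fun j => EuclideanSpace.single (v j) (1 : ℝ)‖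
      ≤ ∑ v : Fin k → Fin n, (∏ j, ‖h j‖) * A := by
        refine (norm_sum_le _ _).trans (Finset.sum_le_sum fun v _ => ?_)
        rw [norm_mul]
        refine mul_le_mul ?_ (hA v) (norm_nonneg _) (by positivity)
        rw [norm_prod]
        exact Finset.prod_le_prod (fun _ _ => norm_nonneg _)
          (fun j _ => PiLp.norm_apply_le (h j) (v j))
    _ = _ := by
        rw [Finset.sum_const, Finset.card_univ, Fintype.card_fun, Fintype.card_fin,
          Fintype.card_fin, nsmul_eq_mul]
        push_cast
        ring

theorem norm_iteratedFDeriv_le_of_mem_testClass {N : ℕ} {φ : Test n} (hφ : φ ∈ testClass n N)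
    {k : ℕ} (hk : k ≤ N + 1) (x : Rn n) : ‖iteratedFDeriv ℝ k φ x‖ ≤ (n : ℝ) ^ k := by
  simpa using norm_multilinear_le (iteratedFDeriv ℝ k φ x) fun v => hφ.2.2 k hk v x

theorem abs_le_one_of_mem_testClass {N : ℕ} {φ : Test n} (hφ : φ ∈ testClass n N) (x : Rn n) :
    |φ x| ≤ 1 := by
  have := hφ.2.2 0 (Nat.zero_le _) Fin.elim0 x
  simpa using this

theorem integrable_mul_continuous {a g : Rn n → ℂ} (ha : Integrable a) {x₀ : Rn n} {R : ℝ}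
    (hs : Function.support a ⊆ Metric.closedBall x₀ R) (hg : Continuous g) :
    Integrable fun y => a y * g y := by
  have h := ha.integrableOn.mul_continuousOn (K := Metric.closedBall x₀ R) hg.continuousOn
    (isCompact_closedBall x₀ R)
  refine (integrableOn_iff_integrable_of_support_subset ?_).1 h
  exact fun y hy => hs fun h0 => hy (by simp [h0])

/-- If the moments of `a` of order at most `S` vanish, then so do its integrals against products
of at most `S` affine coordinates. -/
theorem integral_mul_prod_sub_eq_zero {a : Rn n → ℂ} (ha : Integrable a) {x₀ : Rn n} {R : ℝ}
    (hs : Function.support a ⊆ Metric.closedBall x₀ R) {S : ℕ}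
    (hm : ∀ α : Fin n → ℕ, ∑ i, α i ≤ S → ∫ x, a x * (∏ i, ((x i : ℝ) : ℂ) ^ α i) = 0) :
    ∀ (k : ℕ) (v : Fin k → Fin n) (b : Fin k → ℂ) (α : Fin n → ℕ), k + ∑ i, α i ≤ S →
      ∫ x, a x * ((∏ j, (((x (v j) : ℝ) : ℂ) - b j)) * ∏ i, ((x i : ℝ) : ℂ) ^ α i) = 0 := by
  intro k
  induction k with
  | zero =>
    intro v b α hα
    simpa using hm α (by simpa using hα)
  | succ k ih =>
    intro v b α hα
    have h1 := ih (fun j => v j.succ) (fun j => b j.succ) (α + Pi.single (v 0) 1) (by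
      simp only [Pi.add_apply, Finset.sum_add_distrib, Finset.sum_pi_single', Finset.mem_univ,
        if_true]
      omega)
    have h2 := ih (fun j => v j.succ) (fun j => b j.succ) α (by omega)
    have e : ∀ x : Rn n, a x * ((∏ j, (((x (v j) : ℝ) : ℂ) - b j)) * ∏ i, ((x i : ℝ) : ℂ) ^ α i)
        = a x * ((∏ j : Fin k, (((x (v j.succ) : ℝ) : ℂ) - b j.succ))
            * ∏ i, ((x i : ℝ) : ℂ) ^ (α + Pi.single (v 0) 1 : Fin n → ℕ) i)
          - b 0 * (a x * ((∏ j : Fin k, (((x (v j.succ) : ℝ) : ℂ) - b j.succ))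
            * ∏ i, ((x i : ℝ) : ℂ) ^ α i)) := by
      intro x
      have e1 : ∏ i, ((x i : ℝ) : ℂ) ^ (α + Pi.single (v 0) 1 : Fin n → ℕ) i
          = (∏ i, ((x i : ℝ) : ℂ) ^ α i) * ((x (v 0) : ℝ) : ℂ) := by
        simp only [Pi.add_apply, pow_add, Finset.prod_mul_distrib]
        congr 1
        rw [Finset.prod_eq_single (v 0)]
        · simp
        · intro i _ hi
          simp [Pi.single_eq_of_ne hi]
        · simp
      rw [Fin.prod_univ_succ, e1]
      ring
    simp_rw [e]
    rw [integral_sub, integral_const_mul, h1, h2]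
    · simp
    · exact integrable_mul_continuous ha hs (by fun_prop)
    · exact (integrable_mul_continuous ha hs (by fun_prop)).const_mul _

/-- Subtract from ψ its Taylor polynomial of degree S at x₀, which integrates to zero against `a`.
On the support of `a` the integral form of the remainder is at most B R^{S+1}. -/
theorem norm_integral_mul_le_of_moments {a : Rn n → ℂ} (ha : Integrable a) {x₀ : Rn n} {R : ℝ}
    (hs : Function.support a ⊆ Metric.closedBall x₀ R) {S : ℕ}
    (hm : ∀ α : Fin n → ℕ, ∑ i, α i ≤ S → ∫ x, a x * (∏ i, ((x i : ℝ) : ℂ) ^ α i) = 0)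
    {ψ : Rn n → ℝ} (hψ : ContDiff ℝ (⊤ : ℕ∞) ψ) {B : ℝ}
    (hB : ∀ x, ‖iteratedFDeriv ℝ (S + 1) ψ x‖ ≤ B) :
    ‖∫ x, a x * (ψ x : ℂ)‖ ≤ B * R ^ (S + 1) * ∫ x, ‖a x‖ := by
  set P : Rn n → ℝ := fun y =>
    ∑ k ∈ Finset.range (S + 1), (k.factorial : ℝ)⁻¹ • iteratedFDeriv ℝ k ψ x₀ (fun _ => y - x₀)
    with hP
  have hB0 : 0 ≤ B := (norm_nonneg _).trans (hB 0)
  have hPc : Continuous P := by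
    refine continuous_finsetSum _ fun k _ => ?_
    have h : Continuous fun y : Rn n => iteratedFDeriv ℝ k ψ x₀ (fun _ => y - x₀) :=
      (iteratedFDeriv ℝ k ψ x₀).cont.comp (by fun_prop)
    exact continuous_const.mul h
  have hP0 : ∫ x, a x * (P x : ℂ) = 0 := by
    have e : ∀ x, a x * (P x : ℂ) = ∑ k ∈ Finset.range (S + 1), ∑ v : Fin k → Fin n,
        ((((k.factorial : ℝ)⁻¹ * iteratedFDeriv ℝ k ψ x₀ fun j =>
          EuclideanSpace.single (v j) (1 : ℝ) : ℝ)) : ℂ) *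
          (a x * ((∏ j, (((x (v j) : ℝ) : ℂ) - ((x₀ (v j) : ℝ) : ℂ)))
            * ∏ i : Fin n, ((x i : ℝ) : ℂ) ^ (0 : Fin n → ℕ) i)) := by
      intro x
      simp only [hP, Complex.ofReal_sum, Finset.mul_sum]
      refine Finset.sum_congr rfl fun k _ => ?_
      rw [multilinear_apply_eq_sum, smul_eq_mul]
      push_cast
      rw [Finset.mul_sum, Finset.mul_sum]
      refine Finset.sum_congr rfl fun v _ => ?_
      simp
      ring
    simp_rw [e]
    rw [integral_finsetSum]
    · refine Finset.sum_eq_zero fun k hk => ?_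
      rw [integral_finsetSum]
      · refine Finset.sum_eq_zero fun v _ => ?_
        rw [integral_const_mul, integral_mul_prod_sub_eq_zero ha hs hm, mul_zero]
        have := Finset.mem_range.1 hk
        simp
        omega
      · intro v _
        exact (integrable_mul_continuous ha hs (by fun_prop)).const_mul _
    · intro k _
      refine integrable_finsetSum _ fun v _ => ?_
      exact (integrable_mul_continuous ha hs (by fun_prop)).const_mul _
  have hψc : Continuous ψ := hψ.continuous
  have hrem : ∀ y ∈ Metric.closedBall x₀ R, |ψ y - P y| ≤ B * R ^ (S + 1) := by
    intro y hy
    have hy' : ‖y - x₀‖ ≤ R := by simpa [dist_eq_norm] using hy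
    have hT := map_add_eq_sum_add_integral_iteratedFDeriv (n := S) (f := ψ) (x := x₀)
      (y := y - x₀) (fun t _ => (hψ.of_le (by exact_mod_cast le_top)).contDiffAt)
    rw [add_sub_cancel] at hT
    have e : ψ y - P y = (S.factorial : ℝ)⁻¹ • ∫ t in (0 : ℝ)..1, (1 - t) ^ S •
        iteratedFDeriv ℝ (S + 1) ψ (x₀ + t • (y - x₀)) (fun _ => y - x₀) := by
      rw [hT, hP]
      ring
    rw [e, smul_eq_mul, abs_mul]
    have hI : |∫ t in (0 : ℝ)..1, (1 - t) ^ S •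
        iteratedFDeriv ℝ (S + 1) ψ (x₀ + t • (y - x₀)) (fun _ => y - x₀)| ≤ B * R ^ (S + 1) := by
      have := intervalIntegral.norm_integral_le_of_norm_le_const (a := (0 : ℝ)) (b := 1)
        (C := B * R ^ (S + 1)) (f := fun t : ℝ => (1 - t) ^ S •
        iteratedFDeriv ℝ (S + 1) ψ (x₀ + t • (y - x₀)) (fun _ => y - x₀)) ?_
      · simpa using this
      · intro t ht
        rw [uIoc_of_le zero_le_one] at ht
        have h1 : |1 - t| ≤ 1 := by rw [abs_le]; constructor <;> linarith [ht.1, ht.2]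
        have h2 : ‖iteratedFDeriv ℝ (S + 1) ψ (x₀ + t • (y - x₀)) (fun _ => y - x₀)‖
            ≤ B * R ^ (S + 1) := by
          refine (ContinuousMultilinearMap.le_opNorm _ _).trans ?_
          rw [Finset.prod_const, Finset.card_univ, Fintype.card_fin]
          gcongr
          exact hB _
        rw [norm_smul, norm_pow, Real.norm_eq_abs]
        calc |1 - t| ^ S * ‖iteratedFDeriv ℝ (S + 1) ψ (x₀ + t • (y - x₀)) (fun _ => y - x₀)‖
            ≤ 1 * (B * R ^ (S + 1)) :=
              mul_le_mul (pow_le_one₀ (abs_nonneg _) h1) h2 (norm_nonneg _) zero_le_one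
          _ = _ := one_mul _
    have hf : |(S.factorial : ℝ)⁻¹| ≤ 1 := by
      rw [abs_of_nonneg (by positivity)]
      exact inv_le_one_of_one_le₀ (by exact_mod_cast Nat.factorial_pos S)
    calc |(S.factorial : ℝ)⁻¹| * _ ≤ 1 * (B * R ^ (S + 1)) :=
          mul_le_mul hf hI (abs_nonneg _) zero_le_one
      _ = _ := one_mul _
  have e : ∫ x, a x * (ψ x : ℂ) = ∫ x, a x * ((ψ x - P x : ℝ) : ℂ) := by
    have : ∀ x, a x * ((ψ x - P x : ℝ) : ℂ) = a x * (ψ x : ℂ) - a x * (P x : ℂ) := by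
      intro x; push_cast; ring
    simp_rw [this]
    rw [integral_sub, hP0, sub_zero]
    · exact integrable_mul_continuous ha hs (by fun_prop)
    · exact integrable_mul_continuous ha hs (by fun_prop)
  rw [e, ← integral_const_mul]
  refine norm_integral_le_of_norm_le (ha.norm.const_mul _) (Eventually.of_forall fun x => ?_)
  by_cases hx : a x = 0
  · simp [hx]
  · rw [norm_mul, mul_comm, Complex.norm_real]
    exact mul_le_mul_of_nonneg_right (hrem x (hs hx)) (norm_nonneg _)

end Taylor

/-! ### Size estimates for atoms and unit neighbourhoods of large cubes. -/

section AtomEstimates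

variable {n : ℕ}

theorem support_reflectDilate_subset {N : ℕ} {φ : Test n} (hφ : φ ∈ testClass n N) {t : ℝ}
    (ht : 0 < t) (x : Rn n) : Function.support (reflectDilate φ t ht x) ⊆ Metric.ball x t := by
  intro y hy
  have h1 : φ (t⁻¹ • (x - y)) ≠ 0 := by
    intro h
    exact hy (by simp [h])
  have h2 := hφ.1 (subset_tsupport _ h1)
  rw [mem_ball_zero_iff, norm_smul, norm_inv, Real.norm_of_nonneg ht.le, inv_mul_lt_iff₀ ht,
    mul_one] at h2
  rwa [Metric.mem_ball, dist_comm, dist_eq_norm]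

theorem enorm_integral_mul_reflectDilate_le {N : ℕ} {φ : Test n} (hφ : φ ∈ testClass n N) {t : ℝ}
    (ht : 0 < t) (ht1 : t < 1) (a : Rn n → ℂ) (x : Rn n) :
    ‖∫ y, a y * (reflectDilate φ t ht x y : ℂ)‖ₑ ≤ localMaximal (fun y => ‖a y‖ₑ) x := by
  refine le_trans ?_ (le_iSup_of_le t (le_iSup_of_le ht (le_iSup_of_le ht1 le_rfl)))
  refine (enorm_integral_le_lintegral_enorm _).trans ?_
  have hT : ENNReal.ofReal ((t ^ n)⁻¹) = (ENNReal.ofReal t ^ n)⁻¹ := by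
    rw [ENNReal.ofReal_inv_of_pos (by positivity), ENNReal.ofReal_pow ht.le]
  have hT1 : (ENNReal.ofReal t ^ n)⁻¹ ≠ ∞ := hT ▸ ENNReal.ofReal_ne_top
  rw [← lintegral_const_mul' _ _ hT1, ← lintegral_indicator Metric.isOpen_ball.measurableSet]
  refine lintegral_mono fun y => ?_
  by_cases hy : y ∈ Metric.ball x t
  · rw [indicator_of_mem hy, enorm_mul, mul_comm]
    refine mul_le_mul' ?_ le_rfl
    rw [← hT, ← ofReal_norm, Complex.norm_real, reflectDilate_apply, norm_mul,
      Real.norm_of_nonneg (by positivity : (0 : ℝ) ≤ (t ^ n)⁻¹)]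
    refine ENNReal.ofReal_le_ofReal ?_
    exact mul_le_of_le_one_right (by positivity) (abs_le_one_of_mem_testClass hφ _)
  · have : reflectDilate φ t ht x y = 0 := by
      by_contra h
      exact hy (support_reflectDilate_subset hφ ht x h)
    simp [this]

theorem localMaximal_eq_zero {g : Rn n → ℝ≥0∞} {Q : Set (Rn n)} (hg : Function.support g ⊆ Q)
    {x : Rn n} (hx : x ∉ Metric.thickening 1 Q) : localMaximal g x = 0 := by
  simp only [localMaximal, ENNReal.iSup_eq_zero]
  intro t _ ht1
  have : ∫⁻ y in Metric.ball x t, g y = 0 := by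
    rw [← lintegral_zero (μ := volume.restrict (Metric.ball x t))]
    refine setLIntegral_congr_fun Metric.isOpen_ball.measurableSet fun y hy => ?_
    by_contra h
    refine hx (Metric.mem_thickening_iff.2 ⟨y, hg h, ?_⟩)
    rw [dist_comm]
    exact (Metric.mem_ball.1 hy).trans ht1
  rw [this, mul_zero]

/-- By Hölder on Q, the normalisation for exponent q implies the one for any smaller exponent r.
From here on q plays no role and only r, chosen close to the critical index, is used. -/
theorem lintegral_rpow_le_of_eLpNorm_le {μ : Measure (Rn n)} {a : Rn n → ℂ}
    (ha : AEStronglyMeasurable a μ) {Q : Set (Rn n)} (hQ : Function.support a ⊆ Q)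
    (hQ0 : μ Q ≠ 0) (hQt : μ Q ≠ ∞) {p r : ℝ} (hr : 0 < r) {q : ℝ≥0∞}
    (hrq : ENNReal.ofReal r ≤ q) (h : eLpNorm a q μ ≤ μ Q ^ ((q⁻¹).toReal - 1 / p)) :
    ∫⁻ x, ‖a x‖ₑ ^ r ∂μ ≤ μ Q ^ (1 - r / p) := by
  have h1 : eLpNorm a (ENNReal.ofReal r) μ ≤ μ Q ^ (1 / r - 1 / p) := by
    rw [← eLpNorm_restrict_eq_of_support_subset hQ]
    refine (eLpNorm_le_eLpNorm_mul_rpow_measure_univ hrq ha.restrict).trans ?_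
    rw [eLpNorm_restrict_eq_of_support_subset hQ, Measure.restrict_apply_univ,
      ENNReal.toReal_ofReal hr.le]
    refine (mul_le_mul' h le_rfl).trans ?_
    rw [← ENNReal.rpow_add _ _ hQ0 hQt, ENNReal.toReal_inv]
    refine le_of_eq ?_
    congr 1
    ring
  have h2 : eLpNorm a (ENNReal.ofReal r) μ = (∫⁻ x, ‖a x‖ₑ ^ r ∂μ) ^ (1 / r) := by
    rw [eLpNorm_eq_lintegral_rpow_enorm_toReal (by simpa using hr) ENNReal.ofReal_ne_top,
      ENNReal.toReal_ofReal hr.le]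
  rw [h2, one_div, ENNReal.rpow_inv_le_iff hr, ← ENNReal.rpow_mul] at h1
  refine h1.trans (le_of_eq ?_)
  congr 1
  field_simp

/-- The normalisation of an atom is made for Kolmogorov's inequality: the powers of μ(Q) cancel
exactly and leave a constant independent of Q. -/
theorem BallWeight.lintegral_localMaximal_le_const {r : ℝ} {μ : Measure (Rn n)}
    (hμ : BallWeight r μ) {p : ℝ} (hp : 0 < p) (hpr : p < r) {K : ℝ≥0∞} (hK : K ≠ ∞) :
    ∃ C : ℝ≥0∞, C ≠ ∞ ∧ ∀ g : Rn n → ℝ≥0∞, AEMeasurable g volume → ∀ E Q : Set (Rn n),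
      μ Q ≠ 0 → μ Q ≠ ∞ → μ E ≤ K * μ Q → ∫⁻ x, g x ^ r ∂μ ≤ μ Q ^ (1 - r / p) →
      ∫⁻ x in E, localMaximal g x ^ p ∂μ ≤ C := by
  have hr : 0 < r := hp.trans hpr
  have hθ : 0 ≤ 1 - p / r := by
    rw [sub_nonneg, div_le_one hr]
    exact hpr.le
  obtain ⟨C, hC, h⟩ := hμ.lintegral_localMaximal_le hp hpr
  refine ⟨C * K ^ (1 - p / r), ENNReal.mul_ne_top hC (ENNReal.rpow_ne_top_of_nonneg hθ hK), ?_⟩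
  intro g hg E Q h0 ht hE hI
  refine (h g hg E (ne_top_of_le_ne_top (ENNReal.mul_ne_top hK ht) hE)).trans ?_
  refine mul_le_mul_right ?_ _
  calc μ E ^ (1 - p / r) * (∫⁻ x, g x ^ r ∂μ) ^ (p / r)
      ≤ (K * μ Q) ^ (1 - p / r) * (μ Q ^ (1 - r / p)) ^ (p / r) :=
        mul_le_mul' (ENNReal.rpow_le_rpow hE hθ) (ENNReal.rpow_le_rpow hI (by positivity))
    _ = K ^ (1 - p / r) * (μ Q ^ (1 - p / r) * μ Q ^ (p / r - 1)) := by
        rw [ENNReal.mul_rpow_of_nonneg _ _ hθ, ← ENNReal.rpow_mul, mul_assoc]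
        congr 3
        field_simp
    _ = K ^ (1 - p / r) := by
        rw [← ENNReal.rpow_add _ _ h0 ht]
        simp

theorem closedBall_subset_cube_of_mem {x z : Rn n} {l u : ℝ} (hz : z ∈ cube x (l - 2 * u)) :
    Metric.closedBall z u ⊆ cube x l := by
  intro y hy i
  have h1 : |y i - z i| ≤ u := by
    have := PiLp.norm_apply_le (y - z) i
    rw [Metric.mem_closedBall, dist_eq_norm] at hy
    simpa using this.trans hy
  have h2 := hz i
  have : y i - x i = (y i - z i) + (z i - x i) := by ring
  rw [this]
  refine (abs_add_le _ _).trans ?_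
  linarith

theorem norm_le_sqrt_mul {y : Rn n} {c : ℝ} (hc : 0 ≤ c) (h : ∀ i, |y i| ≤ c) :
    ‖y‖ ≤ √n * c := by
  have hy : y ∈ cube (0 : Rn n) (2 * c) := by
    intro i
    simpa using h i
  have := cube_subset_closedBall (0 : Rn n) (by linarith : (0 : ℝ) ≤ 2 * c) hy
  rw [mem_closedBall_zero_iff] at this
  linarith

theorem exists_mem_cube_dist_le {x y : Rn n} {l u : ℝ} (hu : 0 ≤ u) (hl : 2 * u ≤ l)
    (hy : y ∈ cube x l) : ∃ z ∈ cube x (l - 2 * u), dist y z ≤ √n * u := by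
  have hm : ∀ i, max (x i - (l - 2 * u) / 2) (min (x i + (l - 2 * u) / 2) (y i))
      ∈ Icc (x i - (l - 2 * u) / 2) (x i + (l - 2 * u) / 2) := fun i =>
    ⟨le_max_left _ _, max_le (by linarith) (min_le_left _ _)⟩
  refine ⟨WithLp.toLp 2 fun i => max (x i - (l - 2 * u) / 2) (min (x i + (l - 2 * u) / 2) (y i)),
    fun i => ?_, ?_⟩
  · have := hm i
    rw [abs_le]
    constructor <;> simp only <;> linarith [this.1, this.2]
  · rw [dist_eq_norm]
    refine norm_le_sqrt_mul hu fun i => ?_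
    have := abs_le.1 (hy i)
    simp only [PiLp.sub_apply]
    rw [abs_le]
    rcases le_total (x i + (l - 2 * u) / 2) (y i) with h | h
    · rw [min_eq_left h, max_eq_right (by linarith)]
      constructor <;> linarith
    · rw [min_eq_right h]
      rcases le_total (x i - (l - 2 * u) / 2) (y i) with h' | h'
      · rw [max_eq_right h']
        constructor <;> linarith
      · rw [max_eq_left h']
        constructor <;> linarith

/-- The unit neighbourhood of a cube of side at least one has comparable measure. -/
theorem BallWeight.measure_thickening_le {r : ℝ} {μ : Measure (Rn n)} (hμ : BallWeight r μ)
    (hr : 0 < r) : ∃ K : ℝ≥0∞, K ≠ ∞ ∧ ∀ (x : Rn n) (l : ℝ), 1 ≤ l →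
      μ (Metric.thickening 1 (cube x l)) ≤ K * μ (cube x l) := by
  set T : ℝ := 5 / 4 + √n + 1 with hT
  have hTpos : 0 < T := by positivity
  obtain ⟨K, hK, h⟩ := hμ.doubling_const hr hTpos (4 * T)
  refine ⟨K, hK, fun x l hl => ?_⟩
  -- Disjoint balls of radius 1/4 centred in the cube shrunk by 1/4 on each side: they stay inside
  -- the original cube, and enlarged to radius T they cover its unit neighbourhood. T adds up 1, at
  -- most √n/4 for reaching the shrunk cube, and 5/4 from the covering.
  obtain ⟨u, huE, hdisj, hcov⟩ := Vitali.exists_disjoint_subfamily_covering_enlargement_closedBall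
    (cube x (l - 2 * (1 / 4))) (fun x : Rn n => x) (fun _ => (1 / 4 : ℝ)) 1
    (fun x hx => by norm_num) 5 (by norm_num)
  have hucount : u.Countable := by
    refine hdisj.countable_of_nonempty_interior fun x hx => ?_
    refine ⟨x, ?_⟩
    rw [mem_interior_iff_mem_nhds]
    exact Metric.closedBall_mem_nhds x (by norm_num)
  have : Countable u := hucount.to_subtype
  have hsub : Metric.thickening 1 (cube x l) ⊆ ⋃ b : u, Metric.closedBall (b : Rn n) T := by
    intro y hy
    obtain ⟨y', hy', hd⟩ := Metric.mem_thickening_iff.1 hy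
    obtain ⟨z, hz, hdz⟩ := exists_mem_cube_dist_le (by norm_num : (0 : ℝ) ≤ 1 / 4) (by linarith) hy'
    obtain ⟨b, hb, hzb⟩ := hcov z hz
    have hz' := Metric.mem_closedBall.1 (hzb (Metric.mem_closedBall_self (by norm_num)))
    refine mem_iUnion.2 ⟨⟨b, hb⟩, ?_⟩
    rw [Metric.mem_closedBall]
    have t1 := dist_triangle y y' b
    have t2 := dist_triangle y' z b
    have : 0 ≤ √(n : ℝ) := Real.sqrt_nonneg _
    simp only at hz' ⊢
    linarith
  calc μ (Metric.thickening 1 (cube x l))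
      ≤ ∑' b : u, μ (Metric.closedBall (b : Rn n) T) :=
        (measure_mono hsub).trans (measure_iUnion_le _)
    _ ≤ ∑' b : u, K * μ (Metric.closedBall (b : Rn n) (1 / 4)) := by
        refine ENNReal.tsum_le_tsum fun b => ?_
        refine h b b T (1 / 4) hTpos le_rfl (by norm_num) (by linarith)
          (Metric.closedBall_subset_closedBall ?_)
        have : 0 ≤ √(n : ℝ) := Real.sqrt_nonneg _
        linarith
    _ = K * μ (⋃ b : u, Metric.closedBall (b : Rn n) (1 / 4)) := by
        rw [ENNReal.tsum_mul_left, measure_iUnion]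
        · intro b c hbc
          exact hdisj b.2 c.2 (fun h => hbc (Subtype.ext h))
        · exact fun b => Metric.isClosed_closedBall.measurableSet
    _ ≤ K * μ (cube x l) := by
        refine mul_le_mul_right (measure_mono ?_) _
        exact iUnion_subset fun b => closedBall_subset_cube_of_mem (huE b.2)

end AtomEstimates

/-! ### Majorants for atoms with vanishing moments. -/

section SmallAtoms

variable {n : ℕ}

theorem measurableSet_annulus (x₀ : Rn n) (R L : ℝ) :
    MeasurableSet {x : Rn n | R ≤ dist x x₀ ∧ dist x x₀ ≤ L} := by
  have h : Continuous fun x : Rn n => dist x x₀ := continuous_id.dist continuous_const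
  exact MeasurableSet.inter (isClosed_le continuous_const h).measurableSet
    (isClosed_le h continuous_const).measurableSet

/-- On the annulus at distance about 2^j R the integrand is at most 2^{-jpm}, while doubling bounds
the measure by a multiple of 2^{jnr} μ(B(x₀, R)). The hypothesis n r < p m makes the sum geometric.
-/
theorem BallWeight.lintegral_decay_le {r : ℝ} {μ : Measure (Rn n)} (hμ : BallWeight r μ)
    (hr : 0 < r) {p : ℝ} (hp : 0 < p) {m : ℕ} (hm : n * r < p * m) {L : ℝ} (hL : 0 < L) :
    ∃ C : ℝ≥0∞, C ≠ ∞ ∧ ∀ (x₀ : Rn n) (R : ℝ), 0 < R →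
      ∫⁻ x in {x | R ≤ dist x x₀ ∧ dist x x₀ ≤ L}, ENNReal.ofReal ((R / dist x x₀) ^ m) ^ p ∂μ
        ≤ C * μ (Metric.closedBall x₀ R) := by
  obtain ⟨C, hC, h⟩ := hμ.doubling hr (by positivity : 0 < 2 * L)
  set ρ : ℝ := 2 ^ (n * r - p * m) with hρ
  have hρ0 : 0 < ρ := by positivity
  have hρ1 : ρ < 1 := Real.rpow_lt_one_of_one_lt_of_neg (by norm_num) (by linarith)
  set C' : ℝ≥0∞ := C * ENNReal.ofReal (2 ^ (n * r)) * (1 - ENNReal.ofReal ρ)⁻¹ with hC'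
  refine ⟨C', ?_, fun x₀ R hR => ?_⟩
  · refine ENNReal.mul_ne_top (ENNReal.mul_ne_top hC ENNReal.ofReal_ne_top) ?_
    rw [Ne, ENNReal.inv_eq_top, tsub_eq_zero_iff_le, not_le]
    rw [← ENNReal.ofReal_one]
    exact (ENNReal.ofReal_lt_ofReal_iff one_pos).2 hρ1
  -- The extra condition leaves `B j` empty once its radius exceeds 2L. Doubling is thus only used
  -- for bounded radii, and points within distance L of the centre are still covered.
  set B : ℕ → Set (Rn n) := fun j => {x | dist x x₀ ≤ 2 ^ (j + 1) * R ∧ 2 ^ (j + 1) * R ≤ 2 * L}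
    with hB
  have hBm : ∀ j, MeasurableSet (B j) := by
    intro j
    refine MeasurableSet.inter ?_ (MeasurableSet.const _)
    exact (Metric.isClosed_closedBall (x := x₀) (ε := 2 ^ (j + 1) * R)).measurableSet
  set θ : ℝ≥0∞ := ENNReal.ofReal (2 ^ (-(p * m))) with hθ
  have hset : MeasurableSet {x : Rn n | R ≤ dist x x₀ ∧ dist x x₀ ≤ L} := measurableSet_annulus x₀ R L
  rw [← lintegral_indicator hset]
  have hpt : ∀ x, {x | R ≤ dist x x₀ ∧ dist x x₀ ≤ L}.indicator
      (fun x => ENNReal.ofReal ((R / dist x x₀) ^ m) ^ p) x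
      ≤ ∑' j, (B j).indicator (fun _ => θ ^ j) x := by
    intro x
    by_cases hx : x ∈ {x | R ≤ dist x x₀ ∧ dist x x₀ ≤ L}
    swap
    · rw [indicator_of_notMem hx]
      exact bot_le
    rw [indicator_of_mem hx]
    obtain ⟨hx1, hx2⟩ := hx
    have hd : 0 < dist x x₀ := hR.trans_le hx1
    obtain ⟨j, hj1, hj2⟩ := exists_nat_pow_near ((one_le_div hR).2 hx1) (by norm_num : (1 : ℝ) < 2)
    rw [le_div_iff₀ hR] at hj1
    rw [div_lt_iff₀ hR] at hj2
    refine le_trans ?_ (ENNReal.le_tsum j)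
    have hxB : x ∈ B j := by
      refine ⟨hj2.le, ?_⟩
      rw [pow_succ]
      linarith
    rw [indicator_of_mem hxB, hθ, ← ENNReal.ofReal_pow (by positivity),
      ENNReal.ofReal_rpow_of_pos (by positivity)]
    refine ENNReal.ofReal_le_ofReal ?_
    have h1 : R / dist x x₀ ≤ (2 ^ j)⁻¹ := by
      rw [div_le_iff₀ hd, inv_mul_eq_div, le_div_iff₀ (by positivity)]
      linarith
    calc ((R / dist x x₀) ^ m) ^ p ≤ (((2 ^ j)⁻¹) ^ m) ^ p := by gcongr
      _ = (2 ^ (-(p * m))) ^ j := by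
          rw [← Real.rpow_natCast, ← Real.rpow_natCast 2 j, ← Real.rpow_natCast _ j,
            ← Real.rpow_neg (by norm_num), ← Real.rpow_mul (by norm_num),
            ← Real.rpow_mul (by norm_num), ← Real.rpow_mul (by norm_num)]
          congr 1
          ring
  refine (lintegral_mono hpt).trans ?_
  rw [lintegral_tsum (fun j => (measurable_const.indicator (hBm j)).aemeasurable)]
  calc ∑' j, ∫⁻ x, (B j).indicator (fun _ => θ ^ j) x ∂μ
      ≤ ∑' j, C * ENNReal.ofReal (2 ^ (n * r)) * μ (Metric.closedBall x₀ R)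
        * ENNReal.ofReal ρ ^ j := by
        refine ENNReal.tsum_le_tsum fun j => ?_
        rw [lintegral_indicator_const (hBm j)]
        by_cases hj : 2 ^ (j + 1) * R ≤ 2 * L
        · have hsub : B j ⊆ Metric.closedBall x₀ (2 ^ (j + 1) * R) := fun x hx => hx.1
          have h1 := h x₀ x₀ (2 ^ (j + 1) * R) R (by positivity) hj hR
            (Metric.closedBall_subset_closedBall
              (le_mul_of_one_le_left hR.le (one_le_pow₀ (by norm_num))))
          refine (mul_le_mul_right ((measure_mono hsub).trans h1) _).trans (le_of_eq ?_)
          rw [hθ, ← ENNReal.ofReal_pow (by positivity), ← ENNReal.ofReal_pow hρ0.le]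
          have e : ((2 : ℝ) ^ (-(p * m))) ^ j * (2 ^ (j + 1) * R / R) ^ (n * r)
              = 2 ^ (n * r) * ρ ^ j := by
            rw [mul_div_cancel_right₀ _ hR.ne', hρ, ← Real.rpow_natCast, ← Real.rpow_natCast,
              ← Real.rpow_natCast, ← Real.rpow_mul (by norm_num), ← Real.rpow_mul (by norm_num),
              ← Real.rpow_mul (by norm_num), ← Real.rpow_add (by norm_num),
              ← Real.rpow_add (by norm_num)]
            congr 1
            push_cast
            ring
          calc _ = C * (ENNReal.ofReal ((2 ^ (-(p * m))) ^ j)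
                * ENNReal.ofReal ((2 ^ (j + 1) * R / R) ^ (n * r)))
                  * μ (Metric.closedBall x₀ R) := by ring
            _ = _ := by
                rw [← ENNReal.ofReal_mul (by positivity), e, ENNReal.ofReal_mul (by positivity)]
                ring
        · have : B j = ∅ := by
            ext x
            simp [hB, hj]
          rw [this]
          simp
    _ = C' * μ (Metric.closedBall x₀ R) := by
        rw [ENNReal.tsum_mul_left, ENNReal.tsum_geometric, hC']
        ring

theorem norm_iteratedFDeriv_reflectDilate_testClass_le {N : ℕ} {φ : Test n} (hφ : φ ∈ testClass n N) {t : ℝ}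
    (ht : 0 < t) (x : Rn n) {k : ℕ} (hk : k ≤ N + 1) (y : Rn n) :
    ‖iteratedFDeriv ℝ k (reflectDilate φ t ht x) y‖ ≤ (n : ℝ) ^ k * (t⁻¹) ^ (n + k) := by
  refine (norm_iteratedFDeriv_reflectDilate_le φ ht x
    (fun y => norm_iteratedFDeriv_le_of_mem_testClass hφ hk y) y).trans (le_of_eq ?_)
  rw [pow_add, inv_pow, inv_pow]
  ring

/-- If the integral does not vanish, the ball of radius t about x meets the support of `a`; since x
is at distance at least 2R, this forces t to be at least half that distance. The derivatives of
order S + 1 of the kernel, of size t^{-(n+S+1)}, then give the decay. -/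
theorem enorm_integral_le_decay {N S : ℕ} (hS : S ≤ N) {a : Rn n → ℂ} (ha : Integrable a)
    {x₀ : Rn n} {R : ℝ} (hR : 0 < R) (hs : Function.support a ⊆ Metric.closedBall x₀ R)
    (hm : ∀ α : Fin n → ℕ, ∑ i, α i ≤ S → ∫ x, a x * (∏ i, ((x i : ℝ) : ℂ) ^ α i) = 0)
    {φ : Test n} (hφ : φ ∈ testClass n N) {t : ℝ} (ht : 0 < t) {x : Rn n}
    (hx : 2 * R ≤ dist x x₀) :
    ‖∫ y, a y * (reflectDilate φ t ht x y : ℂ)‖ₑ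
      ≤ ENNReal.ofReal (n ^ (S + 1) * 2 ^ (n + S + 1) * R ^ (S + 1)
        / dist x x₀ ^ (n + S + 1)) * ∫⁻ y, ‖a y‖ₑ := by
  have hd : 0 < dist x x₀ := by linarith
  by_cases hz : ∀ y, a y * (reflectDilate φ t ht x y : ℂ) = 0
  · simp only [hz, integral_zero, enorm_zero]
    exact bot_le
  push Not at hz
  obtain ⟨y, hy⟩ := hz
  have hya : a y ≠ 0 := left_ne_zero_of_mul hy
  have hyφ : reflectDilate φ t ht x y ≠ 0 := by
    have := right_ne_zero_of_mul hy
    exact_mod_cast this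
  have h1 := Metric.mem_ball.1 (support_reflectDilate_subset hφ ht x hyφ)
  have h2 := Metric.mem_closedBall.1 (hs hya)
  have htd : dist x x₀ / 2 ≤ t := by
    have := dist_triangle x y x₀
    rw [dist_comm x y] at this
    linarith
  have hT := norm_integral_mul_le_of_moments ha hs hm (reflectDilate φ t ht x).contDiff
    (fun y => norm_iteratedFDeriv_reflectDilate_testClass_le hφ ht x (by omega : S + 1 ≤ N + 1) y)
  rw [← ofReal_norm, ← ofReal_integral_norm_eq_lintegral_enorm ha,
    ← ENNReal.ofReal_mul (by positivity)]
  refine ENNReal.ofReal_le_ofReal (hT.trans ?_)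
  refine mul_le_mul_of_nonneg_right ?_ (integral_nonneg fun _ => norm_nonneg _)
  have h3 : t⁻¹ ≤ 2 / dist x x₀ := by
    rw [← inv_div]
    exact inv_anti₀ (by positivity) htd
  calc (n : ℝ) ^ (S + 1) * t⁻¹ ^ (n + (S + 1)) * R ^ (S + 1)
      ≤ (n : ℝ) ^ (S + 1) * (2 / dist x x₀) ^ (n + (S + 1)) * R ^ (S + 1) := by gcongr
    _ = _ := by
      rw [div_pow, ← add_assoc]
      ring

/-- `H` dominates all the averages that enter the grand maximal function of `a`. -/
def IsMajorant (N : ℕ) (a : Rn n → ℂ) (H : Rn n → ℝ≥0∞) : Prop :=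
  Measurable H ∧ ∀ (x : Rn n) (t : ℝ) (ht : 0 < t), t < 1 → ∀ φ ∈ testClass n N,
    ‖∫ y, a y * (reflectDilate φ t ht x y : ℂ)‖ₑ ≤ H x

/-- The majorant is the local maximal function on the doubled ball, the decay bound on the annulus
out to distance L = 1 + √n, and zero beyond, since scales t < 1 do not reach further. The A_r
inequality on the ball estimates the L¹ norm of `a` that multiplies the decay. -/
theorem BallWeight.exists_majorant_of_moments {r : ℝ} {μ : Measure (Rn n)} (hμ : BallWeight r μ)
    (hn : 1 ≤ n) {p : ℝ} (hp : 0 < p) (hp1 : p ≤ 1) (hpr : p < r) {N S : ℕ} (hS : S ≤ N)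
    (hnr : n * r < p * (n + S + 1 : ℕ)) :
    ∃ C : ℝ≥0∞, C ≠ ∞ ∧ ∀ (a : Rn n → ℂ) (x₀ : Rn n) (l : ℝ), AEStronglyMeasurable a volume →
      0 < l → l ≤ 1 → Function.support a ⊆ cube x₀ l →
      ∫⁻ x, ‖a x‖ₑ ^ r ∂μ ≤ μ (cube x₀ l) ^ (1 - r / p) →
      (∀ α : Fin n → ℕ, ∑ i, α i ≤ S → ∫ x, a x * (∏ i, ((x i : ℝ) : ℂ) ^ α i) = 0) →
      ∃ H, IsMajorant N a H ∧ ∫⁻ x, H x ^ p ∂μ ≤ C := by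
  have hr : 0 < r := hp.trans hpr
  have hsq : 1 ≤ √(n : ℝ) := Real.one_le_sqrt.2 (by exact_mod_cast hn)
  set L : ℝ := 1 + √n with hL
  have hLpos : 0 < L := by positivity
  obtain ⟨K, hK, hdb⟩ := hμ.doubling_const hr hLpos (2 * √n)
  obtain ⟨C₁, hC₁, hnear⟩ := hμ.lintegral_localMaximal_le_const hp hpr hK
  obtain ⟨C₂, hC₂, hfar⟩ := hμ.lintegral_decay_le hr hp hnr hLpos
  obtain ⟨C₃, hC₃, hbd⟩ := hμ.bound L hLpos
  set A : ℝ≥0∞ := ENNReal.ofReal (n ^ (S + 1) * 2 ^ (n + S + 1)) * C₃ ^ (1 / r) with hA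
  have hAt : A ≠ ∞ := ENNReal.mul_ne_top ENNReal.ofReal_ne_top
    (ENNReal.rpow_ne_top_of_nonneg (by positivity) hC₃)
  refine ⟨C₁ + A ^ p * (C₂ * K), ENNReal.add_ne_top.2 ⟨hC₁, ENNReal.mul_ne_top
    (ENNReal.rpow_ne_top_of_nonneg hp.le hAt) (ENNReal.mul_ne_top hC₂ hK)⟩, ?_⟩
  intro a x₀ l ham hl hl1 hsupp hI hmom
  set Q := cube x₀ l with hQ
  set R : ℝ := √n * l / 2 with hR
  have hRpos : 0 < R := by positivity
  have hRL : 2 * R ≤ L := by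
    have : √(n : ℝ) * l ≤ √n * 1 := by gcongr
    linarith
  have hQB : Q ⊆ Metric.closedBall x₀ R := cube_subset_closedBall x₀ hl.le
  have hBQ : Metric.closedBall x₀ (l / 2) ⊆ Q := by
    have := closedBall_subset_cube (x := x₀) (t := l / 2)
    rwa [mul_div_cancel₀ _ (by norm_num : (2 : ℝ) ≠ 0)] at this
  have hQ0 : μ Q ≠ 0 := ((hμ.measure_closedBall_pos x₀ (by positivity : 0 < l / 2)).trans_le
    (measure_mono hBQ)).ne'
  have hQt : μ Q ≠ ∞ := ((measure_mono hQB).trans_lt (hμ.measure_closedBall_lt_top x₀ R)).ne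
  have hdb2 : μ (Metric.closedBall x₀ (2 * R)) ≤ K * μ Q := by
    refine (hdb x₀ x₀ (2 * R) (l / 2) (by positivity) hRL (by positivity) ?_ ?_).trans
      (mul_le_mul_right (measure_mono hBQ) _)
    · rw [hR]
      linarith
    · refine Metric.closedBall_subset_closedBall ?_
      rw [hR]
      nlinarith
  have hdb1 : μ (Metric.closedBall x₀ R) ≤ K * μ Q :=
    (measure_mono (Metric.closedBall_subset_closedBall (by linarith))).trans hdb2
  have hga : AEMeasurable (fun y => ‖a y‖ₑ) volume := ham.enorm
  have hsB := hsupp.trans hQB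
  -- the integral of `a`
  have hL1 : ∫⁻ y, ‖a y‖ₑ ≤ C₃ ^ (1 / r) * ENNReal.ofReal (R ^ n) * μ Q ^ (-(1 / p)) := by
    have e1 : ∫⁻ y in Metric.closedBall x₀ R, ‖a y‖ₑ = ∫⁻ y, ‖a y‖ₑ := by
      refine setLIntegral_eq_of_support_subset ?_
      intro y hy
      exact hsB (by simpa using hy)
    have h1 := hbd x₀ R hRpos (by linarith) _ hga
    rw [e1] at h1
    have h2 : (∫⁻ y, ‖a y‖ₑ) ^ r * μ Q
        ≤ C₃ * (ENNReal.ofReal R ^ n) ^ r * μ Q ^ (-(r / p)) * μ Q := by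
      calc (∫⁻ y, ‖a y‖ₑ) ^ r * μ Q ≤ (∫⁻ y, ‖a y‖ₑ) ^ r * μ (Metric.closedBall x₀ R) :=
            mul_le_mul_right (measure_mono hQB) _
        _ ≤ C₃ * (ENNReal.ofReal R ^ n) ^ r * ∫⁻ y, ‖a y‖ₑ ^ r ∂μ :=
            h1.trans (mul_le_mul_right (setLIntegral_le_lintegral _ _) _)
        _ ≤ C₃ * (ENNReal.ofReal R ^ n) ^ r * μ Q ^ (1 - r / p) := mul_le_mul_right hI _
        _ = _ := by
            rw [mul_assoc _ _ (μ Q)]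
            congr 1
            nth_rw 3 [← ENNReal.rpow_one (μ Q)]
            rw [← ENNReal.rpow_add _ _ hQ0 hQt]
            congr 1
            ring
    have h3 := (ENNReal.mul_le_mul_iff_left hQ0 hQt).1 h2
    have h4 := ENNReal.rpow_le_rpow h3 (by positivity : 0 ≤ 1 / r)
    rw [← ENNReal.rpow_mul, mul_one_div_cancel hr.ne', ENNReal.rpow_one] at h4
    refine h4.trans (le_of_eq ?_)
    rw [ENNReal.mul_rpow_of_nonneg _ _ (by positivity), ENNReal.mul_rpow_of_nonneg _ _ (by positivity),
      ← ENNReal.rpow_mul, ← ENNReal.rpow_mul, mul_one_div_cancel hr.ne', ENNReal.rpow_one,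
      ENNReal.ofReal_pow hRpos.le]
    congr 2
    field_simp
  have hint : Integrable a := by
    refine ⟨ham, lt_of_le_of_lt hL1 ?_⟩
    refine ENNReal.mul_lt_top (ENNReal.mul_lt_top
      (ENNReal.rpow_lt_top_of_nonneg (by positivity) hC₃) ENNReal.ofReal_lt_top) ?_
    rw [ENNReal.rpow_neg]
    refine ENNReal.inv_lt_top.2 ?_
    exact ENNReal.rpow_pos (pos_iff_ne_zero.2 hQ0) hQt
  set E₁ := Metric.closedBall x₀ (2 * R) with hE₁
  set E₂ := {x : Rn n | R ≤ dist x x₀ ∧ dist x x₀ ≤ L} with hE₂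
  have hE₁m : MeasurableSet E₁ := Metric.isClosed_closedBall.measurableSet
  have hE₂m : MeasurableSet E₂ := measurableSet_annulus x₀ R L
  set G := localMaximal fun y => ‖a y‖ₑ with hG
  set Hf : Rn n → ℝ≥0∞ := fun x =>
    A * μ Q ^ (-(1 / p)) * ENNReal.ofReal ((R / dist x x₀) ^ (n + S + 1)) with hHf
  have hGm : Measurable G := measurable_localMaximal _
  have hHfm : Measurable Hf := by fun_prop
  refine ⟨fun x => E₁.indicator G x + E₂.indicator Hf x,
    ⟨(hGm.indicator hE₁m).add (hHfm.indicator hE₂m), ?_⟩, ?_⟩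
  · intro x t ht ht1 φ hφ
    change _ ≤ E₁.indicator G x + E₂.indicator Hf x
    by_cases hx : x ∈ E₁
    · refine le_trans (enorm_integral_mul_reflectDilate_le hφ ht ht1 a x) ?_
      rw [indicator_of_mem hx]
      exact le_self_add
    have hxd : 2 * R < dist x x₀ := by simpa [hE₁] using hx
    by_cases hx2 : x ∈ E₂
    · refine le_trans ?_ le_add_self
      rw [indicator_of_mem hx2]
      refine (enorm_integral_le_decay hS hint hRpos hsB hmom hφ ht hxd.le).trans ?_
      refine (mul_le_mul_right hL1 _).trans (le_of_eq ?_)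
      have hdp : 0 < dist x x₀ := by linarith
      have e : n ^ (S + 1) * 2 ^ (n + S + 1) * R ^ (S + 1) / dist x x₀ ^ (n + S + 1) * R ^ n
          = n ^ (S + 1) * 2 ^ (n + S + 1) * (R / dist x x₀) ^ (n + S + 1) := by
        rw [div_pow R, add_assoc n S 1, pow_add R n]
        ring
      rw [hHf, hA]
      simp only
      calc _ = ENNReal.ofReal (n ^ (S + 1) * 2 ^ (n + S + 1) * R ^ (S + 1)
              / dist x x₀ ^ (n + S + 1)) * ENNReal.ofReal (R ^ n)
              * (C₃ ^ (1 / r) * μ Q ^ (-(1 / p))) := by ring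
        _ = _ := by
            rw [← ENNReal.ofReal_mul (by positivity), e, ENNReal.ofReal_mul (by positivity)]
            ring
    · refine le_trans (enorm_integral_mul_reflectDilate_le hφ ht ht1 a x) ?_
      rw [localMaximal_eq_zero (Q := Metric.closedBall x₀ R)]
      · exact bot_le
      · exact fun y hy => hsB (by simpa using hy)
      · intro hth
        obtain ⟨y, hy, hxy⟩ := Metric.mem_thickening_iff.1 hth
        rw [Metric.mem_closedBall] at hy
        refine hx2 ⟨by linarith, ?_⟩
        have := dist_triangle x y x₀
        have h2 : R ≤ √n := by
          rw [hR]
          nlinarith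
        rw [hL]
        linarith
  · calc ∫⁻ x, (E₁.indicator G x + E₂.indicator Hf x) ^ p ∂μ
        ≤ ∫⁻ x, (E₁.indicator (fun x => G x ^ p) x + E₂.indicator (fun x => Hf x ^ p) x) ∂μ := by
          refine lintegral_mono fun x => ?_
          refine (ENNReal.rpow_add_le_add_rpow _ _ hp.le hp1).trans (le_of_eq ?_)
          congr 1
          · by_cases hx : x ∈ E₁
            · simp [indicator_of_mem hx]
            · simp [indicator_of_notMem hx, hp]
          · by_cases hx : x ∈ E₂
            · simp [indicator_of_mem hx]
            · simp [indicator_of_notMem hx, hp]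
      _ = ∫⁻ x in E₁, G x ^ p ∂μ + ∫⁻ x in E₂, Hf x ^ p ∂μ := by
          rw [lintegral_add_left ((hGm.pow_const p).indicator hE₁m), lintegral_indicator hE₁m,
            lintegral_indicator hE₂m]
      _ ≤ C₁ + A ^ p * (C₂ * K) := by
          refine add_le_add (hnear _ hga E₁ Q hQ0 hQt hdb2 hI) ?_
          have e : ∀ x, Hf x ^ p = A ^ p * (μ Q)⁻¹
              * ENNReal.ofReal ((R / dist x x₀) ^ (n + S + 1)) ^ p := by
            intro x
            rw [hHf]
            simp only
            rw [ENNReal.mul_rpow_of_nonneg _ _ hp.le, ENNReal.mul_rpow_of_nonneg _ _ hp.le,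
              ← ENNReal.rpow_mul, neg_mul, one_div_mul_cancel hp.ne', ENNReal.rpow_neg_one]
          simp_rw [e]
          rw [lintegral_const_mul _ (by fun_prop)]
          calc A ^ p * (μ Q)⁻¹ * _ ≤ A ^ p * (μ Q)⁻¹ * (C₂ * (K * μ Q)) := by
                refine mul_le_mul_right ((hfar x₀ R hRpos).trans ?_) _
                exact mul_le_mul_right hdb1 _
            _ = A ^ p * (C₂ * K) * ((μ Q)⁻¹ * μ Q) := by ring
            _ = _ := by rw [ENNReal.inv_mul_cancel hQ0 hQt, mul_one]

end SmallAtoms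

/-! ### Choice of the exponent r, and the maximal function of a sum of atoms. -/

section MaximalOfAtoms

variable {n : ℕ}

theorem IsLocalAInfty.one_le_criticalIndex {w : Rn n → ℝ} (hw : IsLocalAInfty w) :
    1 ≤ criticalIndex w :=
  le_csInf hw fun _ h => h.1

/-- The number of moments enters here. With S the nonnegative part of the integer part, n(q_w/p - 1)
< S + 1, that is n q_w < p(n + S + 1). This inequality and q_w < q are both strict, so an r slightly
above q_w satisfies both conditions. -/
theorem exists_exponent {w : Rn n → ℝ} (hn : 1 ≤ n) {q : ℝ≥0∞}
    (hq : ENNReal.ofReal (criticalIndex w) < q) {p : ℝ} (hp : 0 < p)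
    (h0 : 0 ≤ criticalIndex w) : ∃ r, criticalIndex w < r ∧ ENNReal.ofReal r ≤ q ∧
      n * r < p * (n + (max 0 (momentOrder p w)).toNat + 1 : ℕ) := by
  have hn' : (0 : ℝ) < n := by exact_mod_cast hn
  obtain ⟨q', hq0, hq1, hq2⟩ := ENNReal.lt_iff_exists_real_btwn.1 hq
  have h1 : criticalIndex w < q' := by
    rwa [ENNReal.ofReal_lt_ofReal_iff_of_nonneg h0] at hq1
  have h2 : criticalIndex w < p * (n + (max 0 (momentOrder p w)).toNat + 1 : ℕ) / n := by
    have h3 : (n : ℝ) * (criticalIndex w / p - 1) < momentOrder p w + 1 := Int.lt_floor_add_one _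
    have h4 : (momentOrder p w : ℝ) ≤ ((max 0 (momentOrder p w)).toNat : ℕ) := by
      have : momentOrder p w ≤ (((max 0 (momentOrder p w)).toNat : ℕ) : ℤ) := by
        rw [Int.toNat_of_nonneg (le_max_left _ _)]
        exact le_max_right _ _
      exact_mod_cast this
    rw [lt_div_iff₀ hn']
    push_cast at h4 ⊢
    have h5 : (n : ℝ) * (criticalIndex w / p - 1) < ((max 0 (momentOrder p w)).toNat : ℝ) + 1 := by
      linarith
    have h6 : p * (n * (criticalIndex w / p - 1))
        < p * (((max 0 (momentOrder p w)).toNat : ℝ) + 1) := mul_lt_mul_of_pos_left h5 hp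
    have h7 : p * (n * (criticalIndex w / p - 1)) = criticalIndex w * n - p * n := by
      field_simp
    linarith
  obtain ⟨r, hr1, hr2⟩ := exists_between (lt_min h1 h2)
  refine ⟨r, hr1, ?_, ?_⟩
  · exact (ENNReal.ofReal_le_ofReal (hr2.le.trans (min_le_left _ _))).trans hq2.le
  · have := hr2.trans_le (min_le_right _ _)
    rw [lt_div_iff₀ hn'] at this
    linarith

/-- Atoms on cubes of side less than one use their moments. For larger cubes the local maximal
function lives in a unit neighbourhood of comparable measure. A single atom is treated like an atom
whose cube is the whole space when that has finite measure. -/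
theorem exists_atom_majorant (hn : 1 ≤ n) {w : Rn n → ℝ} (hw : IsLocalAInfty w) {q : ℝ≥0∞}
    (hq : ENNReal.ofReal (criticalIndex w) < q) {p : ℝ} (hp : 0 < p) (hp1 : p ≤ 1) {s : ℕ}
    (hs : momentOrder p w ≤ (s : ℤ)) :
    ∃ C : ℝ≥0∞, C ≠ ∞ ∧ ∀ a : Rn n → ℂ, IsAtom p q s w a ∨ IsSingleAtom p q w a →
      ∃ H, IsMajorant (hardyOrder p w) a H ∧ ∫⁻ x, H x ^ p ∂(wMeasure w) ≤ C := by
  have hcrit := hw.one_le_criticalIndex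
  obtain ⟨r, hr, hrq, hnr⟩ := exists_exponent hn hq hp (by linarith)
  have hr0 : 0 < r := by linarith
  have hpr : p < r := by linarith
  have hμ := exists_ballWeight hw hr0 hr
  set μ := wMeasure w with hμdef
  set S := (max 0 (momentOrder p w)).toNat with hS
  have hSs : S ≤ s := by
    rw [hS, Int.toNat_le]
    exact max_le (by positivity) hs
  obtain ⟨K, hK, hthick⟩ := hμ.measure_thickening_le hr0
  obtain ⟨C₁, hC₁, hsmall⟩ := hμ.exists_majorant_of_moments hn hp hp1 hpr
    (by simp [hardyOrder, hS] : S ≤ hardyOrder p w) hnr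
  obtain ⟨C₂, hC₂, hlarge⟩ := hμ.lintegral_localMaximal_le_const hp hpr hK
  obtain ⟨C₃, hC₃, hsing⟩ := hμ.lintegral_localMaximal_le_const hp hpr ENNReal.one_ne_top
  refine ⟨C₁ + C₂ + C₃, by simp [hC₁, hC₂, hC₃], fun a ha => ?_⟩
  rcases ha with ⟨ham, Q, ⟨x₀, l, hl, rfl⟩, hsupp, hnorm, hmom⟩ | ⟨ham, hnorm⟩
  · have hBQ : Metric.closedBall x₀ (l / 2) ⊆ cube x₀ l := by
      have := closedBall_subset_cube (x := x₀) (t := l / 2)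
      rwa [mul_div_cancel₀ _ (by norm_num : (2 : ℝ) ≠ 0)] at this
    have hQ0 : μ (cube x₀ l) ≠ 0 :=
      ((hμ.measure_closedBall_pos x₀ (by positivity : 0 < l / 2)).trans_le (measure_mono hBQ)).ne'
    have hQt : μ (cube x₀ l) ≠ ∞ := (hμ.lt_top _ (isBounded_cube x₀ l)).ne
    have hI := lintegral_rpow_le_of_eLpNorm_le (ham.mono_ac hμ.ac) hsupp hQ0 hQt hr0 hrq hnorm
    rcases lt_or_ge l 1 with hl1 | hl1
    · have hvol : volume (cube x₀ l) < 1 := by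
        rw [volume_cube]
        refine pow_lt_one₀ bot_le ?_ (by omega)
        rw [← ENNReal.ofReal_one]
        exact (ENNReal.ofReal_lt_ofReal_iff one_pos).2 hl1
      obtain ⟨H, hH, hHI⟩ := hsmall a x₀ l ham hl hl1.le hsupp hI
        fun α hα => hmom hvol α (hα.trans hSs)
      exact ⟨H, hH, hHI.trans (by rw [add_assoc]; exact le_self_add)⟩
    · refine ⟨localMaximal fun y => ‖a y‖ₑ, ⟨measurable_localMaximal _, fun x t ht ht1 φ hφ =>
        enorm_integral_mul_reflectDilate_le hφ ht ht1 a x⟩, ?_⟩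
      have h1 := hlarge _ ham.enorm (Metric.thickening 1 (cube x₀ l)) (cube x₀ l) hQ0 hQt
        (hthick x₀ l hl1) hI
      rw [setLIntegral_eq_of_support_subset] at h1
      · exact h1.trans (le_trans le_add_self le_self_add)
      · intro x hx
        by_contra hx'
        refine hx ?_
        change localMaximal _ x ^ p = 0
        rw [localMaximal_eq_zero (fun y hy => hsupp (by simpa using hy)) hx',
          ENNReal.zero_rpow_of_pos hp]
  · by_cases hfin : μ univ = ∞
    -- When the total mass is infinite, the negative exponent turns the normalisation into zero, so
    -- the single atom vanishes almost everywhere and zero is a majorant.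
    · have hexp : (q⁻¹).toReal - 1 / p < 0 := by
        have h1 : (1 : ℝ≥0∞) < q := by
          refine lt_of_le_of_lt ?_ hq
          rw [← ENNReal.ofReal_one]
          exact ENNReal.ofReal_le_ofReal hcrit
        have h2 : (q⁻¹).toReal < 1 := by
          rw [← ENNReal.toReal_one]
          exact (ENNReal.toReal_lt_toReal (ENNReal.inv_ne_top.2 (one_pos.trans h1).ne')
            ENNReal.one_ne_top).2 (ENNReal.inv_lt_one.2 h1)
        have h3 : 1 ≤ 1 / p := (one_le_div hp).2 hp1
        linarith
      rw [hfin, ENNReal.top_rpow_of_neg hexp, nonpos_iff_eq_zero,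
        eLpNorm_eq_zero_iff (ham.mono_ac hμ.ac) (ne_bot_of_gt hq)] at hnorm
      have h0 : a =ᵐ[volume] 0 := hμ.ac' hnorm
      refine ⟨0, ⟨measurable_const, fun x t ht ht1 φ hφ => ?_⟩, ?_⟩
      · have : ∫ y, a y * (reflectDilate φ t ht x y : ℂ) = 0 := by
          refine (integral_congr_ae ?_).trans (integral_zero _ _)
          filter_upwards [h0] with y hy
          rw [hy, Pi.zero_apply, zero_mul]
        rw [this]
        simp
      · simp [hp]
    · have hU0 : μ univ ≠ 0 := ((hμ.measure_closedBall_pos 0 one_pos).trans_le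
        (measure_mono (subset_univ _))).ne'
      have hI := lintegral_rpow_le_of_eLpNorm_le (ham.mono_ac hμ.ac) (subset_univ _) hU0 hfin hr0
        hrq hnorm
      refine ⟨localMaximal fun y => ‖a y‖ₑ, ⟨measurable_localMaximal _, fun x t ht ht1 φ hφ =>
        enorm_integral_mul_reflectDilate_le hφ ht ht1 a x⟩, ?_⟩
      have h1 := hsing _ ham.enorm univ univ hU0 hfin (by rw [one_mul]) hI
      rw [setLIntegral_univ] at h1
      exact h1.trans le_add_self

/-- The grand maximal function of a sum of atoms is controlled by the coefficients. -/
theorem exists_hardyNorm_le_of_isAtomicDecomposition (hn : 1 ≤ n) {w : Rn n → ℝ}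
    (hw : IsLocalAInfty w) {q : ℝ≥0∞} (hq : ENNReal.ofReal (criticalIndex w) < q) {p : ℝ}
    (hp : 0 < p) (hp1 : p ≤ 1) {s : ℕ} (hs : momentOrder p w ≤ (s : ℤ)) :
    ∃ C : ℝ≥0∞, C ≠ ∞ ∧ ∀ (f : Dist n) (c : ℕ → ℂ) (a : ℕ → Rn n → ℂ),
      IsAtomicDecomposition p q s w f c a →
      hardyNorm p w (hardyOrder p w) f ≤ C * ENNReal.ofReal ((∑' i, ‖c i‖ ^ p) ^ (1 / p)) := by
  obtain ⟨C, hC, hmaj⟩ := exists_atom_majorant hn hw hq hp hp1 hs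
  refine ⟨C ^ (1 / p), ENNReal.rpow_ne_top_of_nonneg (by positivity) hC, fun f c a h => ?_⟩
  have hex : ∀ i, ∃ H, IsMajorant (hardyOrder p w) (a i) H ∧
      ∫⁻ x, H x ^ p ∂(wMeasure w) ≤ C := by
    intro i
    rcases Nat.eq_zero_or_pos i with rfl | hi
    · exact hmaj _ (Or.inr h.single)
    · exact hmaj _ (Or.inl (h.atom i hi))
  choose H hH hHI using hex
  have hpt : ∀ x, grandMaximal (hardyOrder p w) f x ≤ ∑' i, ‖c i‖ₑ * H i x := by
    intro x
    refine iSup_le fun t => iSup_le fun ht => iSup_le fun ht1 => iSup_le fun φ => iSup_le fun hφ => ?_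
    have hlim := (continuous_enorm.tendsto _).comp (h.tendsto (reflectDilate φ t ht x))
    refine le_of_tendsto hlim (Eventually.of_forall fun m => ?_)
    refine (enorm_sum_le _ _).trans (le_trans ?_ (ENNReal.sum_le_tsum (Finset.range m)))
    refine Finset.sum_le_sum fun i _ => ?_
    rw [enorm_mul]
    exact mul_le_mul_right ((hH i).2 x t ht ht1 φ hφ) _
  have hint : ∫⁻ x, grandMaximal (hardyOrder p w) f x ^ p ∂(wMeasure w)
      ≤ C * ENNReal.ofReal (∑' i, ‖c i‖ ^ p) := by
    calc ∫⁻ x, grandMaximal (hardyOrder p w) f x ^ p ∂(wMeasure w)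
        ≤ ∫⁻ x, ∑' i, ‖c i‖ₑ ^ p * H i x ^ p ∂(wMeasure w) := by
          refine lintegral_mono fun x => ?_
          refine (ENNReal.rpow_le_rpow (hpt x) hp.le).trans ?_
          refine (rpow_tsum_le_tsum_rpow _ hp hp1).trans (le_of_eq ?_)
          exact tsum_congr fun i => ENNReal.mul_rpow_of_nonneg _ _ hp.le
      _ = ∑' i, ‖c i‖ₑ ^ p * ∫⁻ x, H i x ^ p ∂(wMeasure w) := by
          rw [lintegral_tsum fun i => (((hH i).1.pow_const p).const_mul _).aemeasurable]
          exact tsum_congr fun i => lintegral_const_mul _ ((hH i).1.pow_const p)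
      _ ≤ ∑' i, C * ‖c i‖ₑ ^ p := by
          refine ENNReal.tsum_le_tsum fun i => ?_
          rw [mul_comm C]
          exact mul_le_mul_right (hHI i) _
      _ = _ := by
          rw [ENNReal.tsum_mul_left, ENNReal.ofReal_tsum_of_nonneg (fun i => by positivity)
            h.summable]
          congr 1
          refine tsum_congr fun i => ?_
          rw [← ofReal_norm, ENNReal.ofReal_rpow_of_nonneg (norm_nonneg _) hp.le]
  have hnn : 0 ≤ ∑' i, ‖c i‖ ^ p := tsum_nonneg fun i => by positivity
  rw [← ENNReal.ofReal_rpow_of_nonneg hnn (by positivity), ← ENNReal.mul_rpow_of_nonneg _ _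
    (by positivity)]
  exact ENNReal.rpow_le_rpow hint (by positivity)

end MaximalOfAtoms

/-! ### Whitney families of balls of bounded size. -/

section WhitneyCovers

variable {n : ℕ}

/-- The distance to the complement of `Ω`, truncated at `1/8`. -/
def depth (Ω : Set (Rn n)) (x : Rn n) : ℝ :=
  (min (ENNReal.ofReal (1 / 8)) (Metric.infEDist x Ωᶜ)).toReal

theorem depth_aux_ne_top (Ω : Set (Rn n)) (x : Rn n) :
    min (ENNReal.ofReal (1 / 8)) (Metric.infEDist x Ωᶜ) ≠ ∞ :=
  ne_top_of_le_ne_top ENNReal.ofReal_ne_top (min_le_left _ _)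

theorem depth_nonneg (Ω : Set (Rn n)) (x : Rn n) : 0 ≤ depth Ω x := ENNReal.toReal_nonneg

theorem depth_le (Ω : Set (Rn n)) (x : Rn n) : depth Ω x ≤ 1 / 8 := by
  refine ENNReal.toReal_le_of_le_ofReal (by norm_num) (min_le_left _ _)

theorem depth_pos {Ω : Set (Rn n)} (hΩ : IsOpen Ω) {x : Rn n} (hx : x ∈ Ω) : 0 < depth Ω x := by
  refine ENNReal.toReal_pos ?_ (depth_aux_ne_top Ω x)
  refine (lt_min (by simp) ?_).ne'
  rw [pos_iff_ne_zero, Ne, ← Metric.mem_iff_infEDist_zero_of_closed hΩ.isClosed_compl]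
  simpa using hx

theorem depth_le_add_dist (Ω : Set (Rn n)) (x y : Rn n) : depth Ω x ≤ depth Ω y + dist x y := by
  have h : min (ENNReal.ofReal (1 / 8)) (Metric.infEDist x Ωᶜ)
      ≤ min (ENNReal.ofReal (1 / 8)) (Metric.infEDist y Ωᶜ) + edist x y := by
    rw [min_add]
    exact min_le_min le_self_add Metric.infEDist_le_infEDist_add_edist
  have h2 := ENNReal.toReal_mono (ENNReal.add_ne_top.2 ⟨depth_aux_ne_top Ω y, edist_ne_top x y⟩) h
  rwa [ENNReal.toReal_add (depth_aux_ne_top Ω y) (edist_ne_top x y), ← dist_edist] at h2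

theorem depth_mono {Ω Ω' : Set (Rn n)} (h : Ω ⊆ Ω') (x : Rn n) : depth Ω x ≤ depth Ω' x :=
  ENNReal.toReal_mono (depth_aux_ne_top Ω' x)
    (min_le_min le_rfl (Metric.infEDist_anti (compl_subset_compl.2 h)))

theorem mem_of_dist_lt_depth {Ω : Set (Rn n)} {x y : Rn n} (h : dist x y < depth Ω x) : y ∈ Ω := by
  by_contra hy
  have h1 : depth Ω y = 0 := by
    rw [depth, Metric.infEDist_zero_of_mem (show y ∈ Ωᶜ from hy)]
    simp
  have := depth_le_add_dist Ω x y
  linarith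

/-- When the truncation is inactive, the depth is a genuine distance to the complement and is
attained. The point found lies off Ω, where the maximal function is small; this is how estimates on
Ω are reduced to that bound. -/
theorem exists_dist_eq_depth {Ω : Set (Rn n)} (hΩ : IsOpen Ω) {x : Rn n} (hx : depth Ω x < 1 / 8) :
    ∃ z ∉ Ω, dist x z = depth Ω x := by
  have h1 : Metric.infEDist x Ωᶜ < ENNReal.ofReal (1 / 8) := by
    by_contra h
    push Not at h
    rw [depth, min_eq_left h, ENNReal.toReal_ofReal (by norm_num)] at hx
    exact lt_irrefl _ hx
  have hne : Ωᶜ.Nonempty := by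
    rw [nonempty_iff_ne_empty]
    intro h
    rw [h, Metric.infEDist_empty] at h1
    exact absurd h1 (by simp)
  obtain ⟨z, hz, hd⟩ := hΩ.isClosed_compl.exists_infDist_eq_dist hne x
  refine ⟨z, hz, ?_⟩
  rw [← hd, depth, min_eq_right h1.le, Metric.infDist]

/-- A Whitney-type family of balls for `Ω`: the ball of centre `x i` has radius
`rad i = depth Ω (x i) / 32`. -/
structure Whitney (Ω : Set (Rn n)) where
  A : Set ℕ
  x : A → Rn n
  mem : ∀ i, x i ∈ Ω
  disj : Pairwise fun i j => Disjoint (Metric.closedBall (x i) (depth Ω (x i) / 320))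
    (Metric.closedBall (x j) (depth Ω (x j) / 320))
  cover : ∀ y ∈ Ω, ∃ i, dist y (x i) ≤ depth Ω (x i) / 64

/-- Vitali with radii depth/320: the enlarged balls have radius depth/64, half the radius of the
Whitney ball, so each point of Ω lies where some bump equals 1. Indexing by a set of natural numbers
orders the balls with finitely many predecessors each. -/
theorem exists_whitney {Ω : Set (Rn n)} (hΩ : IsOpen Ω) : Nonempty (Whitney Ω) := by
  obtain ⟨u, huE, hdisj, hcov⟩ := Vitali.exists_disjoint_subfamily_covering_enlargement_closedBall
    Ω (fun x : Rn n => x) (fun x => depth Ω x / 320) 1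
    (fun x hx => by linarith [depth_le Ω x]) 5 (by norm_num)
  have hucount : u.Countable := by
    refine hdisj.countable_of_nonempty_interior fun x hx => ?_
    refine ⟨x, ?_⟩
    rw [mem_interior_iff_mem_nhds]
    exact Metric.closedBall_mem_nhds x (by linarith [depth_pos hΩ (huE hx)])
  have : Countable u := hucount.to_subtype
  obtain ⟨e, he⟩ := exists_injective_nat u
  let E := Equiv.ofInjective e he
  refine ⟨⟨range e, fun i => (E.symm i : Rn n), fun i => huE (E.symm i).2, ?_, ?_⟩⟩
  · intro i j hij
    exact hdisj (E.symm i).2 (E.symm j).2 fun h => hij (E.symm.injective (Subtype.ext h))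
  · intro y hy
    obtain ⟨b, hb, hyb⟩ := hcov y hy
    refine ⟨E ⟨b, hb⟩, ?_⟩
    rw [Equiv.symm_apply_apply]
    have := Metric.mem_closedBall.1
      (hyb (Metric.mem_closedBall_self (by linarith [depth_pos hΩ hy])))
    linarith

namespace Whitney

variable {Ω : Set (Rn n)} (W : Whitney Ω)

/-- The radius of the ball with index `i`. -/
def rad (i : W.A) : ℝ := depth Ω (W.x i) / 32

theorem rad_pos (hΩ : IsOpen Ω) (i : W.A) : 0 < W.rad i := by
  have := depth_pos hΩ (W.mem i)
  unfold rad
  linarith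

theorem rad_le (i : W.A) : W.rad i ≤ 1 / 256 := by
  have := depth_le Ω (W.x i)
  unfold rad
  linarith

theorem closedBall_subset (hΩ : IsOpen Ω) (i : W.A) :
    Metric.closedBall (W.x i) (10 * W.rad i) ⊆ Ω := by
  intro y hy
  have h := W.rad_pos hΩ i
  refine mem_of_dist_lt_depth (x := W.x i) ?_
  rw [Metric.mem_closedBall, dist_comm] at hy
  unfold rad at h hy
  linarith

/-- The overlap constant. -/
def overlapConst (n : ℕ) : ℕ := 420 ^ n

/-- Volume packing. The depth is 1-Lipschitz, so at all centres in question it is within a factor 2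
of the depth d at y. The disjoint balls of radius d/640 about these centres fit into the ball about
y that is 420 times as large. -/
theorem card_le (hΩ : IsOpen Ω) {y : Rn n} (s : Finset W.A)
    (hs : ∀ i ∈ s, dist y (W.x i) ≤ 10 * W.rad i) : s.card ≤ overlapConst n := by
  rcases s.eq_empty_or_nonempty with rfl | ⟨i₀, hi₀⟩
  · simp
  have hcomp : ∀ i ∈ s, depth Ω (W.x i) ≤ 2 * depth Ω y ∧ depth Ω y ≤ 2 * depth Ω (W.x i) := by
    intro i hi
    have h1 := hs i hi
    have h2 := depth_le_add_dist Ω y (W.x i)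
    have h3 := depth_le_add_dist Ω (W.x i) y
    have h4 := depth_nonneg Ω (W.x i)
    rw [dist_comm] at h3
    unfold rad at h1
    constructor <;> linarith
  have hd : 0 < depth Ω y := by
    have := hcomp i₀ hi₀
    have := depth_pos hΩ (W.mem i₀)
    linarith
  set d := depth Ω y with hdef
  have hdisj : (s : Set W.A).PairwiseDisjoint fun i => Metric.closedBall (W.x i) (d / 640) := by
    intro i hi j hj hij
    have hi' := (hcomp i hi).2
    have hj' := (hcomp j hj).2
    exact (W.disj hij).mono (Metric.closedBall_subset_closedBall (by linarith))
      (Metric.closedBall_subset_closedBall (by linarith))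
  have hsub : ∀ i ∈ s, Metric.closedBall (W.x i) (d / 640) ⊆ Metric.closedBall y (420 * (d / 640)) := by
    intro i hi
    refine Metric.closedBall_subset_closedBall' ?_
    have h1 := hs i hi
    have h2 := (hcomp i hi).1
    rw [dist_comm] at h1
    unfold rad at h1
    linarith
  have hvol : (s.card : ℝ≥0∞) * volume (Metric.closedBall y (d / 640))
      ≤ volume (Metric.closedBall y (420 * (d / 640))) := by
    calc (s.card : ℝ≥0∞) * volume (Metric.closedBall y (d / 640))
        = ∑ i ∈ s, volume (Metric.closedBall (W.x i) (d / 640)) := by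
          rw [Finset.sum_congr rfl fun i _ => Measure.addHaar_closedBall_center volume (W.x i) _,
            Finset.sum_const, nsmul_eq_mul, Measure.addHaar_closedBall_center volume y]
      _ = volume (⋃ i ∈ s, Metric.closedBall (W.x i) (d / 640)) :=
          (measure_biUnion_finset hdisj fun i _ => Metric.isClosed_closedBall.measurableSet).symm
      _ ≤ _ := measure_mono (iUnion₂_subset hsub)
  have e : volume (Metric.closedBall y (420 * (d / 640)))
      = (overlapConst n : ℝ≥0∞) * volume (Metric.closedBall y (d / 640)) := by
    rw [Measure.addHaar_closedBall_mul _ _ (by norm_num) (by positivity),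
      finrank_euclideanSpace, Fintype.card_fin, Measure.addHaar_closedBall_center volume y,
      overlapConst, ENNReal.ofReal_pow (by norm_num), ENNReal.ofReal_ofNat]
    push_cast
    rfl
  rw [e] at hvol
  have h0 : volume (Metric.closedBall y (d / 640)) ≠ 0 :=
    (Metric.measure_closedBall_pos volume y (by positivity)).ne'
  have ht : volume (Metric.closedBall y (d / 640)) ≠ ∞ := measure_closedBall_lt_top.ne
  exact_mod_cast (ENNReal.mul_le_mul_iff_left h0 ht).1 hvol

theorem finite_near (hΩ : IsOpen Ω) (y : Rn n) :
    {i : W.A | dist y (W.x i) ≤ 10 * W.rad i}.Finite := by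
  by_contra h
  obtain ⟨s, hs, hc⟩ := Set.Infinite.exists_subset_card_eq h (overlapConst n + 1)
  have := W.card_le hΩ s fun i hi => hs hi
  omega

/-- The total measure of the balls is controlled by the measure of `Ω`. -/
theorem tsum_measure_le (hΩ : IsOpen Ω) (μ : Measure (Rn n)) :
    ∑' i, μ (Metric.closedBall (W.x i) (W.rad i / 10)) ≤ μ Ω := by
  rw [← measure_iUnion]
  · refine measure_mono (iUnion_subset fun i => ?_)
    have := W.rad_pos hΩ i
    exact (Metric.closedBall_subset_closedBall (by linarith)).trans (W.closedBall_subset hΩ i)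
  · intro i j hij
    have := W.disj hij
    simpa only [rad, div_div, Function.onFun, show (32 : ℝ) * 10 = 320 by norm_num] using this
  · exact fun i => Metric.isClosed_closedBall.measurableSet

end Whitney

end WhitneyCovers

/-! ### Scale-invariant derivative bounds and the smooth partition of unity. -/

section Cutoffs

variable {n : ℕ}

/-- The derivatives of `g` at `x` up to order `m` are bounded at scale `ρ`. -/
def DerivBoundAt (m : ℕ) (ρ A : ℝ) (g : Rn n → ℝ) (x : Rn n) : Prop :=
  ∀ k ≤ m, ρ ^ k * ‖iteratedFDeriv ℝ k g x‖ ≤ A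

namespace DerivBoundAt

variable {m : ℕ} {ρ A B : ℝ} {f g : Rn n → ℝ} {x : Rn n}

theorem nonneg (h : DerivBoundAt m ρ A g x) : 0 ≤ A := by
  have := h 0 (Nat.zero_le _)
  rw [pow_zero, one_mul] at this
  exact (norm_nonneg _).trans this

theorem mono (h : DerivBoundAt m ρ A g x) (hAB : A ≤ B) : DerivBoundAt m ρ B g x :=
  fun k hk => (h k hk).trans hAB

theorem congr (h : DerivBoundAt m ρ A f x) (hfg : f =ᶠ[𝓝 x] g) : DerivBoundAt m ρ A g x := by
  intro k hk
  rw [← (hfg.iteratedFDeriv ℝ k).eq_of_nhds]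
  exact h k hk

theorem rescale (h : DerivBoundAt m ρ A g x) {σ c : ℝ} (hσ : 0 ≤ σ) (hρ : 0 ≤ ρ) (hc : 1 ≤ c)
    (hσρ : σ ≤ c * ρ) : DerivBoundAt m σ (c ^ m * A) g x := by
  intro k hk
  calc σ ^ k * ‖iteratedFDeriv ℝ k g x‖ ≤ (c * ρ) ^ k * ‖iteratedFDeriv ℝ k g x‖ := by gcongr
    _ = c ^ k * (ρ ^ k * ‖iteratedFDeriv ℝ k g x‖) := by rw [mul_pow]; ring
    _ ≤ c ^ m * A := mul_le_mul (pow_le_pow_right₀ hc hk) (h k hk) (by positivity) (by positivity)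

theorem mul (hf : ContDiff ℝ (⊤ : ℕ∞) f) (hg : ContDiff ℝ (⊤ : ℕ∞) g) (hρ : 0 ≤ ρ)
    (h1 : DerivBoundAt m ρ A f x) (h2 : DerivBoundAt m ρ B g x) :
    DerivBoundAt m ρ (2 ^ m * A * B) (fun y => f y * g y) x := by
  intro k hk
  have hA := h1.nonneg
  have hB := h2.nonneg
  calc ρ ^ k * ‖iteratedFDeriv ℝ k (fun y => f y * g y) x‖
      ≤ ρ ^ k * ∑ i ∈ Finset.range (k + 1), (k.choose i : ℝ) * ‖iteratedFDeriv ℝ i f x‖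
        * ‖iteratedFDeriv ℝ (k - i) g x‖ := by
        gcongr
        exact norm_iteratedFDeriv_mul_le hf hg x (mod_cast le_top)
    _ ≤ ∑ i ∈ Finset.range (k + 1), (k.choose i : ℝ) * (A * B) := by
        rw [Finset.mul_sum]
        refine Finset.sum_le_sum fun i hi => ?_
        have hi' : i ≤ k := Nat.lt_succ_iff.1 (Finset.mem_range.1 hi)
        calc ρ ^ k * ((k.choose i : ℝ) * ‖iteratedFDeriv ℝ i f x‖
              * ‖iteratedFDeriv ℝ (k - i) g x‖)
            = (k.choose i : ℝ) * ((ρ ^ i * ‖iteratedFDeriv ℝ i f x‖)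
              * (ρ ^ (k - i) * ‖iteratedFDeriv ℝ (k - i) g x‖)) := by
              rw [← Nat.add_sub_cancel' hi', pow_add, Nat.add_sub_cancel' hi']
              ring
          _ ≤ (k.choose i : ℝ) * (A * B) := by
              refine mul_le_mul_of_nonneg_left ?_ (by positivity)
              exact mul_le_mul (h1 i (hi'.trans hk)) (h2 _ ((Nat.sub_le _ _).trans hk))
                (by positivity) hA
    _ = 2 ^ k * A * B := by
        rw [← Finset.sum_mul, ← mul_assoc]
        congr 2
        exact_mod_cast Nat.sum_range_choose k
    _ ≤ 2 ^ m * A * B := by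
        gcongr
        norm_num

theorem const_one : DerivBoundAt m ρ 1 (fun _ : Rn n => (1 : ℝ)) x := by
  intro k _
  rcases Nat.eq_zero_or_pos k with rfl | hk
  · simp
  · rw [iteratedFDeriv_const_of_ne hk.ne']
    simp

theorem one_sub (hg : ContDiff ℝ (⊤ : ℕ∞) g) (hρ : 0 ≤ ρ) (h : DerivBoundAt m ρ A g x) :
    DerivBoundAt m ρ (1 + A) (fun y => 1 - g y) x := by
  intro k hk
  have e : iteratedFDeriv ℝ k (fun y => 1 - g y) x
      = iteratedFDeriv ℝ k (fun _ : Rn n => (1 : ℝ)) x - iteratedFDeriv ℝ k g x :=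
    iteratedFDeriv_sub_apply contDiffAt_const (hg.contDiffAt.of_le (mod_cast le_top))
  rw [e]
  calc ρ ^ k * ‖iteratedFDeriv ℝ k (fun _ : Rn n => (1 : ℝ)) x - iteratedFDeriv ℝ k g x‖
      ≤ ρ ^ k * (‖iteratedFDeriv ℝ k (fun _ : Rn n => (1 : ℝ)) x‖ + ‖iteratedFDeriv ℝ k g x‖) := by
        gcongr
        exact norm_sub_le _ _
    _ ≤ 1 + A := by
        rw [mul_add]
        exact add_le_add (const_one k hk) (h k hk)

theorem prod {ι : Type*} {s : Finset ι} {f : ι → Rn n → ℝ} (hρ : 0 ≤ ρ)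
    (hf : ∀ i ∈ s, ContDiff ℝ (⊤ : ℕ∞) (f i)) (h : ∀ i ∈ s, DerivBoundAt m ρ A (f i) x) :
    DerivBoundAt m ρ ((2 ^ m * A) ^ s.card) (fun y => ∏ i ∈ s, f i y) x := by
  classical
  induction s using Finset.induction_on with
  | empty => simpa using const_one
  | insert i s hi ih =>
    simp only [Finset.prod_insert hi, Finset.card_insert_of_notMem hi]
    have h2 := ih (fun j hj => hf j (Finset.mem_insert_of_mem hj))
      (fun j hj => h j (Finset.mem_insert_of_mem hj))
    refine (mul (hf i (Finset.mem_insert_self i s)) (contDiff_prod fun j hj =>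
      hf j (Finset.mem_insert_of_mem hj)) hρ (h i (Finset.mem_insert_self i s)) h2).mono ?_
    rw [pow_succ]
    exact le_of_eq (by ring)

end DerivBoundAt

theorem derivBoundAt_scale {φ : Test n} {m : ℕ} {D : ℝ}
    (hD : ∀ k ≤ m, ∀ x, ‖iteratedFDeriv ℝ k φ x‖ ≤ D) (c : Rn n) {ρ : ℝ} (hρ : 0 < ρ) (x : Rn n) :
    DerivBoundAt m ρ D (fun y => φ (ρ⁻¹ • (y - c))) x := by
  intro k hk
  have e : (fun y : Rn n => φ (ρ⁻¹ • (y - c))) = fun y => φ (-(ρ⁻¹ • c) + ρ⁻¹ • y) := by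
    funext y
    rw [smul_sub, sub_eq_neg_add]
  rw [e]
  refine (mul_le_mul_of_nonneg_left
    (norm_iteratedFDeriv_comp_affine_le φ.contDiff (-(ρ⁻¹ • c)) ρ⁻¹ k x) (by positivity)).trans ?_
  rw [abs_of_pos (inv_pos.2 hρ), ← mul_assoc, ← mul_pow, mul_inv_cancel₀ hρ.ne', one_pow, one_mul]
  exact hD k hk _

/-- A smooth function between `0` and `1` that is `1` on the ball of radius `1/2`
and is supported in the unit ball. -/
def bump (n : ℕ) : Test n :=
  let b : ContDiffBump (0 : Rn n) := ⟨1 / 2, 1, by norm_num, by norm_num⟩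
  { toFun := b
    contDiff' := b.contDiff
    hasCompactSupport' := b.hasCompactSupport
    tsupport_subset' := by simp }

theorem bump_nonneg (x : Rn n) : 0 ≤ bump n x :=
  ContDiffBump.nonneg _

theorem bump_le_one (x : Rn n) : bump n x ≤ 1 :=
  ContDiffBump.le_one _

theorem bump_eq_one {x : Rn n} (hx : ‖x‖ ≤ 1 / 2) : bump n x = 1 :=
  ContDiffBump.one_of_mem_closedBall _ (by simpa using hx)

theorem bump_eq_zero {x : Rn n} (hx : 1 ≤ ‖x‖) : bump n x = 0 :=
  ContDiffBump.zero_of_le_dist _ (by simpa using hx)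

namespace Whitney

variable {Ω : Set (Rn n)} (W : Whitney Ω)

/-- The bump function adapted to the ball with index `i`. -/
def theta (i : W.A) (y : Rn n) : ℝ := bump n ((W.rad i)⁻¹ • (y - W.x i))

theorem finite_below (i : W.A) : {j : W.A | j < i}.Finite := by
  refine Set.Finite.of_finite_image (f := fun j : W.A => (j : ℕ)) ?_ Subtype.val_injective.injOn
  refine (Set.finite_Iio (i : ℕ)).subset ?_
  rintro _ ⟨j, hj, rfl⟩
  exact hj

/-- The partition of unity subordinate to the Whitney balls. -/
def eta (i : W.A) (y : Rn n) : ℝ :=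
  W.theta i y * ∏ j ∈ (W.finite_below i).toFinset, (1 - W.theta j y)

theorem contDiff_theta (i : W.A) : ContDiff ℝ (⊤ : ℕ∞) (W.theta i) := by
  have h := (bump n).contDiff
  unfold theta
  fun_prop

theorem contDiff_eta (i : W.A) : ContDiff ℝ (⊤ : ℕ∞) (W.eta i) :=
  (W.contDiff_theta i).mul
    (contDiff_prod fun j _ => contDiff_const.sub (W.contDiff_theta j))

theorem theta_nonneg (i : W.A) (y : Rn n) : 0 ≤ W.theta i y := bump_nonneg _

theorem theta_le_one (i : W.A) (y : Rn n) : W.theta i y ≤ 1 := bump_le_one _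

theorem eta_nonneg (i : W.A) (y : Rn n) : 0 ≤ W.eta i y :=
  mul_nonneg (W.theta_nonneg i y)
    (Finset.prod_nonneg fun j _ => sub_nonneg.2 (W.theta_le_one j y))

theorem eta_le_one (i : W.A) (y : Rn n) : W.eta i y ≤ 1 :=
  mul_le_one₀ (W.theta_le_one i y)
    (Finset.prod_nonneg fun j _ => sub_nonneg.2 (W.theta_le_one j y))
    (Finset.prod_le_one (fun j _ => sub_nonneg.2 (W.theta_le_one j y))
      fun j _ => by linarith [W.theta_nonneg j y])

theorem theta_eq_zero (hΩ : IsOpen Ω) {i : W.A} {y : Rn n} (h : W.rad i ≤ dist y (W.x i)) :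
    W.theta i y = 0 := by
  refine bump_eq_zero ?_
  rwa [norm_smul, norm_inv, Real.norm_of_nonneg (W.rad_pos hΩ i).le, ← dist_eq_norm,
    ← div_eq_inv_mul, one_le_div (W.rad_pos hΩ i)]

theorem theta_eq_one (hΩ : IsOpen Ω) {i : W.A} {y : Rn n} (h : dist y (W.x i) ≤ W.rad i / 2) :
    W.theta i y = 1 := by
  refine bump_eq_one ?_
  rw [norm_smul, norm_inv, Real.norm_of_nonneg (W.rad_pos hΩ i).le, ← dist_eq_norm,
    ← div_eq_inv_mul, div_le_iff₀ (W.rad_pos hΩ i)]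
  linarith

theorem eta_eq_zero (hΩ : IsOpen Ω) {i : W.A} {y : Rn n} (h : W.rad i ≤ dist y (W.x i)) :
    W.eta i y = 0 := by
  rw [eta, W.theta_eq_zero hΩ h, zero_mul]

theorem support_eta_subset (hΩ : IsOpen Ω) (i : W.A) :
    Function.support (W.eta i) ⊆ Metric.closedBall (W.x i) (W.rad i) := by
  intro y hy
  by_contra h
  rw [Metric.mem_closedBall, not_le] at h
  exact hy (W.eta_eq_zero hΩ h.le)

/-- The functions `eta i` sum to one on `Ω`. -/
theorem sum_eta (hΩ : IsOpen Ω) {y : Rn n} (hy : y ∈ Ω) (T : Finset W.A)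
    (hT : ∀ i, dist y (W.x i) ≤ W.rad i → i ∈ T) : ∑ i ∈ T, W.eta i y = 1 := by
  classical
  -- The telescoping identity ∏(1 - θ_i) = 1 - ∑ θ_i ∏_{j<i}(1 - θ_j). On Ω the product vanishes
  -- because some bump equals 1 at y. No division by ∑θ_i is needed.
  have h1 := Finset.prod_one_sub_ordered T fun i => W.theta i y
  have h2 : ∏ i ∈ T, (1 - W.theta i y) = 0 := by
    obtain ⟨i, hi⟩ := W.cover y hy
    have hp := W.rad_pos hΩ i
    have hi' : dist y (W.x i) ≤ W.rad i / 2 := by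
      unfold rad
      linarith
    refine Finset.prod_eq_zero (hT i (by linarith)) ?_
    rw [W.theta_eq_one hΩ hi', sub_self]
  rw [h2] at h1
  have h3 : ∑ i ∈ T, W.eta i y
      = ∑ i ∈ T, W.theta i y * ∏ j ∈ T with j < i, (1 - W.theta j y) := by
    refine Finset.sum_congr rfl fun i hi => ?_
    rw [eta]
    congr 1
    refine (Finset.prod_subset ?_ ?_).symm
    · intro j hj
      simpa using (Finset.mem_filter.1 hj).2
    · intro j hj hj'
      have hj1 : j < i := by simpa using hj
      have hjT : j ∉ T := fun h => hj' (Finset.mem_filter.2 ⟨h, hj1⟩)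
      rw [W.theta_eq_zero hΩ, sub_zero]
      by_contra hlt
      exact hjT (hT j (not_le.1 hlt).le)
  linarith

theorem rad_le_two_mul (hΩ : IsOpen Ω) {i j : W.A} (h : dist (W.x i) (W.x j) ≤ W.rad i + W.rad j) :
    W.rad i ≤ 2 * W.rad j := by
  have h1 := depth_le_add_dist Ω (W.x i) (W.x j)
  have h2 := W.rad_pos hΩ i
  have h3 := W.rad_pos hΩ j
  unfold rad at *
  linarith

/-- Only boundedly many factors matter near a given point, and the balls carrying them have
comparable radii, so rescaling costs a fixed constant. The bound depends on neither Ω nor the family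
nor the ball. -/
theorem exists_derivBoundAt_eta (n m : ℕ) : ∃ C : ℝ, 1 ≤ C ∧ ∀ {Ω : Set (Rn n)} (_ : IsOpen Ω)
    (W : Whitney Ω) (i : W.A) (x : Rn n), DerivBoundAt m (W.rad i) C (W.eta i) x := by
  obtain ⟨D, hD0, hD⟩ := exists_deriv_bound (bump n) m
  set B : ℝ := 2 ^ m * (1 + D) with hB
  have hB1 : 1 ≤ B := one_le_mul_of_one_le_of_one_le (one_le_pow₀ (by norm_num)) (by linarith)
  have h2B : 1 ≤ 2 ^ m * B := one_le_mul_of_one_le_of_one_le (one_le_pow₀ (by norm_num)) hB1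
  set C : ℝ := 2 ^ m * B * (2 ^ m * B) ^ overlapConst n with hC
  have hC1 : 1 ≤ C := one_le_mul_of_one_le_of_one_le h2B (one_le_pow₀ h2B)
  refine ⟨C, hC1, fun {Ω} hΩ W i x => ?_⟩
  have hρ := W.rad_pos hΩ i
  by_cases hx : dist x (W.x i) ≤ W.rad i
  swap
  · have hev : (fun _ : Rn n => (0 : ℝ)) =ᶠ[𝓝 x] W.eta i := by
      have hopen : IsOpen (Metric.closedBall (W.x i) (W.rad i))ᶜ :=
        Metric.isClosed_closedBall.isOpen_compl
      filter_upwards [hopen.mem_nhds (by simpa using hx)] with y hy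
      rw [W.eta_eq_zero hΩ]
      have : W.rad i < dist y (W.x i) := by simpa using hy
      exact this.le
    refine DerivBoundAt.congr ?_ hev
    intro k _
    have : iteratedFDeriv ℝ k (fun _ : Rn n => (0 : ℝ)) x = 0 := by
      rw [iteratedFDeriv_fun_zero]
      rfl
    rw [this, norm_zero, mul_zero]
    linarith
  classical
  -- The product over all predecessors has no bounded number of factors. Those whose closed ball
  -- misses x are identically 1 near x and can be dropped; the rest are counted by the overlap
  -- bound.
  set T := (W.finite_below i).toFinset.filter fun j => dist x (W.x j) ≤ W.rad j with hT
  have hev : (fun y => W.theta i y * ∏ j ∈ T, (1 - W.theta j y)) =ᶠ[𝓝 x] W.eta i := by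
    have h1 : ∀ j ∈ (W.finite_below i).toFinset, j ∉ T → ∀ᶠ y in 𝓝 x, W.theta j y = 0 := by
      intro j hj hjT
      have hd : W.rad j < dist x (W.x j) := by
        by_contra h
        exact hjT (Finset.mem_filter.2 ⟨hj, not_lt.1 h⟩)
      have hopen : IsOpen (Metric.closedBall (W.x j) (W.rad j))ᶜ :=
        Metric.isClosed_closedBall.isOpen_compl
      filter_upwards [hopen.mem_nhds (by simpa using hd)] with y hy
      refine W.theta_eq_zero hΩ ?_
      have : W.rad j < dist y (W.x j) := by simpa using hy
      exact this.le
    have h2 : ∀ᶠ y in 𝓝 x, ∀ j ∈ (W.finite_below i).toFinset, j ∉ T → W.theta j y = 0 := by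
      rw [Finset.eventually_all]
      intro j hj
      by_cases hjT : j ∈ T
      · exact Eventually.of_forall fun y h => absurd hjT h
      · filter_upwards [h1 j hj hjT] with y hy _ using hy
    filter_upwards [h2] with y hy
    rw [eta]
    congr 1
    refine Finset.prod_subset (Finset.filter_subset _ _) fun j hj hjT => ?_
    rw [hy j hj hjT, sub_zero]
  refine DerivBoundAt.congr ?_ hev
  have hcard : T.card ≤ overlapConst n := by
    refine W.card_le hΩ (y := x) T fun j hj => ?_
    have := (Finset.mem_filter.1 hj).2
    have := W.rad_pos hΩ j
    linarith
  have hprod : DerivBoundAt m (W.rad i) ((2 ^ m * B) ^ overlapConst n)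
      (fun y => ∏ j ∈ T, (1 - W.theta j y)) x := by
    refine (DerivBoundAt.prod hρ.le (fun j _ => contDiff_const.sub (W.contDiff_theta j))
      fun j hj => ?_).mono (pow_le_pow_right₀ h2B hcard)
    have hj' := (Finset.mem_filter.1 hj).2
    have hρj := W.rad_pos hΩ j
    refine (DerivBoundAt.one_sub (W.contDiff_theta j) hρj.le
      (derivBoundAt_scale hD _ hρj x)).rescale hρ.le hρj.le (by norm_num) ?_
    refine W.rad_le_two_mul hΩ ?_
    have := dist_triangle (W.x i) x (W.x j)
    rw [dist_comm (W.x i) x] at this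
    linarith
  refine (DerivBoundAt.mul (W.contDiff_theta i) (contDiff_prod fun j _ =>
    contDiff_const.sub (W.contDiff_theta j)) hρ.le
    ((derivBoundAt_scale hD _ hρ x).mono ?_) hprod)
  rw [hB]
  nlinarith [one_le_pow₀ (n := m) (by norm_num : (1 : ℝ) ≤ 2)]

end Whitney

end Cutoffs

/-! ### Functions on a ball with prescribed moments. -/

section Projections

variable {n s : ℕ}

/-- The monomial with exponents `α`. -/
def mono (α : Fin n → Fin (s + 1)) (y : Rn n) : ℝ := ∏ i, y i ^ (α i : ℕ)

theorem contDiff_mono (α : Fin n → Fin (s + 1)) : ContDiff ℝ (⊤ : ℕ∞) (mono α) := by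
  unfold mono
  fun_prop

theorem continuous_mono (α : Fin n → Fin (s + 1)) : Continuous (mono α) :=
  (contDiff_mono α).continuous

theorem abs_mono_le_one (α : Fin n → Fin (s + 1)) {y : Rn n} (hy : ‖y‖ ≤ 1) : |mono α y| ≤ 1 := by
  rw [mono, Finset.abs_prod]
  refine Finset.prod_le_one (fun _ _ => abs_nonneg _) fun i _ => ?_
  rw [abs_pow]
  exact pow_le_one₀ (abs_nonneg _) ((PiLp.norm_apply_le y i).trans hy)

/-- A test function that agrees with a monomial on the unit ball. -/
def monoTest (α : Fin n → Fin (s + 1)) : Test n where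
  toFun := fun y => mono α y * bump n ((1 / 2 : ℝ) • y)
  contDiff' := by
    have h := (bump n).contDiff
    have h2 := contDiff_mono α
    fun_prop
  hasCompactSupport' := by
    have h : HasCompactSupport fun y : Rn n => bump n ((1 / 2 : ℝ) • y) :=
      (bump n).hasCompactSupport.comp_homeomorph (Homeomorph.smulOfNeZero (1 / 2 : ℝ) (by norm_num))
    exact h.mul_left
  tsupport_subset' := by simp

theorem monoTest_apply (α : Fin n → Fin (s + 1)) {y : Rn n} (hy : ‖y‖ ≤ 1) :
    monoTest α y = mono α y := by
  change mono α y * bump n ((1 / 2 : ℝ) • y) = mono α y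
  rw [bump_eq_one, mul_one]
  rw [norm_smul, Real.norm_of_nonneg (by norm_num)]
  linarith

theorem eq_zero_of_sum_mono_eq_zero {c : (Fin n → Fin (s + 1)) → ℝ}
    (h : ∀ y ∈ Metric.ball (0 : Rn n) 1, ∑ α, c α * mono α y = 0) : c = 0 := by
  classical
  let E : (Fin n → Fin (s + 1)) → (Fin n →₀ ℕ) := fun α =>
    Finsupp.equivFunOnFinite.symm fun i => (α i : ℕ)
  have hE : Function.Injective E := by
    intro α β hαβ
    have := Finsupp.equivFunOnFinite.symm.injective hαβ
    funext i
    exact Fin.ext (congrFun this i)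
  let P : MvPolynomial (Fin n) ℝ := ∑ α, MvPolynomial.monomial (E α) (c α)
  have hε : (0 : ℝ) < 1 / (√n + 1) := by positivity
  have hP : P = 0 := by
    refine MvPolynomial.funext_set (fun _ => Ioo (-(1 / (√n + 1))) (1 / (√n + 1)))
      (fun _ => Ioo_infinite (by linarith)) fun x hx => ?_
    have hx' : WithLp.toLp 2 x ∈ Metric.ball (0 : Rn n) 1 := by
      rw [mem_ball_zero_iff]
      refine (norm_le_sqrt_mul hε.le fun i => ?_).trans_lt ?_
      · have := hx i (mem_univ i)
        exact (abs_lt.2 this).le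
      · rw [mul_one_div, div_lt_one (by positivity)]
        linarith
    have := h _ hx'
    simp only [P, map_sum, MvPolynomial.eval_monomial, map_zero]
    rw [← this]
    refine Finset.sum_congr rfl fun α _ => ?_
    rw [mono, Finsupp.prod_fintype _ _ (fun i => pow_zero _)]
    rfl
  funext α
  have h1 : MvPolynomial.coeff (E α) P = c α := by
    simp only [P, MvPolynomial.coeff_sum, MvPolynomial.coeff_monomial]
    rw [Finset.sum_eq_single α]
    · simp
    · intro β _ hβ
      rw [if_neg (fun h => hβ (hE h))]
    · simp
  rw [← h1, hP]
  simp

theorem integrableOn_ball_of_continuous {g : Rn n → ℝ} (hg : Continuous g) :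
    IntegrableOn g (Metric.ball (0 : Rn n) 1) :=
  (hg.continuousOn.integrableOn_compact (isCompact_closedBall (0 : Rn n) 1)).mono_set
    Metric.ball_subset_closedBall

/-- A system of bounded functions on the unit ball that is biorthogonal to the monomials. -/
theorem exists_dualMono (n s : ℕ) : ∃ Φ : (Fin n → Fin (s + 1)) → Rn n → ℝ,
    (∀ α, Measurable (Φ α)) ∧ (∀ α y, 1 < ‖y‖ → Φ α y = 0) ∧ (∃ B : ℝ, ∀ α y, |Φ α y| ≤ B) ∧
    ∀ α β, ∫ y, Φ α y * mono β y = if α = β then 1 else 0 := by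
  classical
  set U := Metric.ball (0 : Rn n) 1 with hU
  have hUm : MeasurableSet U := Metric.isOpen_ball.measurableSet
  have hcont : ∀ c : (Fin n → Fin (s + 1)) → ℝ, Continuous fun y : Rn n => ∑ α, c α * mono α y :=
    fun c => continuous_finsetSum _ fun α _ => continuous_const.mul (continuous_mono α)
  let G : ((Fin n → Fin (s + 1)) → ℝ) →ₗ[ℝ] ((Fin n → Fin (s + 1)) → ℝ) :=
    { toFun := fun c β => ∫ y in U, (∑ α, c α * mono α y) * mono β y
      map_add' := by
        intro c d
        funext β
        rw [Pi.add_apply, ← integral_add]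
        · refine integral_congr_ae (Eventually.of_forall fun y => ?_)
          simp only [Pi.add_apply, add_mul, Finset.sum_add_distrib]
        · exact integrableOn_ball_of_continuous ((hcont c).mul (continuous_mono β))
        · exact integrableOn_ball_of_continuous ((hcont d).mul (continuous_mono β))
      map_smul' := by
        intro r c
        funext β
        simp only [RingHom.id_apply, Pi.smul_apply, smul_eq_mul]
        rw [← integral_const_mul]
        refine integral_congr_ae (Eventually.of_forall fun y => ?_)
        simp only [mul_assoc, Finset.mul_sum, Finset.sum_mul] }
  -- `G` is the Gram operator of the monomials on the unit ball. If it kills c, the polynomial with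
  -- coefficients c has zero L² norm there and hence vanishes. By finite dimension `G` is also onto,
  -- which yields the biorthogonal system.
  have hinj : Function.Injective G := by
    rw [← LinearMap.ker_eq_bot, LinearMap.ker_eq_bot']
    intro c hc
    refine eq_zero_of_sum_mono_eq_zero ?_
    have h1 : ∫ y in U, (∑ α, c α * mono α y) ^ 2 = 0 := by
      have h2 : ∑ β, c β * G c β = 0 := by simp [hc]
      rw [← h2]
      have h3 : ∀ β, c β * G c β = ∫ y in U, c β * ((∑ α, c α * mono α y) * mono β y) :=
        fun β => (integral_const_mul _ _).symm
      simp_rw [h3]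
      rw [← integral_finsetSum]
      · refine integral_congr_ae (Eventually.of_forall fun y => ?_)
        simp only
        rw [sq, Finset.mul_sum]
        exact Finset.sum_congr rfl fun β _ => by ring
      · intro β _
        exact integrableOn_ball_of_continuous
          (continuous_const.mul ((hcont c).mul (continuous_mono β)))
    rw [setIntegral_eq_zero_iff_of_nonneg_ae (Eventually.of_forall fun y => sq_nonneg _)
      (integrableOn_ball_of_continuous ((hcont c).pow 2))] at h1
    have h4 := Measure.eqOn_open_of_ae_eq h1 Metric.isOpen_ball ((hcont c).pow 2).continuousOn
      continuousOn_const
    intro y hy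
    have := h4 hy
    simpa using this
  have hsurj : Function.Surjective G := LinearMap.injective_iff_surjective.1 hinj
  choose d hd using fun α : Fin n → Fin (s + 1) => hsurj (Pi.single α 1)
  refine ⟨fun α => U.indicator fun y => ∑ β, d α β * mono β y,
    fun α => (hcont _).measurable.indicator hUm, ?_, ?_, ?_⟩
  · intro α y hy
    refine indicator_of_notMem ?_ _
    rw [hU, mem_ball_zero_iff, not_lt]
    exact hy.le
  · refine ⟨∑ α, ∑ β, |d α β|, fun α y => ?_⟩
    have hle : ∑ β, |d α β| ≤ ∑ α, ∑ β, |d α β| :=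
      Finset.single_le_sum (f := fun α => ∑ β, |d α β|)
        (fun α _ => Finset.sum_nonneg fun β _ => abs_nonneg _) (Finset.mem_univ α)
    refine le_trans ?_ hle
    change |U.indicator (fun y => ∑ β, d α β * mono β y) y| ≤ _
    by_cases hy : y ∈ U
    · rw [indicator_of_mem hy]
      refine (Finset.abs_sum_le_sum_abs _ _).trans (Finset.sum_le_sum fun β _ => ?_)
      rw [abs_mul]
      refine mul_le_of_le_one_right (abs_nonneg _) (abs_mono_le_one β ?_)
      exact (mem_ball_zero_iff.1 hy).le
    · rw [indicator_of_notMem hy, abs_zero]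
      exact Finset.sum_nonneg fun β _ => abs_nonneg _
  · intro α β
    have h1 : G (d α) β = (Pi.single α 1 : (Fin n → Fin (s + 1)) → ℝ) β := by rw [hd α]
    have h2 : G (d α) β = ∫ y in U, (∑ γ, d α γ * mono γ y) * mono β y := rfl
    have h3 : ∀ y, U.indicator (fun y => ∑ γ, d α γ * mono γ y) y * mono β y
        = U.indicator (fun y => (∑ γ, d α γ * mono γ y) * mono β y) y := by
      intro y
      by_cases hy : y ∈ U
      · simp [indicator_of_mem hy]
      · simp [indicator_of_notMem hy]
    simp_rw [h3]
    rw [integral_indicator hUm, ← h2, h1, Pi.single_apply]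
    simp only [eq_comm]

/-- The functions biorthogonal to the monomials. -/
def dualMono (α : Fin n → Fin (s + 1)) : Rn n → ℝ := Classical.choose (exists_dualMono n s) α

theorem measurable_dualMono (α : Fin n → Fin (s + 1)) : Measurable (dualMono α) :=
  (Classical.choose_spec (exists_dualMono n s)).1 α

theorem dualMono_eq_zero (α : Fin n → Fin (s + 1)) {y : Rn n} (hy : 1 < ‖y‖) : dualMono α y = 0 :=
  (Classical.choose_spec (exists_dualMono n s)).2.1 α y hy

theorem exists_abs_dualMono_le (n s : ℕ) :
    ∃ B : ℝ, ∀ (α : Fin n → Fin (s + 1)) y, |dualMono α y| ≤ B :=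
  (Classical.choose_spec (exists_dualMono n s)).2.2.1

theorem integral_dualMono_mul_mono (α β : Fin n → Fin (s + 1)) :
    ∫ y, dualMono α y * mono β y = if α = β then 1 else 0 :=
  (Classical.choose_spec (exists_dualMono n s)).2.2.2 α β

/-- The coefficients of the projection of `u` onto polynomials. -/
def moment (c : Rn n) (ρ : ℝ) (u : Rn n → ℂ) (α : Fin n → Fin (s + 1)) : ℂ :=
  ∫ z, u z * (monoTest α (ρ⁻¹ • (z - c)) : ℂ)

/-- A function supported in the ball with centre `c` and radius `ρ` with the same moments
as `u`. -/
def proj (s : ℕ) (c : Rn n) (ρ : ℝ) (u : Rn n → ℂ) (y : Rn n) : ℂ :=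
  ∑ α : Fin n → Fin (s + 1), moment c ρ u α *
    (((ρ ^ n)⁻¹ * dualMono α (ρ⁻¹ • (y - c)) : ℝ) : ℂ)

theorem proj_eq_zero {c : Rn n} {ρ : ℝ} (hρ : 0 < ρ) (u : Rn n → ℂ) {y : Rn n}
    (hy : ρ < dist y c) : proj s c ρ u y = 0 := by
  refine Finset.sum_eq_zero fun α _ => ?_
  rw [dualMono_eq_zero α]
  · simp
  · rwa [norm_smul, norm_inv, Real.norm_of_nonneg hρ.le, ← dist_eq_norm, ← div_eq_inv_mul,
      one_lt_div hρ]

theorem measurable_proj (s : ℕ) (c : Rn n) (ρ : ℝ) (u : Rn n → ℂ) :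
    Measurable (proj s c ρ u) := by
  refine Finset.measurable_sum _ fun α _ => ?_
  refine measurable_const.mul (Complex.measurable_ofReal.comp (measurable_const.mul ?_))
  exact (measurable_dualMono α).comp (by fun_prop)

/-- The factor ρ^{-n} of the normalised dual functions absorbs the factor ρ^n in the size of the
moments. -/
theorem exists_norm_proj_le (n s : ℕ) : ∃ B : ℝ, 0 ≤ B ∧ ∀ (c : Rn n) (ρ : ℝ) (_ : 0 < ρ)
    (u : Rn n → ℂ) (K : ℝ), (∀ α : Fin n → Fin (s + 1), ‖moment c ρ u α‖ ≤ K * ρ ^ n) →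
      ∀ y, ‖proj s c ρ u y‖ ≤ B * K := by
  obtain ⟨B, hB⟩ := exists_abs_dualMono_le n s
  refine ⟨∑ _α : Fin n → Fin (s + 1), |B|, Finset.sum_nonneg fun _ _ => abs_nonneg _, ?_⟩
  intro c ρ hρ u K hK y
  rw [Finset.sum_mul]
  refine (norm_sum_le _ _).trans (Finset.sum_le_sum fun α _ => ?_)
  have hρn : 0 < ρ ^ n := by positivity
  rw [norm_mul, Complex.norm_real, norm_mul, Real.norm_of_nonneg (by positivity : 0 ≤ (ρ ^ n)⁻¹)]
  calc ‖moment c ρ u α‖ * ((ρ ^ n)⁻¹ * ‖dualMono α (ρ⁻¹ • (y - c))‖)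
      ≤ (K * ρ ^ n) * ((ρ ^ n)⁻¹ * |B|) := by
        refine mul_le_mul (hK α) ?_ (by positivity) ((norm_nonneg _).trans (hK α))
        exact mul_le_mul_of_nonneg_left ((hB α _).trans (le_abs_self B)) (by positivity)
    _ = |B| * K := by
        field_simp

theorem moment_sum {ι : Type*} (T : Finset ι) (c : Rn n) (ρ : ℝ) (u : ι → Rn n → ℂ)
    (hu : ∀ i ∈ T, Continuous (u i) ∧ HasCompactSupport (u i)) (α : Fin n → Fin (s + 1)) :
    moment c ρ (fun z => ∑ i ∈ T, u i z) α = ∑ i ∈ T, moment c ρ (u i) α := by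
  simp only [moment, Finset.sum_mul]
  rw [integral_finsetSum]
  intro i hi
  have hc : Continuous fun z : Rn n => (monoTest α (ρ⁻¹ • (z - c)) : ℂ) := by
    have := (monoTest α).contDiff.continuous
    fun_prop
  exact ((hu i hi).1.mul hc).integrable_of_hasCompactSupport (hu i hi).2.mul_right

theorem proj_sum {ι : Type*} (T : Finset ι) (c : Rn n) (ρ : ℝ) (u : ι → Rn n → ℂ)
    (hu : ∀ i ∈ T, Continuous (u i) ∧ HasCompactSupport (u i)) (y : Rn n) :
    proj s c ρ (fun z => ∑ i ∈ T, u i z) y = ∑ i ∈ T, proj s c ρ (u i) y := by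
  simp only [proj, moment_sum T c ρ u hu, Finset.sum_mul]
  exact Finset.sum_comm

theorem integrable_proj {c : Rn n} {ρ : ℝ} (hρ : 0 < ρ) (u : Rn n → ℂ) :
    Integrable (proj s c ρ u) := by
  obtain ⟨B, hB, hle⟩ := exists_norm_proj_le n s
  have hρn : 0 < ρ ^ n := by positivity
  set K : ℝ := (∑ α : Fin n → Fin (s + 1), ‖moment c ρ u α‖) / ρ ^ n with hK
  have hb : ∀ y, ‖proj s c ρ u y‖ ≤ B * K := by
    refine hle c ρ hρ u K fun α => ?_
    rw [hK, div_mul_cancel₀ _ hρn.ne']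
    exact Finset.single_le_sum (f := fun α => ‖moment c ρ u α‖)
      (fun _ _ => norm_nonneg _) (Finset.mem_univ α)
  have hon : IntegrableOn (proj s c ρ u) (Metric.closedBall c ρ) :=
    Measure.integrableOn_of_bounded (measure_closedBall_lt_top.ne)
      (measurable_proj s c ρ u).aestronglyMeasurable (Eventually.of_forall hb)
  refine (integrableOn_iff_integrable_of_support_subset ?_).1 hon
  intro y hy
  by_contra h
  rw [Metric.mem_closedBall, not_le] at h
  exact hy (proj_eq_zero hρ u h)

/-- Biorthogonality after an affine change of variables. `moment` is defined with compactly
supported `monoTest`, so that it is a pairing with a test function; on the ball carrying `u` this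
agrees with the monomial. -/
theorem integral_proj_mul_mono {c : Rn n} {ρ : ℝ} (hρ : 0 < ρ) {u : Rn n → ℂ}
    (hu : Function.support u ⊆ Metric.closedBall c ρ) (β : Fin n → Fin (s + 1)) :
    ∫ y, proj s c ρ u y * (mono β (ρ⁻¹ • (y - c)) : ℂ)
      = ∫ y, u y * (mono β (ρ⁻¹ • (y - c)) : ℂ) := by
  have hρn : 0 < ρ ^ n := by positivity
  have h1 : ∀ α : Fin n → Fin (s + 1), ∫ y, (((ρ ^ n)⁻¹ * dualMono α (ρ⁻¹ • (y - c)) : ℝ) : ℂ)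
      * (mono β (ρ⁻¹ • (y - c)) : ℂ) = if α = β then 1 else 0 := by
    intro α
    have e1 : ∀ y : Rn n, (((ρ ^ n)⁻¹ * dualMono α (ρ⁻¹ • (y - c)) : ℝ) : ℂ)
        * (mono β (ρ⁻¹ • (y - c)) : ℂ)
        = (((ρ ^ n)⁻¹ * (dualMono α (ρ⁻¹ • (y - c)) * mono β (ρ⁻¹ • (y - c))) : ℝ) : ℂ) := by
      intro y
      push_cast
      ring
    have e3 : ∫ y : Rn n, dualMono α (ρ⁻¹ • (y - c)) * mono β (ρ⁻¹ • (y - c))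
        = ρ ^ n * if α = β then 1 else 0 := by
      have h := integral_sub_right_eq_self (μ := volume) (fun y : Rn n =>
        dualMono α (ρ⁻¹ • y) * mono β (ρ⁻¹ • y)) c
      have h' := Measure.integral_comp_smul volume (fun y : Rn n => dualMono α y * mono β y) ρ⁻¹
      rw [h, h', integral_dualMono_mul_mono, finrank_euclideanSpace, Fintype.card_fin, inv_pow,
        inv_inv, abs_of_pos hρn, smul_eq_mul]
    simp_rw [e1]
    rw [integral_complex_ofReal, integral_const_mul, e3, ← mul_assoc, inv_mul_cancel₀ hρn.ne',
      one_mul]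
    split_ifs <;> simp
  have hint : ∀ α : Fin n → Fin (s + 1), Integrable fun y : Rn n =>
      (((ρ ^ n)⁻¹ * dualMono α (ρ⁻¹ • (y - c)) : ℝ) : ℂ) * (mono β (ρ⁻¹ • (y - c)) : ℂ) := by
    intro α
    obtain ⟨B, hB⟩ := exists_abs_dualMono_le n s
    have hB0 : 0 ≤ B := (abs_nonneg _).trans (hB α 0)
    have hm1 : Measurable fun y : Rn n => dualMono α (ρ⁻¹ • (y - c)) :=
      (measurable_dualMono α).comp (by fun_prop)
    have hm2 : Measurable fun y : Rn n => mono β (ρ⁻¹ • (y - c)) :=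
      (continuous_mono β).measurable.comp (by fun_prop)
    have hsupp : ∀ y, y ∉ Metric.closedBall c ρ → dualMono α (ρ⁻¹ • (y - c)) = 0 := by
      intro y h
      rw [Metric.mem_closedBall, not_le] at h
      refine dualMono_eq_zero α ?_
      rwa [norm_smul, norm_inv, Real.norm_of_nonneg hρ.le, ← dist_eq_norm, ← div_eq_inv_mul,
        one_lt_div hρ]
    refine (integrableOn_iff_integrable_of_support_subset (s := Metric.closedBall c ρ) ?_).1 ?_
    · intro y hy
      by_contra h
      exact hy (by simp [hsupp y h])
    · refine Measure.integrableOn_of_bounded (M := (ρ ^ n)⁻¹ * B) measure_closedBall_lt_top.ne ?_ ?_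
      · exact ((Complex.measurable_ofReal.comp (measurable_const.mul hm1)).mul
          (Complex.measurable_ofReal.comp hm2)).aestronglyMeasurable
      · filter_upwards [ae_restrict_mem Metric.isClosed_closedBall.measurableSet] with y hy
        rw [norm_mul, Complex.norm_real, Complex.norm_real, norm_mul,
          Real.norm_of_nonneg (by positivity : 0 ≤ (ρ ^ n)⁻¹)]
        have h2 : ‖mono β (ρ⁻¹ • (y - c))‖ ≤ 1 := by
          refine abs_mono_le_one β ?_
          rw [norm_smul, norm_inv, Real.norm_of_nonneg hρ.le, ← dist_eq_norm, ← div_eq_inv_mul,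
            div_le_one hρ]
          exact hy
        refine (mul_le_of_le_one_right (by positivity) h2).trans ?_
        exact mul_le_mul_of_nonneg_left (hB α _) (by positivity)
  have e2 : ∀ y, proj s c ρ u y * (mono β (ρ⁻¹ • (y - c)) : ℂ)
      = ∑ α : Fin n → Fin (s + 1), moment c ρ u α *
        ((((ρ ^ n)⁻¹ * dualMono α (ρ⁻¹ • (y - c)) : ℝ) : ℂ) * (mono β (ρ⁻¹ • (y - c)) : ℂ)) := by
    intro y
    rw [proj, Finset.sum_mul]
    exact Finset.sum_congr rfl fun α _ => by ring
  simp_rw [e2]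
  rw [integral_finsetSum _ fun α _ => (hint α).const_mul _]
  simp_rw [integral_const_mul, h1]
  rw [Finset.sum_eq_single β]
  · rw [if_pos rfl, mul_one, moment]
    refine integral_congr_ae (Eventually.of_forall fun y => ?_)
    by_cases hy : u y = 0
    · simp [hy]
    · have := Metric.mem_closedBall.1 (hu hy)
      simp only
      rw [monoTest_apply β]
      rwa [norm_smul, norm_inv, Real.norm_of_nonneg hρ.le, ← dist_eq_norm, ← div_eq_inv_mul,
        div_le_one hρ]
  · intro α _ hα
    rw [if_neg hα, mul_zero]
  · simp

/-- The binomial formula in each coordinate. Bounding each exponent by s, rather than the total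
degree, makes the index set a product stable under this expansion. It contains all monomials of
total degree at most s. -/
theorem exists_monomial_expansion (c : Rn n) {ρ : ℝ} (hρ : 0 < ρ) {γ : Fin n → ℕ}
    (hγ : ∀ i, γ i ≤ s) : ∃ b : (Fin n → Fin (s + 1)) → ℂ, ∀ y : Rn n,
      ∏ i, ((y i : ℝ) : ℂ) ^ γ i = ∑ α, b α * (mono α (ρ⁻¹ • (y - c)) : ℂ) := by
  refine ⟨fun α => ∏ i, ((ρ : ℂ) ^ (α i : ℕ) * ((c i : ℝ) : ℂ) ^ (γ i - (α i : ℕ))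
    * ((γ i).choose (α i : ℕ) : ℂ)), fun y => ?_⟩
  have hfac : ∀ i, ((y i : ℝ) : ℂ) ^ γ i = ∑ k : Fin (s + 1),
      ((ρ : ℂ) ^ (k : ℕ) * ((c i : ℝ) : ℂ) ^ (γ i - (k : ℕ)) * ((γ i).choose (k : ℕ) : ℂ))
        * (((ρ⁻¹ * (y i - c i) : ℝ)) : ℂ) ^ (k : ℕ) := by
    intro i
    have hρ' : (ρ : ℂ) ≠ 0 := by exact_mod_cast hρ.ne'
    have e : ((y i : ℝ) : ℂ) = (ρ : ℂ) * ((ρ⁻¹ * (y i - c i) : ℝ) : ℂ) + ((c i : ℝ) : ℂ) := by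
      push_cast
      field_simp
      ring
    conv_lhs => rw [e, add_pow]
    rw [Fin.sum_univ_eq_sum_range (fun k => ((ρ : ℂ) ^ k * ((c i : ℝ) : ℂ) ^ (γ i - k)
      * ((γ i).choose k : ℂ)) * (((ρ⁻¹ * (y i - c i) : ℝ)) : ℂ) ^ k) (s + 1)]
    have hsub : Finset.range (γ i + 1) ⊆ Finset.range (s + 1) :=
      Finset.range_mono (Nat.succ_le_succ (hγ i))
    rw [← Finset.sum_subset hsub]
    · refine Finset.sum_congr rfl fun k _ => ?_
      rw [mul_pow]
      ring
    · intro k _ hk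
      rw [Finset.mem_range, not_lt] at hk
      rw [Nat.choose_eq_zero_of_lt (by omega)]
      simp
  simp_rw [hfac]
  rw [Finset.prod_univ_sum, Fintype.piFinset_univ]
  refine Finset.sum_congr rfl fun α _ => ?_
  rw [Finset.prod_mul_distrib]
  congr 1
  rw [mono, Complex.ofReal_prod]
  refine Finset.prod_congr rfl fun i _ => ?_
  rw [Complex.ofReal_pow]
  rfl

/-- Replacing `u` by its projection does not change the moments. -/
theorem integral_proj_mul_monomial {c : Rn n} {ρ : ℝ} (hρ : 0 < ρ) {u : Rn n → ℂ}
    (hu : Function.support u ⊆ Metric.closedBall c ρ) (hui : Integrable u) {γ : Fin n → ℕ}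
    (hγ : ∀ i, γ i ≤ s) :
    ∫ y, proj s c ρ u y * ∏ i, ((y i : ℝ) : ℂ) ^ γ i = ∫ y, u y * ∏ i, ((y i : ℝ) : ℂ) ^ γ i := by
  obtain ⟨b, hb⟩ := exists_monomial_expansion c hρ hγ
  have hps : Function.support (proj s c ρ u) ⊆ Metric.closedBall c ρ := by
    intro y hy
    by_contra h
    rw [Metric.mem_closedBall, not_le] at h
    exact hy (proj_eq_zero hρ u h)
  have hc : ∀ α : Fin n → Fin (s + 1), Continuous fun y : Rn n =>
      (mono α (ρ⁻¹ • (y - c)) : ℂ) := by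
    intro α
    have := continuous_mono α
    fun_prop
  have key : ∀ v : Rn n → ℂ, Function.support v ⊆ Metric.closedBall c ρ → Integrable v →
      ∫ y, v y * ∏ i, ((y i : ℝ) : ℂ) ^ γ i
        = ∑ α, b α * ∫ y, v y * (mono α (ρ⁻¹ • (y - c)) : ℂ) := by
    intro v hv hvi
    have e : ∀ y, v y * ∏ i, ((y i : ℝ) : ℂ) ^ γ i
        = ∑ α, b α * (v y * (mono α (ρ⁻¹ • (y - c)) : ℂ)) := by
      intro y
      rw [hb y, Finset.mul_sum]
      exact Finset.sum_congr rfl fun α _ => by ring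
    simp_rw [e]
    rw [integral_finsetSum _ fun α _ =>
      (integrable_mul_continuous hvi hv (hc α)).const_mul _]
    exact Finset.sum_congr rfl fun α _ => integral_const_mul _ _
  rw [key _ hps (integrable_proj hρ u), key _ hu hui]
  exact Finset.sum_congr rfl fun α _ => by rw [integral_proj_mul_mono hρ hu α]

end Projections

/-! ### Size of the moment corrections, and sums over Whitney balls. -/

section Corrections

variable {n s : ℕ}

namespace Whitney

variable {Ω : Set (Rn n)} (W : Whitney Ω)

/-- The projection of `g * eta i * χ`, when the ball with index `i` is near the complement
of `Ω`. -/
def corr (s : ℕ) (g : Rn n → ℂ) (i : W.A) (χ : Rn n → ℝ) (y : Rn n) : ℂ :=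
  if depth Ω (W.x i) < 1 / 8 then
    proj s (W.x i) (W.rad i) (fun z => g z * ((W.eta i z * χ z : ℝ) : ℂ)) y else 0

theorem measurable_corr (g : Rn n → ℂ) (i : W.A) (χ : Rn n → ℝ) :
    Measurable (W.corr s g i χ) := by
  unfold corr
  split_ifs
  · exact measurable_proj _ _ _ _
  · exact measurable_const

theorem corr_eq_zero_of_dist (hΩ : IsOpen Ω) (g : Rn n → ℂ) {i : W.A} (χ : Rn n → ℝ) {y : Rn n}
    (hy : W.rad i < dist y (W.x i)) : W.corr s g i χ y = 0 := by
  unfold corr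
  split_ifs
  · exact proj_eq_zero (W.rad_pos hΩ i) _ hy
  · rfl

theorem corr_congr (g : Rn n → ℂ) {i : W.A} {χ χ' : Rn n → ℝ}
    (h : ∀ z, W.eta i z * χ z = W.eta i z * χ' z) : W.corr s g i χ = W.corr s g i χ' := by
  unfold corr
  simp only [h]

theorem corr_eq_zero (g : Rn n → ℂ) {i : W.A} {χ : Rn n → ℝ}
    (h : ∀ z, W.eta i z * χ z = 0) (y : Rn n) : W.corr s g i χ y = 0 := by
  unfold corr
  split_ifs
  · refine Finset.sum_eq_zero fun α _ => ?_
    simp [moment, h]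
  · rfl

theorem hasCompactSupport_eta (hΩ : IsOpen Ω) (i : W.A) : HasCompactSupport (W.eta i) :=
  HasCompactSupport.of_support_subset_isCompact (isCompact_closedBall _ _)
    (W.support_eta_subset hΩ i)

theorem continuous_eta (i : W.A) : Continuous (W.eta i) := (W.contDiff_eta i).continuous

theorem hasCompactSupport_mul_eta (hΩ : IsOpen Ω) (g : Rn n → ℂ) (i : W.A) (χ : Rn n → ℝ) :
    HasCompactSupport fun z => g z * ((W.eta i z * χ z : ℝ) : ℂ) := by
  refine HasCompactSupport.of_support_subset_isCompact
    (isCompact_closedBall (W.x i) (W.rad i)) ?_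
  intro z hz
  refine W.support_eta_subset hΩ i fun h => hz ?_
  simp [h]

theorem corr_sum (hΩ : IsOpen Ω) {g : Rn n → ℂ} (hg : Continuous g) (i : W.A) {ι : Type*}
    (T : Finset ι) (χ : ι → Rn n → ℝ) (hχ : ∀ j ∈ T, Continuous (χ j)) (y : Rn n) :
    W.corr s g i (fun z => ∑ j ∈ T, χ j z) y = ∑ j ∈ T, W.corr s g i (χ j) y := by
  unfold corr
  split_ifs
  · have e : (fun z => g z * ((W.eta i z * ∑ j ∈ T, χ j z : ℝ) : ℂ))
        = fun z => ∑ j ∈ T, g z * ((W.eta i z * χ j z : ℝ) : ℂ) := by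
      funext z
      rw [Finset.mul_sum, Complex.ofReal_sum, Finset.mul_sum]
    rw [e]
    refine proj_sum T _ _ _ (fun j hj => ⟨?_, W.hasCompactSupport_mul_eta hΩ g i (χ j)⟩) y
    have h1 := W.continuous_eta i
    have h2 := hχ j hj
    fun_prop
  · simp

/-- The tests against which the coefficients of `corr` are computed. -/
def corrTest (hΩ : IsOpen Ω) (i : W.A) (χ : Rn n → ℝ) (hχ : ContDiff ℝ (⊤ : ℕ∞) χ)
    (α : Fin n → Fin (s + 1)) : Test n where
  toFun := fun z => W.eta i z * χ z * monoTest α ((W.rad i)⁻¹ • (z - W.x i))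
  contDiff' := by
    have h1 := W.contDiff_eta i
    have h2 := (monoTest α).contDiff
    fun_prop
  hasCompactSupport' := ((W.hasCompactSupport_eta hΩ i).mul_right).mul_right
  tsupport_subset' := by simp

/-- The moment pairs `g` with a bump on the Whitney ball. As the truncation is inactive, there is a
point z off Ω at distance 32 radii from the centre, so this is also a bump of scale 33 radii about
z, and `Controlled` bounds the pairing by F(z). The scale is at most 33/256, within the admissible
1/4. -/
theorem exists_norm_moment_le (n s N : ℕ) {C₀ : ℝ} (hC₀ : 0 ≤ C₀) : ∃ K : ℝ, 0 ≤ K ∧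
    ∀ {F : Rn n → ℝ≥0∞} {g : Rn n → ℂ} (_ : Controlled N F C₀ g) {Ω : Set (Rn n)}
      (_ : IsOpen Ω) (W : Whitney Ω) (i : W.A), depth Ω (W.x i) < 1 / 8 →
      ∀ Λ : ℝ, 0 ≤ Λ → (∀ z ∉ Ω, F z ≤ ENNReal.ofReal Λ) →
      ∀ (χ : Rn n → ℝ) (B : ℝ), ContDiff ℝ (⊤ : ℕ∞) χ →
      (∀ x, DerivBoundAt (N + 1) (W.rad i) B χ x) → ∀ α : Fin n → Fin (s + 1),
        ‖moment (W.x i) (W.rad i) (fun z => g z * ((W.eta i z * χ z : ℝ) : ℂ)) α‖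
          ≤ K * B * Λ * W.rad i ^ n := by
  classical
  obtain ⟨C₁, hC₁, hη⟩ := exists_derivBoundAt_eta n (N + 1)
  have hD : ∃ D : ℝ, 0 ≤ D ∧ ∀ α : Fin n → Fin (s + 1), ∀ k ≤ N + 1, ∀ x,
      ‖iteratedFDeriv ℝ k (monoTest α) x‖ ≤ D := by
    choose D hD0 hD using fun α : Fin n → Fin (s + 1) => exists_deriv_bound (monoTest α) (N + 1)
    refine ⟨∑ α, D α, Finset.sum_nonneg fun α _ => (hD0 α).le, fun α k hk x => ?_⟩
    exact (hD α k hk x).trans (Finset.single_le_sum (fun α _ => (hD0 α).le) (Finset.mem_univ α))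
  obtain ⟨D, hD0, hD⟩ := hD
  refine ⟨C₀ * (33 ^ (N + 1) * (2 ^ (N + 1) * (2 ^ (N + 1) * C₁) * D)) * 33 ^ n, by positivity, ?_⟩
  intro F g hg Ω hΩ W i hi Λ hΛ hF χ B hχ hB α
  have hρ := W.rad_pos hΩ i
  obtain ⟨z, hz, hdz⟩ := exists_dist_eq_depth hΩ hi
  have hdz' : dist (W.x i) z = 32 * W.rad i := by
    rw [hdz, rad]
    ring
  have hsupp : tsupport (W.corrTest hΩ i χ hχ α) ⊆ Metric.closedBall z (33 * W.rad i) := by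
    refine closure_minimal ?_ Metric.isClosed_closedBall
    intro y hy
    have hy' : W.eta i y ≠ 0 := by
      intro h
      refine hy ?_
      change W.eta i y * χ y * _ = 0
      rw [h, zero_mul, zero_mul]
    have h1 := Metric.mem_closedBall.1 (W.support_eta_subset hΩ i hy')
    rw [Metric.mem_closedBall]
    have := dist_triangle y (W.x i) z
    linarith
  have hbd : ∀ k ≤ N + 1, ∀ y, (33 * W.rad i) ^ k * ‖iteratedFDeriv ℝ k
      (W.corrTest hΩ i χ hχ α) y‖ ≤ 33 ^ (N + 1) * (2 ^ (N + 1) * (2 ^ (N + 1) * C₁ * B) * D) := by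
    intro k hk y
    have hsm : ContDiff ℝ (⊤ : ℕ∞) fun z => monoTest α ((W.rad i)⁻¹ • (z - W.x i)) := by
      have h2 := (monoTest α).contDiff
      fun_prop
    have h1 := DerivBoundAt.mul (W.contDiff_eta i) hχ hρ.le (hη hΩ W i y) (hB y)
    have h2 := DerivBoundAt.mul ((W.contDiff_eta i).mul hχ) hsm hρ.le h1
      (derivBoundAt_scale (hD α) (W.x i) hρ y)
    exact h2.rescale (by positivity) hρ.le (by norm_num : (1 : ℝ) ≤ 33) le_rfl k hk
  have key := hg.norm_integral_le z (33 * W.rad i) _ Λ (W.corrTest hΩ i χ hχ α) (by positivity)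
    (by linarith [W.rad_le i]) hsupp hΛ (hF z hz) hbd
  have e : moment (W.x i) (W.rad i) (fun z => g z * ((W.eta i z * χ z : ℝ) : ℂ)) α
      = ∫ x, g x * (W.corrTest hΩ i χ hχ α x : ℂ) := by
    refine integral_congr_ae (Eventually.of_forall fun x => ?_)
    change _ = g x * ((W.eta i x * χ x * monoTest α ((W.rad i)⁻¹ • (x - W.x i)) : ℝ) : ℂ)
    push_cast
    ring
  rw [e]
  refine key.trans (le_of_eq ?_)
  rw [mul_pow]
  ring

/-- The correction terms are bounded by the size of the maximal function off `Ω`. -/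
theorem exists_norm_corr_le (n s N : ℕ) {C₀ : ℝ} (hC₀ : 0 ≤ C₀) : ∃ K : ℝ, 0 ≤ K ∧
    ∀ {F : Rn n → ℝ≥0∞} {g : Rn n → ℂ} (_ : Controlled N F C₀ g) {Ω : Set (Rn n)}
      (_ : IsOpen Ω) (W : Whitney Ω) (i : W.A),
      ∀ Λ : ℝ, 0 ≤ Λ → (∀ z ∉ Ω, F z ≤ ENNReal.ofReal Λ) →
      ∀ (χ : Rn n → ℝ) (B : ℝ), ContDiff ℝ (⊤ : ℕ∞) χ →
      (∀ x, DerivBoundAt (N + 1) (W.rad i) B χ x) → ∀ y, ‖W.corr s g i χ y‖ ≤ K * B * Λ := by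
  obtain ⟨K, hK, h⟩ := exists_norm_moment_le n s N hC₀
  obtain ⟨A, hA, hproj⟩ := exists_norm_proj_le n s
  refine ⟨A * K, by positivity, ?_⟩
  intro F g hg Ω hΩ W i Λ hΛ hF χ B hχ hB y
  have hB0 := (hB y).nonneg
  unfold corr
  split_ifs with hi
  · refine (hproj _ _ (W.rad_pos hΩ i) _ (K * B * Λ)
      (fun α => h hg hΩ W i hi Λ hΛ hF χ B hχ hB α) y).trans (le_of_eq (by ring))
  · rw [norm_zero]
    positivity

/-- The correction terms are bounded by the size of the function. -/
theorem exists_norm_corr_le_sup (n s : ℕ) : ∃ K : ℝ, 0 ≤ K ∧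
    ∀ (g : Rn n → ℂ) {Ω : Set (Rn n)} (_ : IsOpen Ω) (W : Whitney Ω) (i : W.A) (G : ℝ), 0 ≤ G →
      (∀ y ∈ Metric.closedBall (W.x i) (W.rad i), ‖g y‖ ≤ G) →
      ∀ y, ‖W.corr s g i (fun _ => 1) y‖ ≤ K * G := by
  obtain ⟨A, hA, hproj⟩ := exists_norm_proj_le n s
  set v := (volume (Metric.ball (0 : Rn n) 1)).toReal with hv
  refine ⟨A * v, by positivity, ?_⟩
  intro g Ω hΩ W i G hG hgG y
  have hρ := W.rad_pos hΩ i
  unfold corr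
  split_ifs with hi
  swap
  · rw [norm_zero]
    positivity
  refine (hproj _ _ hρ _ (v * G) (fun α => ?_) y).trans (le_of_eq (by ring))
  have hvol : (volume (Metric.closedBall (W.x i) (W.rad i))).toReal = W.rad i ^ n * v := by
    rw [Measure.addHaar_closedBall _ _ hρ.le, finrank_euclideanSpace, Fintype.card_fin,
      ENNReal.toReal_mul, ENNReal.toReal_ofReal (by positivity)]
  rw [moment, ← setIntegral_eq_integral_of_forall_compl_eq_zero
    (s := Metric.closedBall (W.x i) (W.rad i))]
  · refine (norm_setIntegral_le_of_norm_le_const (C := G) measure_closedBall_lt_top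
      fun z hz => ?_).trans (le_of_eq ?_)
    · rw [norm_mul, norm_mul, Complex.norm_real, Complex.norm_real, mul_one]
      have h1 : ‖W.eta i z‖ ≤ 1 := by
        rw [Real.norm_of_nonneg (W.eta_nonneg i z)]
        exact W.eta_le_one i z
      have h2 : ‖monoTest α ((W.rad i)⁻¹ • (z - W.x i))‖ ≤ 1 := by
        have h3 : ‖(W.rad i)⁻¹ • (z - W.x i)‖ ≤ 1 := by
          rw [norm_smul, norm_inv, Real.norm_of_nonneg hρ.le, ← dist_eq_norm, ← div_eq_inv_mul,
            div_le_one hρ]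
          exact hz
        rw [monoTest_apply α h3]
        exact abs_mono_le_one α h3
      calc ‖g z‖ * ‖W.eta i z‖ * ‖monoTest α ((W.rad i)⁻¹ • (z - W.x i))‖ ≤ G * 1 * 1 := by
            gcongr
            exact hgG z hz
        _ = G := by ring
    · rw [Measure.real, hvol]
      ring
  · intro z hz
    have : W.eta i z = 0 := by
      by_contra h
      exact hz (W.support_eta_subset hΩ i h)
    simp [this]

/-- A sum over the Whitney balls has few terms. -/
theorem tsum_eq_sum_near (hΩ : IsOpen Ω) {E : Type*} [AddCommMonoid E] [TopologicalSpace E]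
    {y : Rn n} {f : W.A → E} (hf : ∀ i, 10 * W.rad i < dist y (W.x i) → f i = 0) :
    ∑' i, f i = ∑ i ∈ (W.finite_near hΩ y).toFinset, f i := by
  refine tsum_eq_sum fun i hi => hf i ?_
  by_contra h
  exact hi (by simpa using h)

theorem norm_tsum_le (hΩ : IsOpen Ω) {E : Type*} [NormedAddCommGroup E] {y : Rn n} {f : W.A → E}
    (hf : ∀ i, 10 * W.rad i < dist y (W.x i) → f i = 0) {K : ℝ} (hK : 0 ≤ K)
    (hfK : ∀ i, ‖f i‖ ≤ K) : ‖∑' i, f i‖ ≤ overlapConst n * K := by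
  rw [W.tsum_eq_sum_near hΩ hf]
  refine (norm_sum_le_of_le _ fun i _ => hfK i).trans ?_
  rw [Finset.sum_const, nsmul_eq_mul]
  gcongr
  exact W.card_le hΩ (y := y) _ fun i hi => by simpa using hi

/-- Integration of a sum over the Whitney balls. -/
theorem hasSum_integral (hΩ : IsOpen Ω) {v : W.A → Rn n → ℂ} {G : Rn n → ℝ}
    (hG : Integrable G) (hG0 : ∀ y, 0 ≤ G y) (hv : ∀ i, AEStronglyMeasurable (v i) volume)
    (hvG : ∀ i y, ‖v i y‖ ≤ G y) (hv0 : ∀ i y, 10 * W.rad i < dist y (W.x i) → v i y = 0) :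
    HasSum (fun i => ∫ y, v i y) (∫ y, ∑' i, v i y) := by
  have hint : ∀ i, Integrable (v i) := fun i =>
    hG.mono' (hv i) (Eventually.of_forall (hvG i))
  refine hasSum_integral_of_summable_integral_norm hint ?_
  refine summable_of_sum_le (c := ∫ y, overlapConst n * G y)
    (fun i => integral_nonneg fun y => norm_nonneg _) fun T => ?_
  rw [← integral_finsetSum _ fun i _ => (hint i).norm]
  refine integral_mono (integrable_finsetSum _ fun i _ => (hint i).norm) (hG.const_mul _) ?_
  intro y
  classical
  have h1 : ∑ i ∈ T, ‖v i y‖ = ∑ i ∈ T with dist y (W.x i) ≤ 10 * W.rad i, ‖v i y‖ := by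
    refine (Finset.sum_filter_of_ne fun i _ hi => ?_).symm
    by_contra h
    exact hi (by rw [hv0 i y (not_le.1 h), norm_zero])
  simp only
  rw [h1]
  refine (Finset.sum_le_sum fun i _ => hvG i y).trans ?_
  rw [Finset.sum_const, nsmul_eq_mul]
  refine mul_le_mul_of_nonneg_right ?_ (hG0 y)
  exact_mod_cast W.card_le hΩ (y := y) _ fun i hi => (Finset.mem_filter.1 hi).2

end Whitney

end Corrections

/-! ### Good parts and pieces between two consecutive level sets. -/

section Pieces

variable {n s : ℕ}

namespace Whitney

variable {Ω Ω' : Set (Rn n)} (W : Whitney Ω) (W' : Whitney Ω')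

/-- The good part of the Calderón–Zygmund decomposition of `g`. -/
def good (s : ℕ) (g : Rn n → ℂ) (y : Rn n) : ℂ :=
  Ωᶜ.indicator g y + ∑' i, W.corr s g i (fun _ => 1) y

/-- The part of the difference of two good parts that lives near the ball with index `i`. -/
def piece (s : ℕ) (g : Rn n → ℂ) (i : W.A) (y : Rn n) : ℂ :=
  Ω'ᶜ.indicator (fun z => g z * (W.eta i z : ℂ)) y - W.corr s g i (fun _ => 1) y
    + ∑' l, W'.corr s g l (W.eta i) y

/-- Depth is monotone in the set and 1-Lipschitz, and 32 radii make up the depth, so 32ρ' ≤ 32ρ + ρ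
+ ρ'. A ball of the inner family that meets a ball of the outer one is hardly larger. -/
theorem thirtyOne_mul_rad_le (hΩ : IsOpen Ω) (hΩ' : IsOpen Ω') (h : Ω' ⊆ Ω) {l : W'.A} {i : W.A}
    {z : Rn n} (h1 : dist z (W'.x l) ≤ W'.rad l) (h2 : dist z (W.x i) ≤ W.rad i) :
    31 * W'.rad l ≤ 33 * W.rad i := by
  have h3 := depth_mono h (W'.x l)
  have h4 := depth_le_add_dist Ω (W'.x l) (W.x i)
  have h5 := dist_triangle (W'.x l) z (W.x i)
  rw [dist_comm (W'.x l) z] at h5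
  have h6 := W.rad_pos hΩ i
  have h7 := W'.rad_pos hΩ' l
  unfold rad at *
  linarith

theorem corr_ne_zero (hΩ : IsOpen Ω) (hΩ' : IsOpen Ω') {g : Rn n → ℂ} {l : W'.A} {i : W.A}
    {y : Rn n} (hne : W'.corr s g l (W.eta i) y ≠ 0) :
    ∃ z, dist z (W'.x l) ≤ W'.rad l ∧ dist z (W.x i) ≤ W.rad i := by
  by_contra hcon
  push Not at hcon
  refine hne (W'.corr_eq_zero g (fun z => ?_) y)
  by_cases h1 : dist z (W'.x l) ≤ W'.rad l
  · rw [W.eta_eq_zero hΩ (hcon z h1).le, mul_zero]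
  · rw [W'.eta_eq_zero hΩ' (not_le.1 h1).le, zero_mul]

/-- A correction belonging to an inner ball that meets ball i reaches at most 1 + 2 · 33/31 < 10
radii from the centre of ball i. The factor 10 used throughout leaves room for this. -/
theorem corr_eq_zero_of_far (hΩ : IsOpen Ω) (hΩ' : IsOpen Ω') (h : Ω' ⊆ Ω) {g : Rn n → ℂ}
    {l : W'.A} {i : W.A} {y : Rn n} (hy : 10 * W.rad i < dist y (W.x i)) :
    W'.corr s g l (W.eta i) y = 0 := by
  by_contra hne
  obtain ⟨z, h1, h2⟩ := W.corr_ne_zero W' hΩ hΩ' hne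
  have h3 := W.thirtyOne_mul_rad_le W' hΩ hΩ' h h1 h2
  have h4 : dist y (W'.x l) ≤ W'.rad l := by
    by_contra h5
    exact hne (W'.corr_eq_zero_of_dist hΩ' g _ (not_le.1 h5))
  have h6 := dist_triangle y (W'.x l) z
  have h7 := dist_triangle y z (W.x i)
  rw [dist_comm (W'.x l) z] at h6
  have h8 := W.rad_pos hΩ i
  linarith

theorem corr_eq_zero_of_far_left (hΩ' : IsOpen Ω') {g : Rn n → ℂ} {l : W'.A} {χ : Rn n → ℝ}
    {y : Rn n} (hy : 10 * W'.rad l < dist y (W'.x l)) : W'.corr s g l χ y = 0 :=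
  W'.corr_eq_zero_of_dist hΩ' g _ (by linarith [W'.rad_pos hΩ' l])

theorem piece_eq_zero (hΩ : IsOpen Ω) (hΩ' : IsOpen Ω') (h : Ω' ⊆ Ω) {g : Rn n → ℂ} {i : W.A}
    {y : Rn n} (hy : 10 * W.rad i < dist y (W.x i)) : W.piece W' s g i y = 0 := by
  have hρ := W.rad_pos hΩ i
  have h1 : W.eta i y = 0 := W.eta_eq_zero hΩ (by linarith)
  rw [piece, W.corr_eq_zero_of_far_left hΩ hy]
  have h2 : ∀ l, W'.corr s g l (W.eta i) y = 0 := fun l =>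
    W.corr_eq_zero_of_far W' hΩ hΩ' h hy
  simp [h2, h1, indicator]

/-- Off Ω' the function itself is at most a multiple of 2Λ. Each correction is at most a multiple of
Λ by the moment estimate, the cut-offs η_i being admissible at the smaller scale of the inner balls,
and at each point only boundedly many corrections are nonzero. -/
theorem exists_norm_piece_le (n s N : ℕ) {C₀ : ℝ} (hC₀ : 0 ≤ C₀) : ∃ K : ℝ, 0 ≤ K ∧
    ∀ {F : Rn n → ℝ≥0∞} {g : Rn n → ℂ} (_ : Controlled N F C₀ g) {Ω Ω' : Set (Rn n)}
      (_ : IsOpen Ω) (_ : IsOpen Ω') (_ : Ω' ⊆ Ω) (W : Whitney Ω) (W' : Whitney Ω') (Λ : ℝ),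
      0 ≤ Λ → (∀ z ∉ Ω, F z ≤ ENNReal.ofReal Λ) → (∀ z ∉ Ω', F z ≤ ENNReal.ofReal (2 * Λ)) →
      (∀ i y, ‖W.piece W' s g i y‖ ≤ K * Λ) ∧ (∀ y, ‖W.good s g y‖ ≤ K * Λ) ∧
      ∀ i l y, ‖W'.corr s g l (W.eta i) y‖ ≤ K * Λ := by
  obtain ⟨K₁, hK₁, hcorr⟩ := exists_norm_corr_le n s N hC₀
  obtain ⟨C₁, hC₁, hη⟩ := exists_derivBoundAt_eta n (N + 1)
  set M : ℝ := (overlapConst n : ℝ) with hM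
  have hM0 : 0 ≤ M := by positivity
  set K₂ : ℝ := K₁ * (2 ^ (N + 1) * C₁) * 2 with hK₂
  have hK₂0 : 0 ≤ K₂ := by positivity
  refine ⟨2 * C₀ + K₁ + K₂ + M * K₂ + M * K₁, by positivity, ?_⟩
  intro F g hg Ω Ω' hΩ hΩ' hsub W W' Λ hΛ hF hF'
  have hc1 : ∀ i y, ‖W.corr s g i (fun _ => 1) y‖ ≤ K₁ * Λ := by
    intro i y
    have := hcorr hg hΩ W i Λ hΛ hF (fun _ => 1) 1 contDiff_const (fun x => DerivBoundAt.const_one) y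
    rwa [mul_one] at this
  have hc2 : ∀ i l y, ‖W'.corr s g l (W.eta i) y‖ ≤ K₂ * Λ := by
    intro i l y
    by_cases hne : W'.corr s g l (W.eta i) y = 0
    · rw [hne, norm_zero]
      positivity
    obtain ⟨z, h1, h2⟩ := W.corr_ne_zero W' hΩ hΩ' hne
    have h3 := W.thirtyOne_mul_rad_le W' hΩ hΩ' hsub h1 h2
    have hρ := W.rad_pos hΩ i
    have hρ' := W'.rad_pos hΩ' l
    have := hcorr hg hΩ' W' l (2 * Λ) (by positivity) hF' (W.eta i) (2 ^ (N + 1) * C₁)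
      (W.contDiff_eta i) (fun x => (hη hΩ W i x).rescale hρ'.le hρ.le (by norm_num)
        (by linarith)) y
    refine this.trans (le_of_eq ?_)
    rw [hK₂]
    ring
  refine ⟨?_, ?_, ?_⟩
  · intro i y
    have t1 : ‖Ω'ᶜ.indicator (fun z => g z * (W.eta i z : ℂ)) y‖ ≤ 2 * C₀ * Λ := by
      by_cases hy : y ∈ Ω'
      · rw [indicator_of_notMem (by simpa using hy), norm_zero]
        positivity
      · rw [indicator_of_mem (by simpa using hy), norm_mul, Complex.norm_real,
          Real.norm_of_nonneg (W.eta_nonneg i y)]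
        refine (mul_le_of_le_one_right (norm_nonneg _) (W.eta_le_one i y)).trans ?_
        refine (hg.norm_le y (2 * Λ) (by positivity) (hF' y hy)).trans (le_of_eq (by ring))
    have t3 : ‖∑' l, W'.corr s g l (W.eta i) y‖ ≤ M * (K₂ * Λ) := by
      refine W'.norm_tsum_le hΩ' (fun l hl => W'.corr_eq_zero_of_far_left hΩ' hl) (by positivity)
        fun l => ?_
      exact hc2 i l y
    rw [piece]
    calc _ ≤ 2 * C₀ * Λ + K₁ * Λ + M * (K₂ * Λ) :=
          norm_add_le_of_le (norm_sub_le_of_le t1 (hc1 i y)) t3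
      _ ≤ (2 * C₀ + K₁ + K₂ + M * K₂ + M * K₁) * Λ := by
          have : 0 ≤ (M * K₁ + K₂) * Λ := by positivity
          linarith
  · intro y
    have t1 : ‖Ωᶜ.indicator g y‖ ≤ C₀ * Λ := by
      by_cases hy : y ∈ Ω
      · rw [indicator_of_notMem (by simpa using hy), norm_zero]
        positivity
      · rw [indicator_of_mem (by simpa using hy)]
        exact hg.norm_le y Λ hΛ (hF y hy)
    have t2 : ‖∑' i, W.corr s g i (fun _ => 1) y‖ ≤ M * (K₁ * Λ) :=
      W.norm_tsum_le hΩ (fun l hl => W.corr_eq_zero_of_far_left hΩ hl) (by positivity)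
        fun l => hc1 l y
    rw [good]
    calc _ ≤ C₀ * Λ + M * (K₁ * Λ) := norm_add_le_of_le t1 t2
      _ ≤ (2 * C₀ + K₁ + K₂ + M * K₂ + M * K₁) * Λ := by
          have : 0 ≤ (C₀ + K₁ + K₂ + M * K₂) * Λ := by positivity
          linarith
  · intro i l y
    refine (hc2 i l y).trans (mul_le_mul_of_nonneg_right ?_ hΛ)
    have : 0 ≤ 2 * C₀ + K₁ + M * K₂ + M * K₁ := by positivity
    linarith

theorem hasSum_near (hΩ : IsOpen Ω) {y : Rn n} {f : W.A → ℂ}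
    (hf : ∀ i, 10 * W.rad i < dist y (W.x i) → f i = 0) : HasSum f (∑' i, f i) := by
  rw [W.tsum_eq_sum_near hΩ hf]
  refine hasSum_sum_of_ne_finset_zero fun i hi => hf i ?_
  by_contra h
  exact hi (by simpa using h)

theorem measurable_tsum (hΩ : IsOpen Ω) {v : W.A → Rn n → ℂ} (hv : ∀ i, Measurable (v i))
    (hv0 : ∀ i y, 10 * W.rad i < dist y (W.x i) → v i y = 0) :
    Measurable fun y => ∑' i, v i y := by
  refine measurable_of_tendsto_metrizable' (atTop : Filter (Finset W.A))
    (f := fun T y => ∑ i ∈ T, v i y) (fun T => Finset.measurable_sum T fun i _ => hv i) ?_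
  rw [tendsto_pi_nhds]
  exact fun y => W.hasSum_near hΩ fun i hi => hv0 i y hi

theorem measurable_piece (hΩ' : IsOpen Ω') {g : Rn n → ℂ} (hg : Continuous g) (i : W.A) :
    Measurable (W.piece W' s g i) := by
  have h1 : Continuous fun z => g z * (W.eta i z : ℂ) := by
    have := W.continuous_eta i
    fun_prop
  exact ((h1.measurable.indicator hΩ'.measurableSet.compl).sub (W.measurable_corr g i _)).add
    (W'.measurable_tsum hΩ' (fun l => W'.measurable_corr g l _)
      fun _ _ hl => W'.corr_eq_zero_of_far_left hΩ' hl)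

theorem measurable_good (hΩ : IsOpen Ω) {g : Rn n → ℂ} (hg : Continuous g) :
    Measurable (W.good s g) :=
  (hg.measurable.indicator hΩ.measurableSet.compl).add
    (W.measurable_tsum hΩ (fun l => W.measurable_corr g l _)
      fun _ _ hl => W.corr_eq_zero_of_far_left hΩ hl)

/-- The pieces sum to the difference of the good parts. -/
theorem tsum_piece (hΩ : IsOpen Ω) (hΩ' : IsOpen Ω') (h : Ω' ⊆ Ω) {g : Rn n → ℂ}
    (hg : Continuous g) (y : Rn n) :
    ∑' i, W.piece W' s g i y = W'.good s g y - W.good s g y := by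
  rw [W.tsum_eq_sum_near hΩ fun i hi => W.piece_eq_zero W' hΩ hΩ' h hi]
  set T := (W.finite_near hΩ y).toFinset with hT
  set T' := (W'.finite_near hΩ' y).toFinset with hT'
  have e1 : ∑ i ∈ T, Ω'ᶜ.indicator (fun z => g z * (W.eta i z : ℂ)) y
      = Ω'ᶜ.indicator g y - Ωᶜ.indicator g y := by
    by_cases hy : y ∈ Ω
    · have hs : ∑ i ∈ T, W.eta i y = 1 := W.sum_eta hΩ hy T fun i hi => by
        have := W.rad_pos hΩ i
        simp only [hT, Finite.mem_toFinset, mem_ofPred_eq]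
        linarith
      rw [indicator_of_notMem (s := Ωᶜ) (by simpa using hy), sub_zero]
      by_cases hy' : y ∈ Ω'
      · rw [indicator_of_notMem (by simpa using hy')]
        exact Finset.sum_eq_zero fun i _ => indicator_of_notMem (by simpa using hy') _
      · rw [indicator_of_mem (by simpa using hy')]
        rw [Finset.sum_congr rfl fun i _ => indicator_of_mem (by simpa using hy') _,
          ← Finset.mul_sum, ← Complex.ofReal_sum, hs]
        simp
    · have hy' : y ∉ Ω' := fun h' => hy (h h')
      rw [indicator_of_mem (s := Ωᶜ) (by simpa using hy),
        indicator_of_mem (by simpa using hy'), sub_self]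
      refine Finset.sum_eq_zero fun i _ => ?_
      have : W.eta i y = 0 := by
        refine W.eta_eq_zero hΩ ?_
        by_contra hlt
        refine hy (W.closedBall_subset hΩ i ?_)
        have := W.rad_pos hΩ i
        rw [Metric.mem_closedBall]
        linarith [not_le.1 hlt]
      simp [indicator, this]
  -- The correction is linear in its cut-off, and the η_i sum to 1 on the support of η'_l because Ω'
  -- ⊆ Ω. So the inner corrections recombine into those of the inner good part.
  have e3 : ∀ l, ∑ i ∈ T, W'.corr s g l (W.eta i) y = W'.corr s g l (fun _ => 1) y := by
    intro l
    have hfar : ∀ i, 10 * W.rad i < dist y (W.x i) → W'.corr s g l (W.eta i) y = 0 :=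
      fun i hi => W.corr_eq_zero_of_far W' hΩ hΩ' h hi
    rw [hT, ← W.tsum_eq_sum_near hΩ hfar]
    set Tl := (W.finite_near hΩ (W'.x l)).toFinset with hTl
    have hnear : ∀ (z : Rn n) (i : W.A), dist z (W'.x l) ≤ W'.rad l → dist z (W.x i) ≤ W.rad i →
        i ∈ Tl := by
      intro z i h1 h2
      have h3 := W.thirtyOne_mul_rad_le W' hΩ hΩ' h h1 h2
      have h5 := dist_triangle (W'.x l) z (W.x i)
      rw [dist_comm (W'.x l) z] at h5
      have := W.rad_pos hΩ i
      simp only [hTl, Finite.mem_toFinset, mem_ofPred_eq]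
      linarith
    rw [tsum_eq_sum (s := Tl)]
    · rw [← W'.corr_sum hΩ' hg l Tl (fun i => W.eta i) fun i _ => W.continuous_eta i]
      refine congrFun (W'.corr_congr g fun z => ?_) y
      by_cases hz : W'.eta l z = 0
      · rw [hz, zero_mul, zero_mul]
      have hz1 := Metric.mem_closedBall.1 (W'.support_eta_subset hΩ' l hz)
      have hzΩ : z ∈ Ω := by
        refine h (W'.closedBall_subset hΩ' l ?_)
        have := W'.rad_pos hΩ' l
        rw [Metric.mem_closedBall]
        linarith
      rw [W.sum_eta hΩ hzΩ Tl fun i hi => hnear z i hz1 hi]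
    · intro i hi
      by_contra hne
      obtain ⟨z, h1, h2⟩ := W.corr_ne_zero W' hΩ hΩ' hne
      exact hi (hnear z i h1 h2)
  have e4 : ∑ i ∈ T, ∑' l, W'.corr s g l (W.eta i) y = ∑' l, W'.corr s g l (fun _ => 1) y := by
    rw [W'.tsum_eq_sum_near hΩ' fun l hl => W'.corr_eq_zero_of_far_left hΩ' hl]
    rw [Finset.sum_congr rfl fun i _ => W'.tsum_eq_sum_near hΩ' fun l hl =>
      W'.corr_eq_zero_of_far_left hΩ' hl]
    rw [Finset.sum_comm]
    exact Finset.sum_congr rfl fun l _ => e3 l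
  simp only [piece, good]
  rw [Finset.sum_add_distrib, Finset.sum_sub_distrib, e1, e4,
    ← W.tsum_eq_sum_near hΩ fun i hi => W.corr_eq_zero_of_far_left hΩ hi]
  ring

/-- On a ball of full depth 1/8 the correction is zero by definition and need not preserve moments.
The moments agree there only if the function to be corrected vanishes, whence the alternative in the
hypothesis. -/
theorem integral_corr_mul_monomial (hΩ : IsOpen Ω) {g : Rn n → ℂ} (hg : Continuous g) (i : W.A)
    {χ : Rn n → ℝ} (hχ : Continuous χ) (hi : depth Ω (W.x i) < 1 / 8 ∨ ∀ z, W.eta i z * χ z = 0)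
    {γ : Fin n → ℕ} (hγ : ∀ j, γ j ≤ s) :
    ∫ y, W.corr s g i χ y * ∏ j, ((y j : ℝ) : ℂ) ^ γ j
      = ∫ y, g y * ((W.eta i y * χ y : ℝ) : ℂ) * ∏ j, ((y j : ℝ) : ℂ) ^ γ j := by
  rcases hi with hi | hi
  · have e : W.corr s g i χ = proj s (W.x i) (W.rad i)
        (fun z => g z * ((W.eta i z * χ z : ℝ) : ℂ)) := by
      funext y
      rw [corr, if_pos hi]
    rw [e]
    refine integral_proj_mul_monomial (W.rad_pos hΩ i) ?_ ?_ hγ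
    · intro z hz
      refine W.support_eta_subset hΩ i fun h => hz ?_
      simp [h]
    · refine Continuous.integrable_of_hasCompactSupport ?_ (W.hasCompactSupport_mul_eta hΩ g i χ)
      have := W.continuous_eta i
      fun_prop
  · simp [W.corr_eq_zero g hi, hi]

/-- The outer correction has the moments of gη_i, and the inner ones together have the moments of
∑_l gη'_lη_i, which is gη_i restricted to Ω'. Added with their signs to gη_i restricted to the
complement of Ω', everything cancels. Since `corr` matches moments by functions on its own ball, no
cross terms occur. -/
theorem integral_piece_mul_monomial (hΩ : IsOpen Ω) (hΩ' : IsOpen Ω') (h : Ω' ⊆ Ω)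
    {g : Rn n → ℂ} (hg : Continuous g) {K : ℝ}
    (hK : ∀ i l y, ‖W'.corr s g l (W.eta i) y‖ ≤ K) {i : W.A}
    (hi : depth Ω (W.x i) < 1 / 16) {γ : Fin n → ℕ} (hγ : ∀ j, γ j ≤ s) :
    ∫ y, W.piece W' s g i y * ∏ j, ((y j : ℝ) : ℂ) ^ γ j = 0 := by
  set P : Rn n → ℂ := fun y => ∏ j, ((y j : ℝ) : ℂ) ^ γ j with hP
  have hPc : Continuous P := by fun_prop
  have hηc := W.continuous_eta i
  set B := Metric.closedBall (W.x i) (10 * W.rad i) with hB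
  have hBm : MeasurableSet B := Metric.isClosed_closedBall.measurableSet
  have hK0 : 0 ≤ |K| := abs_nonneg K
  -- the terms of the sum over `l`
  set G : Rn n → ℝ := B.indicator fun y => |K| * ‖P y‖ with hG
  have hGi : Integrable G := by
    refine IntegrableOn.integrable_indicator ?_ hBm
    exact (by fun_prop : Continuous fun y => |K| * ‖P y‖).continuousOn.integrableOn_compact
      (isCompact_closedBall _ _)
  have hG0 : ∀ y, 0 ≤ G y := fun y => indicator_nonneg (fun _ _ => by positivity) y
  have s1 : HasSum (fun l => ∫ y, W'.corr s g l (W.eta i) y * P y)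
      (∫ y, ∑' l, W'.corr s g l (W.eta i) y * P y) := by
    refine W'.hasSum_integral hΩ' hGi hG0
      (fun l => ((W'.measurable_corr g l _).mul hPc.measurable).aestronglyMeasurable) ?_ ?_
    · intro l y
      by_cases hy : y ∈ B
      · rw [hG, indicator_of_mem hy, norm_mul]
        exact mul_le_mul_of_nonneg_right ((hK i l y).trans (le_abs_self K)) (norm_nonneg _)
      · rw [W.corr_eq_zero_of_far W' hΩ hΩ' h (by simpa [hB] using hy), zero_mul, norm_zero]
        exact hG0 y
    · intro l y hl
      rw [W'.corr_eq_zero_of_far_left hΩ' hl, zero_mul]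
  set u : Rn n → ℂ := fun y => g y * (W.eta i y : ℂ) * P y with hu
  have huc : Continuous u := by fun_prop
  have husupp : HasCompactSupport u := by
    refine HasCompactSupport.of_support_subset_isCompact
      (isCompact_closedBall (W.x i) (W.rad i)) fun z hz => ?_
    refine W.support_eta_subset hΩ i fun h0 => hz ?_
    simp [hu, h0]
  have hui : Integrable u := huc.integrable_of_hasCompactSupport husupp
  have s2 : HasSum (fun l => ∫ y, g y * ((W'.eta l y * W.eta i y : ℝ) : ℂ) * P y)
      (∫ y, ∑' l, g y * ((W'.eta l y * W.eta i y : ℝ) : ℂ) * P y) := by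
    refine W'.hasSum_integral hΩ' hui.norm (fun y => norm_nonneg _) (fun l => ?_) ?_ ?_
    · have := W'.continuous_eta l
      exact (by fun_prop : Continuous fun y => g y * ((W'.eta l y * W.eta i y : ℝ) : ℂ) * P y)
        |>.aestronglyMeasurable
    · intro l y
      have e : g y * ((W'.eta l y * W.eta i y : ℝ) : ℂ) * P y = (W'.eta l y : ℂ) * u y := by
        rw [hu]
        push_cast
        ring
      rw [e, norm_mul, Complex.norm_real, Real.norm_of_nonneg (W'.eta_nonneg l y)]
      exact mul_le_of_le_one_left (norm_nonneg _) (W'.eta_le_one l y)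
    · intro l y hl
      rw [W'.eta_eq_zero hΩ' (by linarith [W'.rad_pos hΩ' l])]
      simp
  -- The margin between 1/16 and 1/8 is used here: an inner ball meeting ball i has depth at most
  -- 33/31 times that of ball i, hence below 1/8, so its correction is active.
  have hterm : ∀ l, ∫ y, W'.corr s g l (W.eta i) y * P y
      = ∫ y, g y * ((W'.eta l y * W.eta i y : ℝ) : ℂ) * P y := by
    intro l
    refine W'.integral_corr_mul_monomial hΩ' hg l hηc ?_ hγ
    by_contra hcon
    push Not at hcon
    obtain ⟨hl, z, hz⟩ := hcon
    have h1 := Metric.mem_closedBall.1 (W'.support_eta_subset hΩ' l (left_ne_zero_of_mul hz))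
    have h2 := Metric.mem_closedBall.1 (W.support_eta_subset hΩ i (right_ne_zero_of_mul hz))
    have h3 := W.thirtyOne_mul_rad_le W' hΩ hΩ' h h1 h2
    unfold rad at h3
    linarith
  have e3 : ∫ y, (∑' l, W'.corr s g l (W.eta i) y) * P y = ∫ y, Ω'.indicator u y := by
    have h1 : ∀ y, (∑' l, W'.corr s g l (W.eta i) y) * P y
        = ∑' l, W'.corr s g l (W.eta i) y * P y := fun y => tsum_mul_right.symm
    simp_rw [h1]
    rw [← s1.tsum_eq]
    simp_rw [hterm]
    rw [s2.tsum_eq]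
    refine integral_congr_ae (Eventually.of_forall fun y => ?_)
    simp only
    have h2 : ∀ l, g y * ((W'.eta l y * W.eta i y : ℝ) : ℂ) * P y = (W'.eta l y : ℂ) * u y := by
      intro l
      rw [hu]
      push_cast
      ring
    have h10 : ∀ l, 10 * W'.rad l < dist y (W'.x l) → (W'.eta l y : ℂ) * u y = 0 := by
      intro l hl
      rw [W'.eta_eq_zero hΩ' (by linarith [W'.rad_pos hΩ' l])]
      simp
    simp_rw [h2]
    rw [W'.tsum_eq_sum_near hΩ' h10, ← Finset.sum_mul, ← Complex.ofReal_sum]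
    by_cases hy : y ∈ Ω'
    · rw [W'.sum_eta hΩ' hy, indicator_of_mem hy, Complex.ofReal_one, one_mul]
      intro l hl
      have := W'.rad_pos hΩ' l
      simp only [Finite.mem_toFinset, mem_ofPred_eq]
      linarith
    · rw [indicator_of_notMem hy]
      rw [Finset.sum_eq_zero]
      · simp
      · intro l _
        refine W'.eta_eq_zero hΩ' ?_
        by_contra hlt
        refine hy (W'.closedBall_subset hΩ' l ?_)
        have := W'.rad_pos hΩ' l
        rw [Metric.mem_closedBall]
        linarith [not_le.1 hlt]
  have e2 : ∫ y, W.corr s g i (fun _ => 1) y * P y = ∫ y, u y := by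
    rw [W.integral_corr_mul_monomial hΩ hg i continuous_const (Or.inl (by linarith)) hγ]
    refine integral_congr_ae (Eventually.of_forall fun y => ?_)
    simp [hu, hP]
  have i2 : Integrable fun y => W.corr s g i (fun _ => 1) y * P y := by
    have h1 : Integrable (W.corr s g i fun _ => 1) := by
      have e : W.corr s g i (fun _ => 1) = proj s (W.x i) (W.rad i)
          (fun z => g z * ((W.eta i z * 1 : ℝ) : ℂ)) := by
        funext y
        rw [corr, if_pos (by linarith)]
      rw [e]
      exact integrable_proj (W.rad_pos hΩ i) _
    refine integrable_mul_continuous h1 (x₀ := W.x i) (R := W.rad i) ?_ hPc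
    intro y hy
    by_contra hlt
    exact hy (W.corr_eq_zero_of_dist hΩ g _ (by simpa using hlt))
  have i3 : Integrable fun y => (∑' l, W'.corr s g l (W.eta i) y) * P y := by
    refine (hGi.const_mul (overlapConst n)).mono' ?_ (Eventually.of_forall fun y => ?_)
    · exact ((W'.measurable_tsum hΩ' (fun l => W'.measurable_corr g l _)
        fun l y hl => W'.corr_eq_zero_of_far_left hΩ' hl).mul hPc.measurable).aestronglyMeasurable
    · rw [norm_mul]
      by_cases hy : y ∈ B
      · rw [hG, indicator_of_mem hy, ← mul_assoc]
        refine mul_le_mul_of_nonneg_right ?_ (norm_nonneg _)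
        exact W'.norm_tsum_le hΩ' (fun l hl => W'.corr_eq_zero_of_far_left hΩ' hl) hK0
          fun l => (hK i l y).trans (le_abs_self K)
      · have h0 : ∀ l, W'.corr s g l (W.eta i) y = 0 := fun l =>
          W.corr_eq_zero_of_far W' hΩ hΩ' h (by simpa [hB] using hy)
        simp only [h0, tsum_zero, norm_zero, zero_mul]
        exact mul_nonneg (by positivity) (hG0 y)
  have e1 : ∀ y, Ω'ᶜ.indicator (fun z => g z * (W.eta i z : ℂ)) y * P y = Ω'ᶜ.indicator u y := by
    intro y
    by_cases hy : y ∈ Ω'ᶜ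
    · rw [indicator_of_mem hy, indicator_of_mem hy]
    · rw [indicator_of_notMem hy, indicator_of_notMem hy, zero_mul]
  have i1 : Integrable fun y => Ω'ᶜ.indicator u y := hui.indicator hΩ'.measurableSet.compl
  have hsplit : ∀ y, W.piece W' s g i y * P y = Ω'ᶜ.indicator u y
      - W.corr s g i (fun _ => 1) y * P y + (∑' l, W'.corr s g l (W.eta i) y) * P y := by
    intro y
    rw [piece, add_mul, sub_mul, e1]
  have i12 : Integrable fun y => Ω'ᶜ.indicator u y - W.corr s g i (fun _ => 1) y * P y :=
    i1.sub i2
  change ∫ y, W.piece W' s g i y * P y = 0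
  simp_rw [hsplit]
  rw [integral_add i12 i3, integral_sub i1 i2, e2, e3, integral_indicator
    hΩ'.measurableSet.compl, integral_indicator hΩ'.measurableSet,
    ← integral_add_compl hΩ'.measurableSet hui]
  ring

end Whitney

end Pieces

/-! ### Dyadic level sets and the telescoping sum over all heights. -/

section Levels

variable {n s : ℕ}

/-- The set where `F` exceeds `2 ^ k`. -/
def level (F : Rn n → ℝ≥0∞) (k : ℤ) : Set (Rn n) := {x | ENNReal.ofReal ((2 : ℝ) ^ k) < F x}

theorem isOpen_level {F : Rn n → ℝ≥0∞} (hF : LowerSemicontinuous F) (k : ℤ) :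
    IsOpen (level F k) := hF.isOpen_preimage _

theorem level_succ_subset (F : Rn n → ℝ≥0∞) (k : ℤ) : level F (k + 1) ⊆ level F k := by
  intro x hx
  refine lt_of_le_of_lt (ENNReal.ofReal_le_ofReal ?_) hx
  exact zpow_le_zpow_right₀ (by norm_num) (by omega)

theorem le_of_notMem_level {F : Rn n → ℝ≥0∞} {k : ℤ} {x : Rn n} (hx : x ∉ level F k) :
    F x ≤ ENNReal.ofReal ((2 : ℝ) ^ k) := not_lt.1 hx

theorem le_of_notMem_level_succ {F : Rn n → ℝ≥0∞} {k : ℤ} {x : Rn n} (hx : x ∉ level F (k + 1)) :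
    F x ≤ ENNReal.ofReal (2 * (2 : ℝ) ^ k) := by
  have := le_of_notMem_level hx
  rwa [zpow_add_one₀ (by norm_num), mul_comm] at this

/-- Summability is assumed, so the sum may be computed along the finite intervals [-m, m), where it
collapses to G(m) - G(-m). -/
theorem tsum_telescope {G : ℤ → ℂ} {a : ℂ} (hs : Summable fun k => G (k + 1) - G k)
    (h1 : Tendsto (fun m : ℕ => G m) atTop (𝓝 a))
    (h2 : Tendsto (fun m : ℕ => G (-(m : ℤ))) atTop (𝓝 0)) :
    ∑' k, (G (k + 1) - G k) = a := by
  let e : ℕ → ℕ ↪ ℤ := fun m => ⟨fun j => (j : ℤ) - m, fun a b h => by simpa using h⟩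
  have he : ∀ m j, e m j = (j : ℤ) - m := fun _ _ => rfl
  let S : ℕ → Finset ℤ := fun m => (Finset.range (2 * m)).map (e m)
  have hmem : ∀ (m : ℕ) (k : ℤ), k ∈ S m ↔ -(m : ℤ) ≤ k ∧ k < m := by
    intro m k
    simp only [S, Finset.mem_map, Finset.mem_range, he]
    constructor
    · rintro ⟨j, hj, rfl⟩
      omega
    · rintro ⟨h1, h2⟩
      exact ⟨(k + m).toNat, by omega, by omega⟩
  have hS : Tendsto S atTop atTop := by
    refine tendsto_atTop_finset_of_monotone (fun a b hab k hk => ?_) fun k => ⟨k.natAbs + 1, ?_⟩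
    · rw [hmem] at hk ⊢
      omega
    · rw [hmem]
      omega
  have h3 : ∀ m : ℕ, ∑ k ∈ S m, (G (k + 1) - G k) = G m - G (-(m : ℤ)) := by
    intro m
    rw [Finset.sum_map]
    have := Finset.sum_range_sub (fun j : ℕ => G ((j : ℤ) - m)) (2 * m)
    simp only [he]
    convert this using 2
    · refine congrArg₂ _ ?_ rfl
      congr 1
      push_cast
      ring
    · congr 1
      push_cast
      ring
    · congr 1
      simp
  have h4 := hs.hasSum.comp hS
  have h5 : Tendsto (fun m : ℕ => ∑ k ∈ S m, (G (k + 1) - G k)) atTop (𝓝 (a - 0)) := by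
    simp_rw [h3]
    exact h1.sub h2
  rw [sub_zero] at h5
  exact tendsto_nhds_unique h4 h5

variable {F : Rn n → ℝ≥0∞}

theorem integrable_test (φ : Test n) : Integrable fun y => (φ y : ℂ) := by
  have h : Integrable (φ : Rn n → ℝ) :=
    φ.contDiff.continuous.integrable_of_hasCompactSupport φ.hasCompactSupport
  exact h.ofReal

theorem hasSum_integral_piece_mul (hF : LowerSemicontinuous F) (W : ∀ k, Whitney (level F k))
    {g : Rn n → ℂ} (hg : Continuous g) {k : ℤ} {K : ℝ}
    (hK : ∀ i y, ‖(W k).piece (W (k + 1)) s g i y‖ ≤ K)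
    (hK1 : ∀ y, ‖(W k).good s g y‖ ≤ K) (hK2 : ∀ y, ‖(W (k + 1)).good s g y‖ ≤ K) (φ : Test n) :
    HasSum (fun i => ∫ y, (W k).piece (W (k + 1)) s g i y * (φ y : ℂ))
      ((∫ y, (W (k + 1)).good s g y * (φ y : ℂ)) - ∫ y, (W k).good s g y * (φ y : ℂ)) := by
  have hΩ := isOpen_level hF k
  have hΩ' := isOpen_level hF (k + 1)
  have hsub := level_succ_subset F k
  have hφ := integrable_test φ
  have hK0 : 0 ≤ K := (norm_nonneg _).trans (hK1 0)
  have h := (W k).hasSum_integral hΩ (v := fun i y => (W k).piece (W (k + 1)) s g i y * (φ y : ℂ))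
    (hφ.norm.const_mul K) (fun y => by positivity)
    (fun i => ((W k).measurable_piece (W (k + 1)) hΩ' hg i).aestronglyMeasurable.mul
      hφ.aestronglyMeasurable)
    (fun i y => by
      rw [norm_mul]
      exact mul_le_mul_of_nonneg_right (hK i y) (norm_nonneg _))
    (fun i y hy => by
      rw [(W k).piece_eq_zero (W (k + 1)) hΩ hΩ' hsub hy, zero_mul])
  convert h using 1
  have hi : ∀ j, (∀ y, ‖(W j).good s g y‖ ≤ K) →
      Integrable fun y => (W j).good s g y * (φ y : ℂ) := by
    intro j hj
    exact hφ.bdd_mul ((W j).measurable_good (isOpen_level hF j) hg).aestronglyMeasurable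
      (Eventually.of_forall hj)
  rw [← integral_sub (hi _ hK2) (hi _ hK1)]
  refine integral_congr_ae (Eventually.of_forall fun y => ?_)
  simp only
  rw [tsum_mul_right, (W k).tsum_piece (W (k + 1)) hΩ hΩ' hsub hg y, sub_mul]

/-- Almost every point lies outside the level set at all large heights, and there the good part
equals `g`. The dominating constant is the supremum of `g` on a slightly larger ball than the
support of φ; it is not uniform in `g`, but here `g` is fixed. -/
theorem tendsto_integral_good_mul (hF : LowerSemicontinuous F) (hfin : ∀ᵐ x, F x ≠ ∞)
    (W : ∀ k, Whitney (level F k)) {g : Rn n → ℂ} (hg : Continuous g) (φ : Test n) :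
    Tendsto (fun m : ℕ => ∫ y, (W m).good s g y * (φ y : ℂ)) atTop
      (𝓝 (∫ y, g y * (φ y : ℂ))) := by
  obtain ⟨R, hR, hsupp⟩ := exists_tsupport_subset_closedBall φ
  obtain ⟨K, hK, hcorr⟩ := Whitney.exists_norm_corr_le_sup n s
  obtain ⟨G, hG⟩ := (isCompact_closedBall (0 : Rn n) (R + 2)).exists_bound_of_continuousOn
    hg.continuousOn
  have hG0 : 0 ≤ G := (norm_nonneg _).trans (hG 0 (by simp; linarith))
  have hφ := integrable_test φ
  set A : ℝ := G + Whitney.overlapConst n * (K * G) with hA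
  refine tendsto_integral_of_dominated_convergence (fun y => A * ‖(φ y : ℂ)‖)
    (fun m => ((W m).measurable_good (isOpen_level hF m) hg).aestronglyMeasurable.mul
      hφ.aestronglyMeasurable) (hφ.norm.const_mul A) ?_ ?_
  · intro m
    refine Eventually.of_forall fun y => ?_
    rw [norm_mul]
    by_cases hy : φ y = 0
    · simp [hy]
    refine mul_le_mul_of_nonneg_right ?_ (norm_nonneg _)
    have hyR : ‖y‖ ≤ R := by simpa using hsupp (subset_tsupport _ hy)
    have hΩ := isOpen_level hF (m : ℤ)
    refine norm_add_le_of_le ?_ ?_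
    · refine (norm_indicator_le_norm_self _ _).trans (hG y ?_)
      rw [mem_closedBall_zero_iff]
      linarith
    · refine (W m).norm_tsum_le hΩ (fun i hi => (W m).corr_eq_zero_of_far_left hΩ hi)
        (by positivity) fun i => ?_
      by_cases hd : dist y ((W m).x i) ≤ (W m).rad i
      · refine hcorr g hΩ (W m) i G hG0 (fun z hz => hG z ?_) y
        rw [Metric.mem_closedBall] at hz
        have h1 := (W m).rad_le i
        have h2 := dist_triangle z ((W m).x i) y
        rw [dist_comm ((W m).x i) y] at h2
        have h3 := dist_triangle z y 0
        rw [dist_zero_right y] at h3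
        rw [Metric.mem_closedBall]
        linarith
      · rw [(W m).corr_eq_zero_of_dist hΩ g _ (not_le.1 hd), norm_zero]
        positivity
  · filter_upwards [hfin] with y hy
    refine Tendsto.congr' ?_ tendsto_const_nhds
    obtain ⟨m₀, hm₀⟩ := pow_unbounded_of_one_lt (F y).toReal (by norm_num : (1 : ℝ) < 2)
    filter_upwards [eventually_ge_atTop m₀] with m hm
    have hΩ := isOpen_level hF (m : ℤ)
    have hnot : y ∉ level F m := by
      intro hmem
      have h1 : (2 : ℝ) ^ m < (F y).toReal := by
        have h2 : ENNReal.ofReal ((2 : ℝ) ^ (m : ℤ)) < F y := hmem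
        rw [zpow_natCast] at h2
        rwa [ENNReal.ofReal_lt_iff_lt_toReal (by positivity) hy] at h2
      have h3 : (2 : ℝ) ^ m₀ ≤ 2 ^ m := pow_le_pow_right₀ (by norm_num) hm
      linarith
    have h0 : ∀ i, (W m).corr s g i (fun _ => 1) y = 0 := by
      intro i
      refine (W m).corr_eq_zero_of_dist hΩ g _ ?_
      by_contra hd
      refine hnot ((W m).closedBall_subset hΩ i ?_)
      have := (W m).rad_pos hΩ i
      rw [Metric.mem_closedBall]
      linarith [not_lt.1 hd]
    rw [Whitney.good, indicator_of_mem (by simpa using hnot)]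
    simp [h0]

/-- The low end of the telescoping sum: good parts at height 2^{-m} are uniformly of that size. -/
theorem tendsto_integral_good_mul_neg {W : ∀ k, Whitney (level F k)} {g : Rn n → ℂ} {K : ℝ}
    (hK : ∀ k y, ‖(W k).good s g y‖ ≤ K * (2 : ℝ) ^ k) (φ : Test n) :
    Tendsto (fun m : ℕ => ∫ y, (W (-(m : ℤ))).good s g y * (φ y : ℂ)) atTop (𝓝 0) := by
  have hφ := integrable_test φ
  have h1 : Tendsto (fun m : ℕ => K * (1 / 2 : ℝ) ^ m * ∫ y, ‖(φ y : ℂ)‖) atTop (𝓝 0) := by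
    have := (tendsto_pow_atTop_nhds_zero_of_lt_one (by norm_num : (0 : ℝ) ≤ 1 / 2)
      (by norm_num)).const_mul K
    simpa using this.mul_const (∫ y, ‖(φ y : ℂ)‖)
  refine squeeze_zero_norm (fun m => ?_) h1
  rw [← integral_const_mul]
  refine norm_integral_le_of_norm_le (hφ.norm.const_mul _) (Eventually.of_forall fun y => ?_)
  rw [norm_mul]
  refine mul_le_mul_of_nonneg_right ((hK _ y).trans (le_of_eq ?_)) (norm_nonneg _)
  rw [zpow_neg, zpow_natCast, one_div, inv_pow]

/-- The Calderón–Zygmund decomposition of a controlled function into bounded pieces. -/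
theorem exists_pieces (n s N : ℕ) {C₀ : ℝ} (hC₀ : 0 ≤ C₀) : ∃ K : ℝ, 0 < K ∧
    ∀ {F : Rn n → ℝ≥0∞} (_ : LowerSemicontinuous F) (_ : ∀ᵐ x, F x ≠ ∞)
      (W : ∀ k, Whitney (level F k)) {g : Rn n → ℂ} (_ : Controlled N F C₀ g),
    ∃ h : (Σ k : ℤ, (W k).A) → Rn n → ℂ,
      (∀ j, Measurable (h j)) ∧ (∀ j y, ‖h j y‖ ≤ K * (2 : ℝ) ^ j.1) ∧
      (∀ j y, 10 * (W j.1).rad j.2 < dist y ((W j.1).x j.2) → h j y = 0) ∧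
      (∀ j, depth (level F j.1) ((W j.1).x j.2) < 1 / 16 → ∀ γ : Fin n → ℕ, (∀ i, γ i ≤ s) →
        ∫ y, h j y * ∏ i, ((y i : ℝ) : ℂ) ^ γ i = 0) ∧
      ∀ φ : Test n, (Summable fun j => ∫ y, h j y * (φ y : ℂ)) →
        ∑' j, ∫ y, h j y * (φ y : ℂ) = ∫ y, g y * (φ y : ℂ) := by
  obtain ⟨K, hK, hb⟩ := Whitney.exists_norm_piece_le n s N hC₀
  refine ⟨K + 1, by positivity, ?_⟩
  intro F hF hfin W g hg
  have hbk := fun k : ℤ => hb hg (isOpen_level hF k) (isOpen_level hF (k + 1))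
    (level_succ_subset F k) (W k) (W (k + 1)) ((2 : ℝ) ^ k) (by positivity)
    (fun z hz => le_of_notMem_level hz) (fun z hz => le_of_notMem_level_succ hz)
  refine ⟨fun j => (W j.1).piece (W (j.1 + 1)) s g j.2, ?_, ?_, ?_, ?_, ?_⟩
  · exact fun j => (W j.1).measurable_piece _ (isOpen_level hF _) hg.continuous j.2
  · intro j y
    refine ((hbk j.1).1 j.2 y).trans ?_
    gcongr
    linarith
  · intro j y hy
    exact (W j.1).piece_eq_zero _ (isOpen_level hF _) (isOpen_level hF _)
      (level_succ_subset F j.1) hy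
  · intro j hj γ hγ
    exact (W j.1).integral_piece_mul_monomial _ (isOpen_level hF _) (isOpen_level hF _)
      (level_succ_subset F j.1) hg.continuous (hbk j.1).2.2 hj hγ
  · intro φ hsum
    set G : ℤ → ℂ := fun k => ∫ y, (W k).good s g y * (φ y : ℂ) with hG
    have hk : ∀ k, HasSum (fun i => ∫ y, (W k).piece (W (k + 1)) s g i y * (φ y : ℂ))
        (G (k + 1) - G k) := by
      intro k
      refine hasSum_integral_piece_mul hF W hg.continuous
        (K := K * (2 : ℝ) ^ k + K * (2 : ℝ) ^ (k + 1)) ?_ ?_ ?_ φ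
      · exact fun i y => ((hbk k).1 i y).trans (le_add_of_nonneg_right (by positivity))
      · exact fun y => ((hbk k).2.1 y).trans (le_add_of_nonneg_right (by positivity))
      · exact fun y => ((hbk (k + 1)).2.1 y).trans (le_add_of_nonneg_left (by positivity))
    have h1 : HasSum (fun k => G (k + 1) - G k)
        (∑' j : (Σ k : ℤ, (W k).A), ∫ y, (W j.1).piece (W (j.1 + 1)) s g j.2 y * (φ y : ℂ)) :=
      hsum.hasSum.sigma hk
    rw [← h1.tsum_eq]
    exact tsum_telescope h1.summable (tendsto_integral_good_mul hF hfin W hg.continuous φ)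
      (tendsto_integral_good_mul_neg (fun k y => (hbk k).2.1 y) φ)

end Levels

/-! ### Weak limits along an ultrafilter, and a dominating bound for the pairings. -/

section WeakLimits

variable {n s : ℕ}

/-- Weak compactness of the unit ball of a Hilbert space, along an ultrafilter. -/
theorem exists_weak_limit_inner {H : Type*} [NormedAddCommGroup H] [InnerProductSpace ℂ H]
    [CompleteSpace H] (U : Ultrafilter ℕ) {v : ℕ → H} {r : ℝ} (hv : ∀ m, ‖v m‖ ≤ r) :
    ∃ x : H, ∀ u : H, Tendsto (fun m => inner ℂ (v m) u) U (𝓝 (inner ℂ x u)) := by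
  let T : ℕ → WeakDual ℂ H := fun m => StrongDual.toWeakDual (InnerProductSpace.toDual ℂ H (v m))
  have hK := WeakDual.isCompact_closedBall (𝕜 := ℂ) (E := H) 0 r
  have hmem : ∀ m, T m ∈ WeakDual.toStrongDual ⁻¹' Metric.closedBall (0 : StrongDual ℂ H) r := by
    intro m
    change InnerProductSpace.toDual ℂ H (v m) ∈ Metric.closedBall (0 : StrongDual ℂ H) r
    rw [mem_closedBall_zero_iff, LinearIsometryEquiv.norm_map]
    exact hv m
  -- Banach–Alaoglu: an ultrafilter on a weak-* compact set converges, without passing to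
  -- subsequences and without separability.
  obtain ⟨l, -, hl⟩ := hK.ultrafilter_le_nhds (U.map T)
    (tendsto_principal.2 (Eventually.of_forall hmem) : Tendsto T U _)
  refine ⟨(InnerProductSpace.toDual ℂ H).symm (WeakDual.toStrongDual l), fun u => ?_⟩
  have h1 : Tendsto T U (𝓝 l) := hl
  have h2 := ((WeakDual.eval_continuous u).tendsto l).comp h1
  have e : inner ℂ ((InnerProductSpace.toDual ℂ H).symm (WeakDual.toStrongDual l)) u = l u := by
    rw [InnerProductSpace.toDual_symm_apply]
    rfl
  rw [e]
  refine h2.congr fun m => ?_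
  simp [T]

theorem memLp_two_of_bound {ν : Measure (Rn n)} [IsFiniteMeasure ν] {u : Rn n → ℂ}
    (hu : AEStronglyMeasurable u ν) {M : ℝ} (hM : ∀ᵐ y ∂ν, ‖u y‖ ≤ M) : MemLp u 2 ν :=
  MemLp.of_bound hu M hM

/-- Bounded functions supported in a fixed ball converge weakly along an ultrafilter. -/
theorem exists_weak_limit (U : Ultrafilter ℕ) {v : ℕ → Rn n → ℂ} (hm : ∀ m, Measurable (v m))
    {M : ℝ} (hM : ∀ m y, ‖v m y‖ ≤ M) {c : Rn n} {R : ℝ}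
    (hs : ∀ m y, R < dist y c → v m y = 0) :
    ∃ h : Rn n → ℂ, AEStronglyMeasurable h volume ∧ (∀ᵐ y, ‖h y‖ ≤ M) ∧
      (∀ y, R < dist y c → h y = 0) ∧
      ∀ ψ : Rn n → ℂ, Continuous ψ →
        Tendsto (fun m => ∫ y, v m y * ψ y) U (𝓝 (∫ y, h y * ψ y)) := by
  set B := Metric.closedBall c R with hB
  have hBm : MeasurableSet B := Metric.isClosed_closedBall.measurableSet
  set ν : Measure (Rn n) := volume.restrict B with hν
  have hfin : IsFiniteMeasure ν := ⟨by
    rw [hν, Measure.restrict_apply_univ]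
    exact measure_closedBall_lt_top⟩
  have hM0 : 0 ≤ M := (norm_nonneg _).trans (hM 0 0)
  -- The inner product is conjugate-linear in its first argument. Using the conjugates makes it the
  -- bilinear pairing ∫ v ψ.
  have hmem : ∀ m, MemLp (fun y => (starRingEnd ℂ) (v m y)) 2 ν := fun m =>
    memLp_two_of_bound (Complex.continuous_conj.measurable.comp (hm m)).aestronglyMeasurable
      (Eventually.of_forall fun y => by rw [RCLike.norm_conj]; exact hM m y)
  have hbd : ∀ m, ‖(hmem m).toLp _‖ ≤ (ν univ ^ ((2 : ℝ≥0∞).toReal)⁻¹ * ENNReal.ofReal M).toReal := by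
    intro m
    rw [Lp.norm_toLp]
    refine ENNReal.toReal_mono ?_ (eLpNorm_le_of_ae_bound (Eventually.of_forall fun y => ?_))
    · exact ENNReal.mul_ne_top (ENNReal.rpow_ne_top_of_nonneg (by positivity) (measure_ne_top _ _))
        ENNReal.ofReal_ne_top
    · rw [RCLike.norm_conj]
      exact hM m y
  obtain ⟨x, hx⟩ := exists_weak_limit_inner U hbd
  set h : Rn n → ℂ := B.indicator fun y => (starRingEnd ℂ) (x y) with hh
  have hxm : AEStronglyMeasurable (x : Rn n → ℂ) ν := Lp.aestronglyMeasurable x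
  have hhm : AEStronglyMeasurable h volume := by
    refine (aestronglyMeasurable_indicator_iff hBm).2 ?_
    exact Complex.continuous_conj.comp_aestronglyMeasurable hxm
  have conv : ∀ ψ : Rn n → ℂ, MemLp ψ 2 ν →
      Tendsto (fun m => ∫ y, v m y * ψ y) U (𝓝 (∫ y, h y * ψ y)) := by
    intro ψ hψ
    have h1 := hx (hψ.toLp ψ)
    have e1 : ∀ m, inner ℂ ((hmem m).toLp _) (hψ.toLp ψ) = ∫ y, v m y * ψ y := by
      intro m
      rw [L2.inner_def]
      have h2 : ∫ y, v m y * ψ y = ∫ y, v m y * ψ y ∂ν := by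
        rw [hν, setIntegral_eq_integral_of_forall_compl_eq_zero]
        intro y hy
        rw [hs m y (by simpa [hB] using hy), zero_mul]
      rw [h2]
      refine integral_congr_ae ?_
      filter_upwards [(hmem m).coeFn_toLp, hψ.coeFn_toLp] with y hy1 hy2
      rw [hy1, hy2, RCLike.inner_apply]
      simp [mul_comm]
    have e2 : inner ℂ x (hψ.toLp ψ) = ∫ y, h y * ψ y := by
      rw [L2.inner_def]
      have h2 : ∫ y, h y * ψ y = ∫ y, h y * ψ y ∂ν := by
        rw [hν, setIntegral_eq_integral_of_forall_compl_eq_zero]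
        intro y hy
        rw [hh, indicator_of_notMem hy, zero_mul]
      rw [h2]
      refine integral_congr_ae ?_
      filter_upwards [hψ.coeFn_toLp, ae_restrict_mem hBm] with y hy1 hy2
      rw [hy1, RCLike.inner_apply, hh, indicator_of_mem hy2, mul_comm]
    rw [e2] at h1
    exact h1.congr e1
  have hh2 : MemLp h 2 ν := by
    have : MemLp (fun y => (starRingEnd ℂ) (x y)) 2 ν := (Lp.memLp x).star
    refine (memLp_congr_ae ?_).2 this
    filter_upwards [ae_restrict_mem hBm] with y hy
    rw [hh, indicator_of_mem hy]
  have hhint : Integrable h volume := by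
    have h1 : IntegrableOn h B := hh2.integrable (by norm_num)
    refine (integrableOn_iff_integrable_of_support_subset ?_).1 h1
    exact support_indicator_subset
  refine ⟨h, hhm, ?_, ?_, fun ψ hψ => conv ψ ?_⟩
  · obtain ⟨h', hh'm, hh'⟩ := hhm
    set E := {y | M < ‖h' y‖} ∩ B with hE
    have hEm : MeasurableSet E :=
      (measurableSet_lt measurable_const hh'm.norm.measurable).inter hBm
    -- The sup bound survives the weak limit: test against the conjugate phase of the limit on the
    -- set E where its modulus exceeds M. This gives ∫_E |h| ≤ M|E|, so E is null.
    set u : Rn n → ℂ := E.indicator fun y => (starRingEnd ℂ) (h' y) / (‖h' y‖ : ℂ) with hu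
    have hu1 : ∀ y, ‖u y‖ ≤ 1 := by
      intro y
      by_cases hy : y ∈ E
      · rw [hu, indicator_of_mem hy, norm_div, RCLike.norm_conj, Complex.norm_real,
          norm_norm]
        exact div_self_le_one _
      · rw [hu, indicator_of_notMem hy, norm_zero]
        exact zero_le_one
    have hum : Measurable u := by
      refine Measurable.indicator ?_ hEm
      exact (Complex.continuous_conj.measurable.comp hh'm.measurable).div
        (Complex.measurable_ofReal.comp hh'm.norm.measurable)
    have hlim := conv u (memLp_two_of_bound hum.aestronglyMeasurable (Eventually.of_forall hu1))
    have hEfin : volume E ≠ ∞ :=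
      ((measure_mono inter_subset_right).trans_lt measure_closedBall_lt_top).ne
    have hle : ‖∫ y, h y * u y‖ ≤ M * volume.real E := by
      refine le_of_tendsto hlim.norm (Eventually.of_forall fun m => ?_)
      rw [← setIntegral_eq_integral_of_forall_compl_eq_zero (s := E)]
      · refine norm_setIntegral_le_of_norm_le_const hEfin.lt_top fun y _ => ?_
        rw [norm_mul]
        calc ‖v m y‖ * ‖u y‖ ≤ M * 1 := mul_le_mul (hM m y) (hu1 y) (norm_nonneg _) hM0
          _ = M := mul_one M
      · intro y hy
        rw [hu, indicator_of_notMem hy, mul_zero]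
    have hh'int : Integrable h' := hhint.congr hh'
    have heq : ∫ y, h y * u y = ((∫ y in E, ‖h' y‖ : ℝ) : ℂ) := by
      rw [← integral_complex_ofReal, ← integral_indicator hEm]
      refine integral_congr_ae ?_
      filter_upwards [hh'] with y hy
      by_cases hyE : y ∈ E
      · rw [hu, indicator_of_mem hyE, indicator_of_mem hyE, hy]
        have hne : (‖h' y‖ : ℂ) ≠ 0 := by
          have : M < ‖h' y‖ := hyE.1
          exact_mod_cast (hM0.trans_lt this).ne'
        rw [mul_div_assoc', Complex.mul_conj, Complex.normSq_eq_norm_sq]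
        push_cast
        field_simp
      · rw [hu, indicator_of_notMem hyE, indicator_of_notMem hyE, mul_zero]
    rw [heq, Complex.norm_real, Real.norm_of_nonneg (integral_nonneg fun _ => norm_nonneg _)] at hle
    have hzero : ∫ y in E, (‖h' y‖ - M) = 0 := by
      refine le_antisymm ?_ (setIntegral_nonneg hEm fun y hy => by
        have : M < ‖h' y‖ := hy.1
        linarith)
      rw [integral_sub hh'int.norm.integrableOn (integrableOn_const hEfin), setIntegral_const,
        smul_eq_mul]
      linarith
    rw [setIntegral_eq_zero_iff_of_nonneg_ae] at hzero
    · have h3 : ∀ᵐ y, y ∈ E → ‖h' y‖ - M = 0 := (ae_restrict_iff' hEm).1 hzero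
      filter_upwards [h3, hh'] with y hy1 hy2
      by_cases hyE : y ∈ E
      · have := hy1 hyE
        rw [hy2]
        linarith
      · by_cases hyB : y ∈ B
        · rw [hy2]
          by_contra hlt
          exact hyE ⟨not_le.1 hlt, hyB⟩
        · rw [hh, indicator_of_notMem hyB, norm_zero]
          exact hM0
    · filter_upwards [ae_restrict_mem hEm] with y hy
      have : M < ‖h' y‖ := hy.1
      simp only [Pi.zero_apply]
      linarith
    · exact hh'int.norm.integrableOn.sub (integrableOn_const hEfin)
  · intro y hy
    exact indicator_of_notMem (by simpa [hB] using hy) _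
  · obtain ⟨A, hA⟩ := (isCompact_closedBall c R).exists_bound_of_continuousOn hψ.continuousOn
    refine memLp_two_of_bound hψ.aestronglyMeasurable (M := A) ?_
    filter_upwards [ae_restrict_mem hBm] with y hy using hA y hy

/-- The pairing of a bounded function with a test function is controlled by the measure of
its support. -/
theorem BallWeight.exists_norm_integral_mul_le {r : ℝ} {μ : Measure (Rn n)} (hμ : BallWeight r μ)
    (hr : 0 < r) {p : ℝ} (hp : 0 < p) (hnr : n * r ≤ p * (n + s + 1 : ℕ)) (φ : Test n) :
    ∃ C : ℝ, 0 ≤ C ∧ ∀ (h : Rn n → ℂ) (c : Rn n) (ρ M : ℝ), AEStronglyMeasurable h volume →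
      0 ≤ M → (∀ y, ‖h y‖ ≤ M) → 0 < ρ → ρ ≤ 1 / 256 → (∀ y, 10 * ρ < dist y c → h y = 0) →
      (ρ < 1 / 512 → ∀ γ : Fin n → ℕ, ∑ i, γ i ≤ s →
        ∫ y, h y * ∏ i, ((y i : ℝ) : ℂ) ^ γ i = 0) →
      ‖∫ y, h y * (φ y : ℂ)‖ ≤ C * M * μ.real (cube c (512 * ρ)) ^ (1 / p) := by
  obtain ⟨R, hR, hsupp⟩ := exists_tsupport_subset_closedBall φ
  obtain ⟨D, hD, hDb⟩ := exists_deriv_bound φ (s + 1)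
  have hφ := integrable_test φ
  set L : ℝ := R + 2 with hL
  have hLpos : 0 < L := by positivity
  obtain ⟨C₁, hC₁, hdb⟩ := hμ.doubling hr hLpos
  set v := volume.real (Metric.ball (0 : Rn n) 1) with hv
  set θ : ℝ := n * r / p with hθ
  have hθ0 : 0 ≤ θ := by positivity
  have hθ1 : θ ≤ (n + s + 1 : ℕ) := by
    rw [hθ, div_le_iff₀ hp]
    linarith
  set A : ℝ := D * 10 ^ (s + 1) * (10 ^ n * v) + 512 ^ θ * ∫ y, ‖(φ y : ℂ)‖ with hA
  have hI0 : 0 ≤ ∫ y, ‖(φ y : ℂ)‖ := integral_nonneg fun _ => norm_nonneg _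
  have hA0 : 0 ≤ A := by positivity
  set m₀ := μ.real (Metric.closedBall (0 : Rn n) L) with hm₀
  have hm₀pos : 0 < m₀ := ENNReal.toReal_pos (hμ.measure_closedBall_pos 0 hLpos).ne'
    (hμ.measure_closedBall_lt_top 0 L).ne
  set E : ℝ := C₁.toReal * L ^ (n * r) / m₀ with hE
  have hE0 : 0 ≤ E := by positivity
  refine ⟨A * E ^ (1 / p), by positivity, ?_⟩
  intro h c ρ M hm hM0 hM hρ hρ1 hs hmom
  by_cases hz : ∫ y, h y * (φ y : ℂ) = 0
  · rw [hz, norm_zero]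
    positivity
  have hsB : Function.support h ⊆ Metric.closedBall c (10 * ρ) := by
    intro y hy
    by_contra hlt
    exact hy (hs y (by simpa using hlt))
  have hball : Metric.closedBall c ρ ⊆ Metric.closedBall 0 L := by
    have hex : ∃ y, h y * (φ y : ℂ) ≠ 0 := by
      by_contra hcon
      push Not at hcon
      exact hz (by simp [hcon])
    obtain ⟨y, hy⟩ := hex
    have h1 := Metric.mem_closedBall.1 (hsB (left_ne_zero_of_mul hy))
    have h2 : φ y ≠ 0 := by
      have := right_ne_zero_of_mul hy
      exact_mod_cast this
    have h3 := Metric.mem_closedBall.1 (hsupp (subset_tsupport _ h2))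
    refine Metric.closedBall_subset_closedBall' ?_
    have h4 := dist_triangle c y 0
    rw [dist_comm c y] at h4
    linarith
  have hint : Integrable h := by
    refine (integrableOn_iff_integrable_of_support_subset hsB).1 ?_
    exact Measure.integrableOn_of_bounded MeasureTheory.measure_closedBall_lt_top.ne hm (Eventually.of_forall hM)
  have hL1 : ∫ y, ‖h y‖ ≤ M * ((10 * ρ) ^ n * v) := by
    rw [← setIntegral_eq_integral_of_forall_compl_eq_zero (s := Metric.closedBall c (10 * ρ))]
    · have h1 := norm_setIntegral_le_of_norm_le_const (f := fun y => ‖h y‖) (C := M)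
        (μ := volume) (s := Metric.closedBall c (10 * ρ)) MeasureTheory.measure_closedBall_lt_top
        (fun y _ => by rw [norm_norm]; exact hM y)
      rw [volume_closedBall_eq c (by positivity)] at h1
      exact (le_abs_self _).trans h1
    · intro y hy
      rw [hs y (by simpa using hy), norm_zero]
  -- For small radii the moments gain ρ^{n+s+1}, at most ρ^θ because θ = nr/p ≤ n + s + 1 and ρ < 1.
  -- For radii at least 1/512 the trivial bound suffices, since ρ^θ is then bounded below.
  have hbound : ‖∫ y, h y * (φ y : ℂ)‖ ≤ A * M * ρ ^ θ := by
    rcases lt_or_ge ρ (1 / 512) with hlt | hge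
    · have h1 := norm_integral_mul_le_of_moments hint hsB (hmom hlt) φ.contDiff
        (fun x => hDb (s + 1) le_rfl x)
      calc ‖∫ y, h y * (φ y : ℂ)‖ ≤ D * (10 * ρ) ^ (s + 1) * (M * ((10 * ρ) ^ n * v)) :=
            h1.trans (mul_le_mul_of_nonneg_left hL1 (by positivity))
        _ = D * 10 ^ (s + 1) * (10 ^ n * v) * M * ρ ^ (n + s + 1) := by
            rw [mul_pow, mul_pow, add_assoc, pow_add ρ n]
            ring
        _ ≤ A * M * ρ ^ θ := by
            have h2 : ρ ^ (n + s + 1) ≤ ρ ^ θ := by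
              rw [← Real.rpow_natCast]
              exact Real.rpow_le_rpow_of_exponent_ge hρ (by linarith) hθ1
            have h3 : D * 10 ^ (s + 1) * (10 ^ n * v) ≤ A := by
              rw [hA]
              exact le_add_of_nonneg_right (by positivity)
            gcongr
    · have h1 : ‖∫ y, h y * (φ y : ℂ)‖ ≤ M * ∫ y, ‖(φ y : ℂ)‖ := by
        rw [← integral_const_mul]
        refine norm_integral_le_of_norm_le (hφ.norm.const_mul _) (Eventually.of_forall fun y => ?_)
        rw [norm_mul]
        exact mul_le_mul_of_nonneg_right (hM y) (norm_nonneg _)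
      have h2 : 1 ≤ 512 ^ θ * ρ ^ θ := by
        rw [← Real.mul_rpow (by norm_num) hρ.le]
        exact Real.one_le_rpow (by linarith) hθ0
      calc ‖∫ y, h y * (φ y : ℂ)‖ ≤ M * (∫ y, ‖(φ y : ℂ)‖) * 1 := by rwa [mul_one]
        _ ≤ M * (∫ y, ‖(φ y : ℂ)‖) * (512 ^ θ * ρ ^ θ) := by gcongr
        _ = 512 ^ θ * (∫ y, ‖(φ y : ℂ)‖) * M * ρ ^ θ := by ring
        _ ≤ A * M * ρ ^ θ := by
            have h3 : 512 ^ θ * (∫ y, ‖(φ y : ℂ)‖) ≤ A := by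
              rw [hA]
              exact le_add_of_nonneg_left (by positivity)
            gcongr
  -- Doubling between the ball of radius ρ and a fixed ball about the origin. The latter contains
  -- the former because h must meet the support of φ for the pairing to be nonzero.
  have hmeas : ρ ^ (n * r) ≤ E * μ.real (cube c (512 * ρ)) := by
    have h1 := hdb 0 c L ρ hLpos le_rfl hρ hball
    have h2 := ENNReal.toReal_mono (ENNReal.mul_ne_top (ENNReal.mul_ne_top hC₁
      ENNReal.ofReal_ne_top) (hμ.measure_closedBall_lt_top c ρ).ne) h1
    rw [ENNReal.toReal_mul, ENNReal.toReal_mul, ENNReal.toReal_ofReal (by positivity)] at h2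
    have h3 : (μ (Metric.closedBall c ρ)).toReal ≤ μ.real (cube c (512 * ρ)) := by
      refine ENNReal.toReal_mono (hμ.lt_top _ (isBounded_cube _ _)).ne (measure_mono ?_)
      refine (closedBall_subset_cube c ρ).trans fun y hy i => (hy i).trans ?_
      linarith
    have h4 : m₀ ≤ C₁.toReal * (L / ρ) ^ (n * r) * μ.real (cube c (512 * ρ)) :=
      h2.trans (mul_le_mul_of_nonneg_left h3 (by positivity))
    rw [Real.div_rpow hLpos.le hρ.le] at h4
    rw [hE, div_mul_eq_mul_div, le_div_iff₀ hm₀pos]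
    have h5 : 0 < ρ ^ (n * r) := by positivity
    calc ρ ^ (n * r) * m₀ ≤ ρ ^ (n * r) * (C₁.toReal * (L ^ (n * r) / ρ ^ (n * r))
          * μ.real (cube c (512 * ρ))) := by gcongr
      _ = _ := by
          field_simp
  have hfinal : ρ ^ θ ≤ E ^ (1 / p) * μ.real (cube c (512 * ρ)) ^ (1 / p) := by
    rw [← Real.mul_rpow hE0 measureReal_nonneg, hθ, div_eq_mul_one_div, Real.rpow_mul hρ.le]
    exact Real.rpow_le_rpow (by positivity) hmeas (by positivity)
  calc ‖∫ y, h y * (φ y : ℂ)‖ ≤ A * M * ρ ^ θ := hbound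
    _ ≤ A * M * (E ^ (1 / p) * μ.real (cube c (512 * ρ)) ^ (1 / p)) := by gcongr
    _ = _ := by ring

end WeakLimits

/-! ### Summability of the coefficients and assembly of atomic decompositions. -/

section Decomposition

variable {n s : ℕ}

/-- Only exponents up to the largest power of two below t contribute, and downwards from there the
series is geometric with ratio 2^{-p}. -/
theorem tsum_dyadic_lt_le {p : ℝ} (hp : 0 < p) (t : ℝ≥0∞) :
    (∑' k : ℤ, if ENNReal.ofReal ((2 : ℝ) ^ k) < t then ENNReal.ofReal (((2 : ℝ) ^ k) ^ p) else 0)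
      ≤ (1 - ENNReal.ofReal ((2 : ℝ) ^ (-p)))⁻¹ * t ^ p := by
  rcases eq_or_ne t ∞ with rfl | ht
  · rw [ENNReal.top_rpow_of_pos hp, ENNReal.mul_top]
    · exact le_top
    · exact ENNReal.inv_ne_zero.2 (ne_top_of_le_ne_top ENNReal.one_ne_top tsub_le_self)
  rcases eq_or_ne t 0 with rfl | ht0
  · simp
  have hτ : 0 < t.toReal := ENNReal.toReal_pos ht0 ht
  obtain ⟨m, hm1, hm2⟩ := exists_mem_Ioc_zpow hτ (one_lt_two : (1 : ℝ) < 2)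
  have hinj : Function.Injective fun i : ℕ => m - (i : ℤ) := fun i j hij => by
    simpa using hij
  have key : ∀ k : ℤ, ENNReal.ofReal ((2 : ℝ) ^ k) < t → k ≤ m := by
    intro k hk
    rw [ENNReal.ofReal_lt_iff_lt_toReal (by positivity) ht] at hk
    have := (zpow_lt_zpow_iff_right₀ (one_lt_two : (1 : ℝ) < 2)).1 (hk.trans_le hm2)
    omega
  rw [← hinj.tsum_eq]
  · calc (∑' i : ℕ, if ENNReal.ofReal ((2 : ℝ) ^ (m - (i : ℤ))) < t then
          ENNReal.ofReal (((2 : ℝ) ^ (m - (i : ℤ))) ^ p) else 0)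
        ≤ ∑' i : ℕ, ENNReal.ofReal (((2 : ℝ) ^ m) ^ p) * ENNReal.ofReal ((2 : ℝ) ^ (-p)) ^ i := by
          refine ENNReal.tsum_le_tsum fun i => ?_
          have e : ENNReal.ofReal (((2 : ℝ) ^ (m - (i : ℤ))) ^ p)
              = ENNReal.ofReal (((2 : ℝ) ^ m) ^ p) * ENNReal.ofReal ((2 : ℝ) ^ (-p)) ^ i := by
            rw [← ENNReal.ofReal_pow (by positivity), ← ENNReal.ofReal_mul (by positivity)]
            congr 1
            rw [← Real.rpow_intCast, ← Real.rpow_intCast, ← Real.rpow_natCast,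
              ← Real.rpow_mul (by norm_num), ← Real.rpow_mul (by norm_num),
              ← Real.rpow_mul (by norm_num), ← Real.rpow_add (by norm_num)]
            congr 1
            push_cast
            ring
          split_ifs
          · exact e.le
          · exact zero_le
      _ = (1 - ENNReal.ofReal ((2 : ℝ) ^ (-p)))⁻¹ * ENNReal.ofReal (((2 : ℝ) ^ m) ^ p) := by
          rw [ENNReal.tsum_mul_left, ENNReal.tsum_geometric, mul_comm]
      _ ≤ _ := by
          gcongr
          rw [← ENNReal.ofReal_rpow_of_pos (by positivity)]
          refine ENNReal.rpow_le_rpow ?_ hp.le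
          exact ENNReal.ofReal_le_of_le_toReal hm1.le
  · intro k hk
    have : ENNReal.ofReal ((2 : ℝ) ^ k) < t := by
      by_contra hc
      simp [hc] at hk
    exact ⟨(m - k).toNat, by have := key k this; simp only; omega⟩

theorem dyadic_const_ne_top {p : ℝ} (hp : 0 < p) :
    (1 - ENNReal.ofReal ((2 : ℝ) ^ (-p)))⁻¹ ≠ ∞ := by
  rw [ENNReal.inv_ne_top]
  refine (tsub_pos_of_lt ?_).ne'
  rw [← ENNReal.ofReal_one]
  exact (ENNReal.ofReal_lt_ofReal_iff one_pos).2
    (Real.rpow_lt_one_of_one_lt_of_neg one_lt_two (by linarith))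

theorem tsum_measure_level_le {p : ℝ} (hp : 0 < p) {F : Rn n → ℝ≥0∞} (hF : LowerSemicontinuous F)
    (μ : Measure (Rn n)) :
    ∑' k : ℤ, ENNReal.ofReal (((2 : ℝ) ^ k) ^ p) * μ (level F k)
      ≤ (1 - ENNReal.ofReal ((2 : ℝ) ^ (-p)))⁻¹ * ∫⁻ x, F x ^ p ∂μ := by
  calc ∑' k : ℤ, ENNReal.ofReal (((2 : ℝ) ^ k) ^ p) * μ (level F k)
      = ∑' k : ℤ, ∫⁻ x, (level F k).indicator (fun _ => ENNReal.ofReal (((2 : ℝ) ^ k) ^ p)) x ∂μ := by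
        congr 1 with k
        rw [lintegral_indicator_const (isOpen_level hF k).measurableSet]
    _ = ∫⁻ x, ∑' k : ℤ, (level F k).indicator (fun _ => ENNReal.ofReal (((2 : ℝ) ^ k) ^ p)) x ∂μ := by
        rw [lintegral_tsum]
        exact fun k => (measurable_const.indicator (isOpen_level hF k).measurableSet).aemeasurable
    _ ≤ ∫⁻ x, (1 - ENNReal.ofReal ((2 : ℝ) ^ (-p)))⁻¹ * F x ^ p ∂μ := by
        refine lintegral_mono fun x => le_trans (le_of_eq ?_) (tsum_dyadic_lt_le hp (F x))
        congr 1 with k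
        simp only [indicator_apply, level, mem_ofPred_eq]
    _ = _ := lintegral_const_mul' _ _ (dyadic_const_ne_top hp)

/-- Each cube is contained in a fixed multiple of a ball of a tenth of the Whitney radius. By
doubling its measure is comparable to that of this ball, and these small balls are disjoint within
one level set. Summing over the levels gives the integral of F^p. -/
theorem BallWeight.exists_tsum_cube_le {r : ℝ} {μ : Measure (Rn n)} (hμ : BallWeight r μ)
    (hr : 0 < r) {p : ℝ} (hp : 0 < p) :
    ∃ C : ℝ≥0∞, C ≠ ∞ ∧ ∀ {F : Rn n → ℝ≥0∞} (_ : LowerSemicontinuous F)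
      (W : ∀ k, Whitney (level F k)),
      ∑' j : Σ k : ℤ, (W k).A, ENNReal.ofReal (((2 : ℝ) ^ j.1) ^ p) *
        μ (cube ((W j.1).x j.2) (512 * (W j.1).rad j.2)) ≤ C * ∫⁻ x, F x ^ p ∂μ := by
  set b : ℝ := √n * 512 / 2 + 1 with hb
  have hbpos : 0 < b := by positivity
  obtain ⟨C, hC, hd⟩ := hμ.doubling_const hr hbpos (10 * b)
  refine ⟨C * (1 - ENNReal.ofReal ((2 : ℝ) ^ (-p)))⁻¹,
    ENNReal.mul_ne_top hC (dyadic_const_ne_top hp), ?_⟩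
  intro F hF W
  rw [ENNReal.tsum_sigma']
  calc _ ≤ ∑' k : ℤ, C * (ENNReal.ofReal (((2 : ℝ) ^ k) ^ p) * μ (level F k)) := by
        refine ENNReal.tsum_le_tsum fun k => ?_
        simp only
        rw [ENNReal.tsum_mul_left, mul_left_comm]
        gcongr
        calc _ ≤ ∑' i, C * μ (Metric.closedBall ((W k).x i) ((W k).rad i / 10)) := by
              refine ENNReal.tsum_le_tsum fun i => ?_
              have hρ := (W k).rad_pos (isOpen_level hF k) i
              have hρ' := (W k).rad_le i
              set ρ := (W k).rad i
              refine le_trans (measure_mono ?_) (hd ((W k).x i) ((W k).x i) (b * ρ) (ρ / 10)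
                (by positivity) ?_ (by positivity) (by linarith) ?_)
              · refine (cube_subset_closedBall _ (by positivity)).trans ?_
                refine Metric.closedBall_subset_closedBall ?_
                rw [hb]
                linarith
              · nlinarith
              · refine Metric.closedBall_subset_closedBall ?_
                have : 1 ≤ b := by
                  rw [hb]
                  exact le_add_of_nonneg_left (by positivity)
                nlinarith
          _ ≤ C * μ (level F k) := by
              rw [ENNReal.tsum_mul_left]
              gcongr
              exact (W k).tsum_measure_le (isOpen_level hF k) μ
    _ ≤ _ := by
        rw [ENNReal.tsum_mul_left, mul_assoc]
        gcongr
        exact tsum_measure_level_le hp hF μ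

/-- A bounded function of the right size is an atom for every q simultaneously, which is why the
quasi-norms for different q are equivalent. -/
theorem isAtom_of_ae_norm_le {p : ℝ} {q : ℝ≥0∞} {w : Rn n → ℝ} {a : Rn n → ℂ} {x : Rn n} {l : ℝ}
    (hl : 0 < l) (hac : wMeasure w ≪ volume) (hpos : wMeasure w (cube x l) ≠ 0)
    (hfin : wMeasure w (cube x l) ≠ ∞) (hm : AEStronglyMeasurable a volume)
    (hs : Function.support a ⊆ cube x l)
    (hb : ∀ᵐ y, ‖a y‖ ≤ (wMeasure w).real (cube x l) ^ (-(1 / p)))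
    (hmom : volume (cube x l) < 1 → ∀ α : Fin n → ℕ, ∑ i, α i ≤ s →
      (∫ x, a x * (∏ i, ((x i : ℝ) : ℂ) ^ α i)) = 0) :
    IsAtom p q s w a := by
  refine ⟨hm, cube x l, ⟨x, l, hl, rfl⟩, hs, ?_, hmom⟩
  rw [← eLpNorm_restrict_eq_of_support_subset hs]
  refine (eLpNorm_le_of_ae_bound (ae_restrict_of_ae (hac.ae_le hb))).trans (le_of_eq ?_)
  rw [Measure.restrict_apply_univ, Measure.real,
    ← ENNReal.ofReal_rpow_of_pos (ENNReal.toReal_pos hpos hfin), ENNReal.ofReal_toReal hfin,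
    ← ENNReal.rpow_add _ _ hpos hfin, ENNReal.toReal_inv, sub_eq_add_neg]

theorem isAtom_zero (p : ℝ) (q : ℝ≥0∞) (s : ℕ) (w : Rn n → ℝ) : IsAtom p q s w 0 :=
  ⟨aestronglyMeasurable_zero, cube 0 1, ⟨0, 1, one_pos, rfl⟩, by simp, by simp, by simp⟩

theorem isSingleAtom_zero (p : ℝ) (q : ℝ≥0∞) (w : Rn n → ℝ) : IsSingleAtom p q w 0 :=
  ⟨aestronglyMeasurable_zero, by simp⟩

/-- A decomposition indexed by a countable type yields one indexed by `ℕ`. -/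
theorem exists_isAtomicDecomposition_of_hasSum {p : ℝ} (hp : 0 < p) {q : ℝ≥0∞} {w : Rn n → ℝ}
    {ι : Type*} [Countable ι] {f : Dist n} {c : ι → ℝ} {a : ι → Rn n → ℂ}
    (ha : ∀ j, IsAtom p q s w (a j)) (hc : Summable fun j => |c j| ^ p)
    (hf : ∀ φ : Test n, HasSum (fun j => (c j : ℂ) * ∫ x, a j x * (φ x : ℂ)) (f φ)) :
    ∃ c' a', IsAtomicDecomposition p q s w f c' a' ∧
      ∑' i, ‖c' i‖ ^ p = ∑' j, |c j| ^ p := by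
  obtain ⟨e, he⟩ := exists_injective_nat ι
  -- The shift by one keeps index 0 free for the single atom, which is taken to be zero.
  have hE : Function.Injective fun j => e j + 1 := fun i j hij => he (by simpa using hij)
  set E : ι → ℕ := fun j => e j + 1 with hEdef
  set c' : ℕ → ℂ := Function.extend E (fun j => (c j : ℂ)) 0 with hc'
  set a' : ℕ → Rn n → ℂ := Function.extend E a 0 with ha'
  have hnorm : (fun i => ‖c' i‖ ^ p) = Function.extend E (fun j => |c j| ^ p) 0 := by
    funext i
    by_cases hi : ∃ j, E j = i
    · obtain ⟨j, rfl⟩ := hi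
      rw [hc', hE.extend_apply, hE.extend_apply, Complex.norm_real, Real.norm_eq_abs]
    · rw [hc', Function.extend_apply' _ _ _ hi, Function.extend_apply' _ _ _ hi]
      simp [Real.zero_rpow hp.ne']
  have hsum := (hasSum_extend_zero hE).2 hc.hasSum
  rw [← hnorm] at hsum
  refine ⟨c', a', ⟨?_, ?_, hsum.summable, ?_⟩, hsum.tsum_eq⟩
  · have : ¬ ∃ j, E j = 0 := by simp [hEdef]
    rw [ha', Function.extend_apply' _ _ _ this]
    exact isSingleAtom_zero p q w
  · intro i _
    by_cases hi : ∃ j, E j = i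
    · obtain ⟨j, rfl⟩ := hi
      rw [ha', hE.extend_apply]
      exact ha j
    · rw [ha', Function.extend_apply' _ _ _ hi]
      exact isAtom_zero p q s w
  · intro φ
    have h1 : (fun i => c' i * ∫ x, a' i x * (φ x : ℂ))
        = Function.extend E (fun j => (c j : ℂ) * ∫ x, a j x * (φ x : ℂ)) 0 := by
      funext i
      by_cases hi : ∃ j, E j = i
      · obtain ⟨j, rfl⟩ := hi
        rw [hc', ha', hE.extend_apply, hE.extend_apply, hE.extend_apply]
      · rw [hc', Function.extend_apply' _ _ _ hi, Function.extend_apply' _ _ _ hi]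
        simp
    have h2 := (hasSum_extend_zero hE).2 (hf φ)
    rw [← h1] at h2
    exact h2.tendsto_sum_nat

end Decomposition

/-! ### Passage to the limit and equivalence of the quasi-norms. -/

section Equivalence

variable {n s : ℕ}

theorem continuous_monomial (γ : Fin n → ℕ) :
    Continuous fun y : Rn n => ∏ i, ((y i : ℝ) : ℂ) ^ γ i := by
  fun_prop

/-- The Calderón–Zygmund decomposition at all heights: functions that are controlled by `F` and
converge as distributions have limits that are sums of multiples of bounded pieces. -/
theorem exists_limit_pieces (n s N : ℕ) {C₀ : ℝ} (hC₀ : 0 ≤ C₀) : ∃ K : ℝ, 0 < K ∧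
    ∀ {F : Rn n → ℝ≥0∞} (_ : LowerSemicontinuous F) (_ : ∀ᵐ x, F x ≠ ∞)
      (W : ∀ k, Whitney (level F k)) {r p : ℝ} {μ : Measure (Rn n)} (_ : BallWeight r μ) (_ : 0 < r)
      (_ : 0 < p) (_ : n * r ≤ p * (n + s + 1 : ℕ))
      (_ : Summable fun j : Σ k : ℤ, (W k).A => K * (2 : ℝ) ^ j.1 *
        μ.real (cube ((W j.1).x j.2) (512 * (W j.1).rad j.2)) ^ (1 / p))
      {g : ℕ → Rn n → ℂ} (_ : ∀ m, Controlled N F C₀ (g m)) {f : Dist n}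
      (_ : ∀ φ : Test n, Tendsto (fun m => ∫ x, g m x * (φ x : ℂ)) atTop (𝓝 (f φ))),
    ∃ h : (Σ k : ℤ, (W k).A) → Rn n → ℂ,
      (∀ j, AEStronglyMeasurable (h j) volume) ∧ (∀ j, ∀ᵐ y, ‖h j y‖ ≤ K * (2 : ℝ) ^ j.1) ∧
      (∀ j y, 10 * (W j.1).rad j.2 < dist y ((W j.1).x j.2) → h j y = 0) ∧
      (∀ j, (W j.1).rad j.2 < 1 / 512 → ∀ γ : Fin n → ℕ, ∑ i, γ i ≤ s →
        ∫ y, h j y * ∏ i, ((y i : ℝ) : ℂ) ^ γ i = 0) ∧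
      ∀ φ : Test n, HasSum (fun j => ∫ y, h j y * (φ y : ℂ)) (f φ) := by
  obtain ⟨K, hK, hpieces⟩ := exists_pieces n s N hC₀
  refine ⟨K, hK, ?_⟩
  intro F hF hfin W r p μ hμ hr hp hnr hsum g hg f hgf
  choose v hvm hvb hvs hvmom hvsum using fun m => hpieces hF hfin W (hg m)
  have hvmom' : ∀ m j, (W j.1).rad j.2 < 1 / 512 → ∀ γ : Fin n → ℕ, ∑ i, γ i ≤ s →
      ∫ y, v m j y * ∏ i, ((y i : ℝ) : ℂ) ^ γ i = 0 := by
    intro m j hj γ hγ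
    refine hvmom m j ?_ γ fun i =>
      (Finset.single_le_sum (f := γ) (fun _ _ => Nat.zero_le _) (Finset.mem_univ i)).trans hγ
    unfold Whitney.rad at hj
    linarith
  -- One ultrafilter serves all pieces at once, so no diagonal subsequence is needed.
  set U : Ultrafilter ℕ := hyperfilter ℕ with hU
  have hUle : (U : Filter ℕ) ≤ atTop := by
    rw [← Nat.cofinite_eq_atTop]
    exact hyperfilter_le_cofinite
  choose h hhm hhb hhs hhlim using fun j =>
    exists_weak_limit U (fun m => hvm m j) (fun m => hvb m j) (fun m => hvs m j)
  refine ⟨h, hhm, hhb, hhs, ?_, ?_⟩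
  · intro j hj γ hγ
    have h1 := hhlim j _ (continuous_monomial γ)
    simp only [hvmom' _ j hj γ hγ] at h1
    exact (tendsto_nhds_unique h1 tendsto_const_nhds)
  · intro φ
    obtain ⟨C, hC, hbd⟩ := hμ.exists_norm_integral_mul_le hr hp hnr φ
    set l : (Σ k : ℤ, (W k).A) → ℝ := fun j => K * (2 : ℝ) ^ j.1 *
        μ.real (cube ((W j.1).x j.2) (512 * (W j.1).rad j.2)) ^ (1 / p) with hl
    have hb : ∀ m j, ‖∫ y, v m j y * (φ y : ℂ)‖ ≤ C * l j := by
      intro m j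
      have h1 := hbd (v m j) _ _ _ (hvm m j).aestronglyMeasurable (by positivity) (hvb m j)
        ((W j.1).rad_pos (isOpen_level hF j.1) j.2) ((W j.1).rad_le j.2) (hvs m j) (hvmom' m j)
      refine h1.trans (le_of_eq ?_)
      rw [hl]
      ring
    have hlim : ∀ j, Tendsto (fun m => ∫ y, v m j y * (φ y : ℂ)) U
        (𝓝 (∫ y, h j y * (φ y : ℂ))) := fun j =>
      hhlim j _ (Complex.continuous_ofReal.comp φ.contDiff.continuous)
    have hb' : ∀ j, ‖∫ y, h j y * (φ y : ℂ)‖ ≤ C * l j := fun j =>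
      le_of_tendsto (hlim j).norm (Eventually.of_forall fun m => hb m j)
    have hCl : Summable fun j => C * l j := hsum.mul_left C
    -- The pairings are dominated by C·l j, uniformly in m. The same bound supplies the summability
    -- under which the pieces of each g_m add up to g_m.
    have h1 := tendsto_tsum_of_dominated_convergence hCl hlim
      (Eventually.of_forall fun m j => hb m j)
    have h2 : Tendsto (fun m => ∑' j, ∫ y, v m j y * (φ y : ℂ)) U (𝓝 (f φ)) := by
      refine ((hgf φ).mono_left hUle).congr fun m => ?_
      exact (hvsum m φ (Summable.of_norm_bounded hCl (hb m))).symm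
    rw [← tendsto_nhds_unique h1 h2]
    exact (Summable.of_norm_bounded hCl hb').hasSum

/-- The order `N` is arbitrary here; only the number s of moments matters, through the convergence
of the series. The lower bound on `N` is needed solely for the converse estimate. -/
theorem exists_isAtomicDecomposition (hn : 1 ≤ n) {w : Rn n → ℝ}
    (hw : IsLocalAInfty w) {q : ℝ≥0∞} (hq : ENNReal.ofReal (criticalIndex w) < q) {p : ℝ}
    (hp : 0 < p) (hp1 : p ≤ 1) (hs : momentOrder p w ≤ (s : ℤ)) (N : ℕ) :
    ∃ C : ℝ≥0∞, C ≠ ∞ ∧ ∀ f : Dist n, hardyNorm p w N f < ∞ →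
      ∃ (c : ℕ → ℂ) (a : ℕ → Rn n → ℂ), IsAtomicDecomposition p q s w f c a ∧
        ENNReal.ofReal ((∑' i, ‖c i‖ ^ p) ^ (1 / p)) ≤ C * hardyNorm p w N f := by
  have h1w := hw.one_le_criticalIndex
  obtain ⟨r, hr, -, hnr⟩ := exists_exponent hn hq hp (by linarith)
  have hr0 : 0 < r := by linarith
  have hnr' : n * r ≤ p * (n + s + 1 : ℕ) := by
    refine hnr.le.trans (mul_le_mul_of_nonneg_left ?_ hp.le)
    have : (max 0 (momentOrder p w)).toNat ≤ s := by omega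
    exact_mod_cast (by omega : n + (max 0 (momentOrder p w)).toNat + 1 ≤ n + s + 1)
  have hμ := exists_ballWeight hw hr0 hr
  set μ := wMeasure w with hμdef
  obtain ⟨C₀, hC₀, happ⟩ := exists_controlled_approximation n N
  obtain ⟨K, hK, hlim⟩ := exists_limit_pieces n s N hC₀.le
  obtain ⟨C, hC, hcube⟩ := hμ.exists_tsum_cube_le hr0 hp
  refine ⟨(ENNReal.ofReal (K ^ p) * C) ^ (1 / p), ENNReal.rpow_ne_top_of_nonneg (by positivity)
    (ENNReal.mul_ne_top ENNReal.ofReal_ne_top hC), ?_⟩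
  intro f hf
  set F := grandMaximal N f with hFdef
  have hF : LowerSemicontinuous F := lowerSemicontinuous_grandMaximal N f
  have hI : ∫⁻ x, F x ^ p ∂μ < ∞ := by
    by_contra hc
    rw [hardyNorm, not_lt_top_iff.1 hc, ENNReal.top_rpow_of_pos (by positivity)] at hf
    exact lt_irrefl _ hf
  have hfin : ∀ᵐ x, F x ≠ ∞ := by
    refine hμ.ac'.ae_le ?_
    filter_upwards [ae_lt_top (hF.measurable.pow_const p) hI.ne] with x hx hx'
    rw [hx', ENNReal.top_rpow_of_pos hp] at hx
    exact lt_irrefl _ hx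
  let W : ∀ k, Whitney (level F k) := fun k => (exists_whitney (isOpen_level hF k)).some
  have hrad : ∀ j : Σ k : ℤ, (W k).A, 0 < (W j.1).rad j.2 := fun j =>
    (W j.1).rad_pos (isOpen_level hF j.1) j.2
  set Q : (Σ k : ℤ, (W k).A) → Set (Rn n) := fun j =>
    cube ((W j.1).x j.2) (512 * (W j.1).rad j.2) with hQ
  have hQfin : ∀ j, μ (Q j) ≠ ∞ := fun j => (hμ.lt_top _ (isBounded_cube _ _)).ne
  have hball : ∀ j, Metric.closedBall ((W j.1).x j.2) (10 * (W j.1).rad j.2) ⊆ Q j := fun j =>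
    (closedBall_subset_cube _ _).trans fun y hy i => (hy i).trans (by linarith [hrad j])
  have hQpos : ∀ j, μ (Q j) ≠ 0 := fun j =>
    ((hμ.measure_closedBall_pos _ (by linarith [hrad j])).trans_le (measure_mono (hball j))).ne'
  have hQreal : ∀ j, 0 < μ.real (Q j) := fun j => ENNReal.toReal_pos (hQpos j) (hQfin j)
  -- The size of a piece divided by the size allowed for an atom on its cube.
  set l : (Σ k : ℤ, (W k).A) → ℝ := fun j => K * (2 : ℝ) ^ j.1 * μ.real (Q j) ^ (1 / p) with hl
  have hlpos : ∀ j, 0 < l j := fun j => by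
    have := hQreal j
    positivity
  have hlp : ∀ j, ENNReal.ofReal (l j) ^ p
      = ENNReal.ofReal (K ^ p) * (ENNReal.ofReal (((2 : ℝ) ^ j.1) ^ p) * μ (Q j)) := by
    intro j
    rw [ENNReal.ofReal_rpow_of_pos (hlpos j), ← ENNReal.ofReal_toReal (hQfin j),
      ← ENNReal.ofReal_mul (by positivity), ← ENNReal.ofReal_mul (by positivity), hl]
    congr 1
    have := hQreal j
    rw [Real.mul_rpow (by positivity) (by positivity), Real.mul_rpow (by positivity)
      (by positivity), ← Real.rpow_mul (by positivity), one_div_mul_cancel hp.ne', Real.rpow_one,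
      mul_assoc]
    rfl
  have hsum : ∑' j, ENNReal.ofReal (l j) ^ p
      ≤ ENNReal.ofReal (K ^ p) * C * ∫⁻ x, F x ^ p ∂μ := by
    simp only [hlp]
    rw [ENNReal.tsum_mul_left, mul_assoc]
    gcongr
    exact hcube hF W
  have hsumtop : ∑' j, ENNReal.ofReal (l j) ^ p ≠ ∞ := ne_top_of_le_ne_top
    (ENNReal.mul_ne_top (ENNReal.mul_ne_top ENNReal.ofReal_ne_top hC) hI.ne) hsum
  -- As p ≤ 1, summability of the p-th powers implies summability, which is what the limit in the
  -- sense of distributions requires.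
  have hlsum : Summable l := by
    have h1 : ∑' j, ENNReal.ofReal (l j) ≠ ∞ := by
      intro h2
      have h3 := rpow_tsum_le_tsum_rpow (fun j => ENNReal.ofReal (l j)) hp hp1
      rw [h2, ENNReal.top_rpow_of_pos hp] at h3
      exact hsumtop (top_le_iff.1 h3)
    refine (ENNReal.summable_toReal h1).congr fun j => ?_
    rw [ENNReal.toReal_ofReal (hlpos j).le]
  have hlpR : ∀ j, (ENNReal.ofReal (l j) ^ p).toReal = |l j| ^ p := fun j => by
    rw [ENNReal.ofReal_rpow_of_pos (hlpos j), ENNReal.toReal_ofReal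
      (Real.rpow_nonneg (hlpos j).le _), abs_of_pos (hlpos j)]
  have hlpsum : Summable fun j => |l j| ^ p :=
    (ENNReal.summable_toReal hsumtop).congr hlpR
  obtain ⟨g, hg, hgf⟩ := happ f
  obtain ⟨h, hhm, hhb, hhs, hhmom, hhsum⟩ := hlim hF hfin W hμ hr0 hp hnr' hlsum hg hgf
  have hatom : ∀ j, IsAtom p q s w fun y => ((l j)⁻¹ : ℂ) * h j y := by
    intro j
    refine isAtom_of_ae_norm_le (x := (W j.1).x j.2) (l := 512 * (W j.1).rad j.2)
      (by linarith [hrad j]) hμ.ac (hQpos j) (hQfin j) ((hhm j).const_mul _) ?_ ?_ ?_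
    · intro y hy
      refine hball j ?_
      by_contra hc
      rw [Metric.mem_closedBall, not_le] at hc
      exact hy (by simp [hhs j y hc])
    · filter_upwards [hhb j] with y hy
      rw [norm_mul, norm_inv, Complex.norm_real, Real.norm_of_nonneg (hlpos j).le]
      have h2 := hQreal j
      calc (l j)⁻¹ * ‖h j y‖ ≤ (l j)⁻¹ * (K * (2 : ℝ) ^ j.1) :=
            mul_le_mul_of_nonneg_left hy (inv_nonneg.2 (hlpos j).le)
        _ = μ.real (Q j) ^ (-(1 / p)) := by
            rw [hl, Real.rpow_neg h2.le]
            have : 0 < μ.real (Q j) ^ (1 / p) := Real.rpow_pos_of_pos h2 _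
            field_simp
    · intro hv γ hγ
      -- The factor 512 in the cubes is chosen so that side less than one means exactly radius below
      -- 1/512, that is depth below 1/16, the range in which the pieces have vanishing moments.
      have h2 : (W j.1).rad j.2 < 1 / 512 := by
        by_contra hc
        rw [volume_cube] at hv
        refine absurd hv (not_lt.2 (one_le_pow₀ ?_))
        rw [ENNReal.one_le_ofReal]
        linarith
      simp only [mul_assoc]
      rw [integral_const_mul, hhmom j h2 γ hγ, mul_zero]
  obtain ⟨c, a, hca, hceq⟩ := exists_isAtomicDecomposition_of_hasSum hp hatom hlpsum fun φ => by
    convert hhsum φ using 2 with j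
    have h2 : (l j : ℂ) ≠ 0 := by exact_mod_cast (hlpos j).ne'
    simp only [mul_assoc]
    rw [integral_const_mul, mul_inv_cancel_left₀ h2]
  refine ⟨c, a, hca, ?_⟩
  rw [hceq, hardyNorm, ← ENNReal.mul_rpow_of_nonneg _ _ (by positivity),
    ← ENNReal.ofReal_rpow_of_nonneg (tsum_nonneg fun j => by positivity) (by positivity)]
  refine ENNReal.rpow_le_rpow (le_trans (le_of_eq ?_) hsum) (by positivity)
  rw [ENNReal.ofReal_tsum_of_nonneg (fun j => by positivity) hlpsum]
  refine tsum_congr fun j => ?_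
  rw [← hlpR, ENNReal.ofReal_toReal]
  exact ENNReal.rpow_ne_top_of_nonneg hp.le ENNReal.ofReal_ne_top

theorem grandMaximal_anti {N N' : ℕ} (h : N' ≤ N) (f : Dist n) (x : Rn n) :
    grandMaximal N f x ≤ grandMaximal N' f x := by
  unfold grandMaximal
  refine iSup_mono fun t => iSup_mono fun ht => iSup_mono fun ht1 => iSup_mono fun φ => ?_
  exact iSup_le fun hφ => le_iSup_of_le ⟨hφ.1, hφ.2.1, fun k hk => hφ.2.2 k (by omega)⟩ le_rfl

theorem hardyNorm_anti {p : ℝ} (hp : 0 < p) (w : Rn n → ℝ) {N N' : ℕ} (h : N' ≤ N) (f : Dist n) :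
    hardyNorm p w N f ≤ hardyNorm p w N' f := by
  unfold hardyNorm
  refine ENNReal.rpow_le_rpow (lintegral_mono fun x => ?_) (by positivity)
  exact ENNReal.rpow_le_rpow (grandMaximal_anti h f x) hp.le

/-- The constants of the two inclusions may be chosen equal. -/
theorem exists_norm_equivalence (hn : 1 ≤ n) {w : Rn n → ℝ}
    (hw : IsLocalAInfty w) {q : ℝ≥0∞} (hq : ENNReal.ofReal (criticalIndex w) < q) {p : ℝ}
    (hp : 0 < p) (hp1 : p ≤ 1) (hs : momentOrder p w ≤ (s : ℤ)) (N : ℕ) :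
    ∃ C : ℝ≥0, 1 ≤ C ∧
      (∀ f ∈ atomicSpace p q s w, hardyNorm p w (hardyOrder p w) f ≤ C * atomicNorm p q s w f) ∧
      (∀ f ∈ atomicSpace p q s w, hardyNorm p w (hardyOrder p w) f < ∞) ∧
      ∀ f, hardyNorm p w N f < ∞ → f ∈ atomicSpace p q s w ∧
        atomicNorm p q s w f ≤ C * hardyNorm p w N f := by
  obtain ⟨A, hA, hA'⟩ := exists_hardyNorm_le_of_isAtomicDecomposition hn hw hq hp hp1 hs
  obtain ⟨B, hB, hB'⟩ := exists_isAtomicDecomposition hn hw hq hp hp1 hs N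
  lift A to ℝ≥0 using hA
  lift B to ℝ≥0 using hB
  -- The summand 1 makes the constant nonzero, so that one can divide by it before taking the
  -- infimum over decompositions, and at least 1, as used when the constants are merged.
  refine ⟨1 + A + B, by rw [add_assoc]; exact le_self_add, ?_, ?_, ?_⟩
  · intro f _
    have hC : (A : ℝ≥0∞) ≤ ((1 + A + B : ℝ≥0) : ℝ≥0∞) := by
      exact_mod_cast (le_add_self.trans le_self_add : A ≤ 1 + A + B)
    have h0 : ((1 + A + B : ℝ≥0) : ℝ≥0∞) ≠ 0 := by
      rw [add_assoc]
      exact_mod_cast (lt_of_lt_of_le one_pos (le_self_add : (1 : ℝ≥0) ≤ 1 + (A + B))).ne'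
    rw [mul_comm, ← ENNReal.div_le_iff_le_mul (Or.inl h0) (Or.inl ENNReal.coe_ne_top)]
    refine le_iInf fun c => le_iInf fun a => le_iInf fun hca => ?_
    refine ENNReal.div_le_of_le_mul' ((hA' f c a hca).trans ?_)
    gcongr
  · rintro f ⟨c, a, hca⟩
    exact (hA' f c a hca).trans_lt (ENNReal.mul_lt_top ENNReal.coe_lt_top ENNReal.ofReal_lt_top)
  · intro f hf
    obtain ⟨c, a, hca, hle⟩ := hB' f hf
    refine ⟨⟨c, a, hca⟩, ?_⟩
    have h1 : atomicNorm p q s w f ≤ B * hardyNorm p w N f :=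
      iInf_le_of_le c (iInf_le_of_le a (iInf_le_of_le hca hle))
    refine h1.trans ?_
    gcongr
    exact le_add_self

end Equivalence

end LocalHardy

end

/-! ### The theorem: closing the cycle of inclusions. -/

theorem theorem5p1 (n : ℕ) (hn : 1 ≤ n) (w : LocalHardy.Rn n → ℝ)
    (hw : LocalHardy.IsLocalAInfty w)
    (q : ℝ≥0∞) (hq : ENNReal.ofReal (LocalHardy.criticalIndex w) < q)
    (p : ℝ) (hp0 : 0 < p) (hp1 : p ≤ 1)
    (N : ℕ) (hN : LocalHardy.hardyOrder p w ≤ N)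
    (s : ℕ) (hs : LocalHardy.momentOrder p w ≤ (s : ℤ)) :
    LocalHardy.atomicSpace p q s w = LocalHardy.hardySpace p w N ∧
    LocalHardy.hardySpace p w N = LocalHardy.hardySpace p w (LocalHardy.hardyOrder p w) ∧
    ∃ C : ℝ≥0, ∀ f ∈ LocalHardy.atomicSpace p q s w,
      LocalHardy.atomicNorm p q s w f ≤ C * LocalHardy.hardyNorm p w N f ∧
      LocalHardy.hardyNorm p w N f ≤ C * LocalHardy.atomicNorm p q s w f ∧
      LocalHardy.hardyNorm p w (LocalHardy.hardyOrder p w) f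
        ≤ C * LocalHardy.hardyNorm p w N f ∧
      LocalHardy.hardyNorm p w N f
        ≤ C * LocalHardy.hardyNorm p w (LocalHardy.hardyOrder p w) f := by
  obtain ⟨C, hC, hle, hfin, hdec⟩ :=
    LocalHardy.exists_norm_equivalence hn hw hq hp0 hp1 hs N
  have hmono := LocalHardy.hardyNorm_anti hp0 w hN
  have h1C : ∀ x : ℝ≥0∞, x ≤ C * x := fun x => le_mul_of_one_le_left' (by exact_mod_cast hC)
  have hCC : ∀ x : ℝ≥0∞, (C : ℝ≥0∞) * x ≤ (C * C : ℝ≥0) * x := fun x => by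
    rw [ENNReal.coe_mul, mul_assoc]
    exact h1C _
  -- The cycle runs from atoms to order `hardyOrder p w`, to order `N` by monotonicity, and back to
  -- atoms. The bound of the lowest order by order `N` passes through atoms and costs C².
  refine ⟨Subset.antisymm (fun f hf => (hmono f).trans_lt (hfin f hf)) fun f hf => (hdec f hf).1,
    Subset.antisymm (fun f hf => hfin f (hdec f hf).1) fun f hf => (hmono f).trans_lt hf,
    C * C, fun f hf => ?_⟩
  have hf' := (hmono f).trans_lt (hfin f hf)
  refine ⟨(hdec f hf').2.trans (hCC _), ((hmono f).trans (hle f hf)).trans (hCC _), ?_,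
    (hmono f).trans ((h1C _).trans (hCC _))⟩
  rw [ENNReal.coe_mul, mul_assoc]
  exact (hle f hf).trans (mul_le_mul_right (hdec f hf').2 _)
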